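/- Let $\alpha\in(0,1)$, $T>0$, let $P\subset\mathbb R^{n_u}$ be compact, and let $f\colon[0,T]\times\mathbb R^n\times P\to\mathbb R^n$ satisfy: (f.1) $f$ is continuous; (f.3) there is $c_f\ge 0$ with $\|f(\tau,x,u)\|\le c_f(1+\|x\|)$ for all $(\tau,x,u)$; (f.4) the partial derivatives $\partial f/\partial\tau$ (one-sided at $\tau=0$ and $\tau=T$) and $\partial f/\partial x$ exist and are continuous on $[0,T]\times\mathbb R^n\times P$. Notation. For $t\in[0,T]$, $\mathrm{AC}^\alpha([0,t],\mathbb R^n)$ is the set of all $x\colon[0,t]\to\mathbb R^n$ of the form $x(\tau)=x(0)+\frac1{\Gamma(\alpha)}\int_0^\tau(\tau-\xi)^{\alpha-1}g(\xi)\,d\xi$, $\tau\in[0,t]$, with $g$ measurable and essentially bounded, and $({}^CD^\alpha x)(\tau)=\frac1{\Gamma(1-\alpha)}\frac{d}{d\tau}\int_0^\tau\frac{x(\xi)-x(0)}{(\tau-\xi)^\alpha}\,d\xi$. Let $G^0$ be the set of pairs $(t,w)$ with $t\in[0,T)$, $w\in\mathrm{AC}^\alpha([0,t],\mathbb R^n)$.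 For $(t,w)\in G^0$ put $a(\tau\mid t,w)=w(\tau)$ for $\tau\in[0,t]$ and $$a(\tau\mid t,w)=w(0)+\frac1{\Gamma(\alpha)}\int_0^t\frac{({}^CD^\alpha w)(\xi)}{(\tau-\xi)^{1-\alpha}}\,d\xi,\qquad \tau\in(t,T].$$ For $v\in\mathbb R^n$ put $x^{(v)}(\tau\mid t,w)=w(\tau)$ for $\tau\in[0,t]$ and $x^{(v)}(\tau\mid t,w)=a(\tau\mid t,w)+\frac{(\tau-t)^\alpha}{\Gamma(\alpha+1)}v$ for $\tau\in(t,T]$; $x^{(v)}_{t+\delta}(\cdot\mid t,w)$ is its restriction to $[0,t+\delta]$. Let $X_N$ be the set of $x\in\mathrm{AC}^\alpha([0,T],\mathbb R^n)$ with $\|x(0)\|\le N$ and $\|({}^CD^\alpha x)(\tau)\|\le N(1+\|x(\tau)\|)$ for a.e. $\tau\in[0,T]$, and let $G_N^\eta$ be the set of pairs $(t,w)$ with $t\in[0,T-\eta]$ and $w=x|_{[0,t]}$ for some $x\in X_N$. Let $B(M)=\{v\in\mathbb R^n:\|v\|\le M\}$, and let $\mathcal N$ be the set of relaxed controls, i.e.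 (classes of) measurable functions $\nu$ from $[0,1]$ to the Borel probability measures on $P$. For a function $h$ on $P$ and a probability measure $\mu$ on $P$ put $h^*(\mu)=\int_P h(u)\,\mu(du)$, other arguments of $h$ being kept as parameters. For $(t,w)\in G^0$ and $\nu\in\mathcal N$ let $y(\cdot\mid t,w,\nu)\in C([0,1],\mathbb R^n)$ be the solution of $$y(\vartheta)=a(t+\vartheta(T-t)\mid t,w)+\frac{(T-t)^\alpha}{\Gamma(\alpha)}\int_0^\vartheta\frac{f^*(t+\zeta(T-t),y(\zeta),\nu(\zeta))}{(\vartheta-\zeta)^{1-\alpha}}\,d\zeta,\qquad\vartheta\in[0,1].$$ With this $y$, put $A(\vartheta,u)=(T-t)^\alpha\frac{\partial f}{\partial x}(t+\vartheta(T-t),y(\vartheta),u)$, $b(\vartheta,u)=(1-\vartheta)(T-t)^\alpha\frac{\partial f}{\partial\tau}(t+\vartheta(T-t),y(\vartheta),u)-\frac{\alpha f(t+\vartheta(T-t),y(\vartheta),u)}{(T-t)^{1-\alpha}}$, $$q(\vartheta)=-\frac{(1-\alpha)(1-\vartheta)}{\Gamma(\alpha)}\int_0^t\frac{({}^CD^\alpha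 w)(\xi)}{(t+\vartheta(T-t)-\xi)^{2-\alpha}}\,d\xi,\qquad Q(\vartheta)=\frac{\mathrm{Id}_n}{\Gamma(\alpha)\vartheta^{1-\alpha}(T-t)^{1-\alpha}},$$ and let $z=z(\cdot\mid t,w,\nu)$ and $Z=Z(\cdot\mid t,w,\nu)$ be the solutions of $$z(\vartheta)=q(\vartheta)+\frac1{\Gamma(\alpha)}\int_0^\vartheta\frac{A^*(\zeta,\nu(\zeta))z(\zeta)+b^*(\zeta,\nu(\zeta))}{(\vartheta-\zeta)^{1-\alpha}}\,d\zeta,\qquad Z(\vartheta)=Q(\vartheta)+\frac1{\Gamma(\alpha)}\int_0^\vartheta\frac{A^*(\zeta,\nu(\zeta))Z(\zeta)}{(\vartheta-\zeta)^{1-\alpha}}\,d\zeta,\qquad\vartheta\in(0,1],$$ in the classes of continuous functions on $(0,1]$, with values in $\mathbb R^n$ and $\mathbb R^{n\times n}$ respectively, whose norm multiplied by $\vartheta^{1-\alpha}$ is bounded. Claim. For all $(t,w)\in G^0$ and $\nu\in\mathcal N$ the solutions $y$, $z$, $Z$ exist and are unique. Let $N\ge c_f$, $M\ge0$ and $\eta\in(0,T)$.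 For all $(t,w)\in G_N^\eta$, $v\in B(M)$ and $\delta\in[0,\eta/2]$ one has $(t+\delta,x^{(v)}_{t+\delta}(\cdot\mid t,w))\in G^0$. There is $\lambda_y\ge0$ such that for all $(t,w)\in G_N^\eta$, $v\in B(M)$, $\nu\in\mathcal N$, $\delta\in(0,\eta/2]$ and $\vartheta\in(0,1]$, $$\left\|\frac{y(\vartheta\mid t+\delta,x^{(v)}_{t+\delta}(\cdot\mid t,w),\nu)-y(\vartheta\mid t,w,\nu)}{\delta}\right\|\le\frac{\lambda_y}{\vartheta^{1-\alpha}}.$$ Moreover, $$\left\|\frac{y(1\mid t+\delta,x^{(v)}_{t+\delta}(\cdot\mid t,w),\nu)-y(1\mid t,w,\nu)}{\delta}-z(1\mid t,w,\nu)-Z(1\mid t,w,\nu)v\right\|\to0\quad\text{as }\delta\to0^+$$ uniformly in $(t,w)\in G_N^\eta$, $v\in B(M)$ and $\nu\in\mathcal N$. -/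

import Mathlib

open Set MeasureTheory

noncomputable section

namespace FracControl

/-- The Euclidean space `ℝⁿ`. Matrices `ℝⁿˣⁿ` with the induced norm are `Vec n →L[ℝ] Vec n`. -/
abbrev Vec (n : ℕ) : Type := EuclideanSpace ℝ (Fin n)

/-! Functions on an interval `[0, t]` are represented by functions on `ℝ` of which only the values
on `[0, t]` matter, so restriction to a smaller interval needs no notation. -/

/-- The space `AC^α([0, t], ℝⁿ)`: functions `x` such that `x - x(0)` is, on `[0, t]`, the
Riemann-Liouville integral of order `α` of a measurable essentially bounded function. -/
def IsAC {n : ℕ} (α t : ℝ) (x : ℝ → Vec n) : Prop :=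
  ∃ g : ℝ → Vec n, MemLp g ⊤ (volume.restrict (Icc 0 t)) ∧
    ∀ τ ∈ Icc 0 t,
      x τ = x 0 + (1 / Real.Gamma α) • ∫ ξ in (0 : ℝ)..τ, (τ - ξ) ^ (α - 1) • g ξ

/-- The Caputo derivative of order `α`. For `x` in `AC^α([0, t], ℝⁿ)` and `τ` in `(0, t)` it depends
only on the values of `x` on `[0, t]`. -/
def caputo {n : ℕ} (α : ℝ) (x : ℝ → Vec n) (τ : ℝ) : Vec n :=
  (1 / Real.Gamma (1 - α)) •
    deriv (fun s : ℝ => ∫ ξ in (0 : ℝ)..s, (s - ξ) ^ (-α) • (x ξ - x 0)) τ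

/-- The set `G⁰` of positions `(t, w)` with `t ∈ [0, T)` and `w ∈ AC^α([0, t], ℝⁿ)`. -/
def positions (n : ℕ) (α T : ℝ) : Set (ℝ × (ℝ → Vec n)) :=
  {p | p.1 ∈ Ico 0 T ∧ IsAC α p.1 p.2}

/-- The set `X_N`. -/
def XN (n : ℕ) (α T N : ℝ) : Set (ℝ → Vec n) :=
  {x | IsAC α T x ∧ ‖x 0‖ ≤ N ∧
    ∀ᵐ τ ∂(volume.restrict (Icc 0 T)), ‖caputo α x τ‖ ≤ N * (1 + ‖x τ‖)}

/-- The set `G_N^η`: positions `(t, w)` with `t ∈ [0, T - η]` such that `w` is the restriction to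
`[0, t]` of some element of `X_N`. -/
def GNη (n : ℕ) (α T N η : ℝ) : Set (ℝ × (ℝ → Vec n)) :=
  {p | p.1 ∈ Icc 0 (T - η) ∧ IsAC α p.1 p.2 ∧ ∃ x ∈ XN n α T N, EqOn p.2 x (Icc 0 p.1)}

/-- The function `a(· | t, w)`: the continuation of `w` with zero Caputo derivative after `t`. -/
def aExt {n : ℕ} (α t : ℝ) (w : ℝ → Vec n) (τ : ℝ) : Vec n :=
  if τ ≤ t then w τ
  else w 0 + (1 / Real.Gamma α) • ∫ ξ in (0 : ℝ)..t, (τ - ξ) ^ (α - 1) • caputo α w ξ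

/-- The function `x^(v)(· | t, w)`: the continuation of `w` with Caputo derivative `v` after `t`. -/
def xDir {n : ℕ} (α t : ℝ) (w : ℝ → Vec n) (v : Vec n) (τ : ℝ) : Vec n :=
  if τ ≤ t then w τ
  else aExt α t w τ + ((τ - t) ^ α / Real.Gamma (α + 1)) • v

/-- The relaxed controls on `[0, 1]`: (representatives of) measurable functions from `[0, 1]` to the
Borel probability measures on `P`. The values are required to depend measurably on time for the
`σ`-algebra generated by the evaluations at Borel sets, which for compact `P` is the Borel
`σ`-algebra of weak convergence; all finite Borel measures on `P` are regular. -/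
def IsRelaxedControl {m : ℕ} {P : Set (Vec m)} (ν : ℝ → ProbabilityMeasure P) : Prop :=
  AEMeasurable ν (volume.restrict (Icc 0 1))

section RightHandSide

variable {n m : ℕ} (T α : ℝ) {P : Set (Vec m)} (f : ℝ → Vec n → Vec m → Vec n)

/-- The partial derivative `∂f/∂τ`, one-sided at `τ = 0` and `τ = T`. -/
def dtau (τ : ℝ) (x : Vec n) (u : Vec m) : Vec n :=
  derivWithin (fun s => f s x u) (Icc 0 T) τ

/-- The partial derivative `∂f/∂x`. -/
def dx (τ : ℝ) (x : Vec n) (u : Vec m) : Vec n →L[ℝ] Vec n :=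
  fderiv ℝ (fun x' => f τ x' u) x

/-- `f` is continuous on `[0, T] × ℝⁿ × P`. -/
def CondF1 (P : Set (Vec m)) : Prop :=
  ContinuousOn (fun q : ℝ × Vec n × Vec m => f q.1 q.2.1 q.2.2) (Icc 0 T ×ˢ univ ×ˢ P)

/-- Sublinear growth of `f` with the constant `c`. -/
def CondF3 (P : Set (Vec m)) (c : ℝ) : Prop :=
  ∀ τ ∈ Icc 0 T, ∀ x : Vec n, ∀ u ∈ P, ‖f τ x u‖ ≤ c * (1 + ‖x‖)

/-- `∂f/∂τ` and `∂f/∂x` exist and are continuous on `[0, T] × ℝⁿ × P`. -/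
def CondF4 (P : Set (Vec m)) : Prop :=
  (∀ τ ∈ Icc 0 T, ∀ x : Vec n, ∀ u ∈ P,
    DifferentiableWithinAt ℝ (fun s => f s x u) (Icc 0 T) τ ∧
    DifferentiableAt ℝ (fun x' => f τ x' u) x) ∧
  ContinuousOn (fun q : ℝ × Vec n × Vec m => dtau T f q.1 q.2.1 q.2.2)
    (Icc 0 T ×ˢ univ ×ˢ P) ∧
  ContinuousOn (fun q : ℝ × Vec n × Vec m => dx f q.1 q.2.1 q.2.2)
    (Icc 0 T ×ˢ univ ×ˢ P)

/-- `f*(τ, x, μ) = ∫ f(τ, x, u) μ(du)`. -/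
def fStar (τ : ℝ) (x : Vec n) (μ : ProbabilityMeasure P) : Vec n :=
  ∫ u, f τ x (u : Vec m) ∂(μ : Measure P)

/-- `y` is a solution `y(· | t, w, ν) ∈ C([0, 1], ℝⁿ)` of the auxiliary Volterra equation. -/
def IsY (t : ℝ) (w : ℝ → Vec n) (ν : ℝ → ProbabilityMeasure P) (y : ℝ → Vec n) : Prop :=
  ContinuousOn y (Icc 0 1) ∧
  ∀ ϑ ∈ Icc (0 : ℝ) 1,
    y ϑ = aExt α t w (t + ϑ * (T - t)) +
      ((T - t) ^ α / Real.Gamma α) •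
        ∫ ζ in (0 : ℝ)..ϑ, (ϑ - ζ) ^ (α - 1) • fStar f (t + ζ * (T - t)) (y ζ) (ν ζ)

/-- The free term `q` of the equation for `z`. -/
def qFun (t : ℝ) (w : ℝ → Vec n) (ϑ : ℝ) : Vec n :=
  -((1 - α) * (1 - ϑ) / Real.Gamma α) •
    ∫ ξ in (0 : ℝ)..t, (t + ϑ * (T - t) - ξ) ^ (α - 2) • caputo α w ξ

/-- The free term `Q` of the equation for `Z`. -/
def QFun (n : ℕ) (t ϑ : ℝ) : Vec n →L[ℝ] Vec n :=
  (1 / (Real.Gamma α * ϑ ^ (1 - α) * (T - t) ^ (1 - α))) • ContinuousLinearMap.id ℝ (Vec n)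

/-- `A(ϑ, u)` along the function `y`. -/
def AFun (t : ℝ) (y : ℝ → Vec n) (ϑ : ℝ) (u : Vec m) : Vec n →L[ℝ] Vec n :=
  (T - t) ^ α • dx f (t + ϑ * (T - t)) (y ϑ) u

/-- `b(ϑ, u)` along the function `y`. -/
def bFun (t : ℝ) (y : ℝ → Vec n) (ϑ : ℝ) (u : Vec m) : Vec n :=
  ((1 - ϑ) * (T - t) ^ α) • dtau T f (t + ϑ * (T - t)) (y ϑ) u -
    (α / (T - t) ^ (1 - α)) • f (t + ϑ * (T - t)) (y ϑ) u

/-- `A*(ϑ, μ) = ∫ A(ϑ, u) μ(du)`. -/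
def AStar (t : ℝ) (y : ℝ → Vec n) (ϑ : ℝ) (μ : ProbabilityMeasure P) : Vec n →L[ℝ] Vec n :=
  ∫ u, AFun T α f t y ϑ (u : Vec m) ∂(μ : Measure P)

/-- `b*(ϑ, μ) = ∫ b(ϑ, u) μ(du)`. -/
def bStar (t : ℝ) (y : ℝ → Vec n) (ϑ : ℝ) (μ : ProbabilityMeasure P) : Vec n :=
  ∫ u, bFun T α f t y ϑ (u : Vec m) ∂(μ : Measure P)

/-- The space `C^(1-α)((0, 1], F)`. -/
def IsCWeighted {F : Type} [NormedAddCommGroup F] (α : ℝ) (q : ℝ → F) : Prop :=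
  ContinuousOn q (Ioc 0 1) ∧ ∃ C : ℝ, ∀ ϑ ∈ Ioc (0 : ℝ) 1, ϑ ^ (1 - α) * ‖q ϑ‖ ≤ C

/-- `z` is a solution `z(· | t, w, ν)` of the first linear Volterra equation, where
`y = y(· | t, w, ν)`. -/
def IsZvec (t : ℝ) (w : ℝ → Vec n) (ν : ℝ → ProbabilityMeasure P) (y z : ℝ → Vec n) : Prop :=
  IsCWeighted α z ∧
  ∀ ϑ ∈ Ioc (0 : ℝ) 1,
    z ϑ = qFun T α t w ϑ + (1 / Real.Gamma α) •
      ∫ ζ in (0 : ℝ)..ϑ, (ϑ - ζ) ^ (α - 1) •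
        (AStar T α f t y ζ (ν ζ) (z ζ) + bStar T α f t y ζ (ν ζ))

/-- `Z` is a solution `Z(· | t, w, ν)` of the second linear Volterra equation, where
`y = y(· | t, w, ν)`. -/
def IsZmat (t : ℝ) (ν : ℝ → ProbabilityMeasure P) (y : ℝ → Vec n)
    (Z : ℝ → Vec n →L[ℝ] Vec n) : Prop :=
  IsCWeighted α Z ∧
  ∀ ϑ ∈ Ioc (0 : ℝ) 1,
    Z ϑ = QFun T α n t ϑ + (1 / Real.Gamma α) •
      ∫ ζ in (0 : ℝ)..ϑ, (ϑ - ζ) ^ (α - 1) •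
        (AStar T α f t y ζ (ν ζ)).comp (Z ζ)

end RightHandSide

end FracControl

end

open FracControl

noncomputable section

open Filter Topology

namespace FracControl

/-! ### Weakly singular kernels -/

/-! On the fixed interval [0, 1] both `y` and its perturbation solve Volterra equations with the
same control, so one can differentiate in δ. The derivative of the free term is q + Qv, and that of
the rescaled right-hand side at frozen control is A·(derivative of y) + b. Formally the derivative
of y therefore solves the linear equation satisfied by z + Zv, and the task is to make this rigorous
uniformly in (t, w), v and ν.

The obstacle is the end ϑ = 0. There q and Q blow up like ϑ^(α-1), and for ϑ small against δ the
difference quotient need not be close to its limit, even after division by ϑ^(α-1). The remedy is to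
measure errors in the weaker weight ϑ^(α/2-1). The error is at most Cϑ^(α-1) everywhere and small
for ϑ ≥ ϑ₀; since ϑ^(α-1) = ϑ^(α/2)·ϑ^(α/2-1), it is at most εϑ^(α/2-1) on all of (0, 1]
(`le_mul_rpow_half`). This is done for the free term (`exists_freeTerm_error_le`) and for the
right-hand side (`exists_rhs_error_le`). A Gronwall inequality for singular kernels and singular
functions (`exists_gronwall_const`, `exists_gronwall_perturbed`) carries the smallness to the
solution, and at ϑ = 1 every weight equals 1.

Uniformity has two sources. By the same Gronwall inequality all elements of `XN` have generators
bounded by one constant (`exists_generator_of_mem_XN`), which bounds all trajectories `y` at once;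
on the resulting compact set f and its derivatives are bounded and uniformly continuous. Caputo
derivatives enter only through generators, by `IsGenerator.caputo_ae`. Existence comes from a
contraction in a space weighted by ϑ^(β-1)exp(kϑ), and uniqueness from the Gronwall inequality. -/

/-- The Riemann-Liouville integral of order `α` without the normalizing factor. -/
def fracInt {E : Type*} [NormedAddCommGroup E] [NormedSpace ℝ E] (α : ℝ) (h : ℝ → E) (τ : ℝ) : E :=
  ∫ ζ in (0 : ℝ)..τ, (τ - ζ) ^ (α - 1) • h ζ

/-- Scaling by τ reduces this to Euler's Beta integral. The proof casts everything to ℂ, where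
`Complex.betaIntegral_scaled` applies, and casts back. -/
theorem integral_kernel_mul_rpow {α β τ : ℝ} (hα : 0 < α) (hβ : 0 < β) (hτ : 0 < τ) :
    ∫ ζ in (0 : ℝ)..τ, (τ - ζ) ^ (α - 1) * ζ ^ (β - 1) =
      τ ^ (α + β - 1) * ProbabilityTheory.beta α β := by
  have h := Complex.betaIntegral_scaled (β : ℂ) (α : ℂ) hτ
  have hb : Complex.betaIntegral β α = ((ProbabilityTheory.beta α β : ℝ) : ℂ) := by
    rw [Complex.betaIntegral_eq_Gamma_mul_div _ _ (by simpa) (by simpa), ProbabilityTheory.beta]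
    simp only [← Complex.ofReal_add, Complex.Gamma_ofReal]
    push_cast
    rw [mul_comm, add_comm]
  rw [hb] at h
  have e : ∫ x in (0 : ℝ)..τ, (x : ℂ) ^ ((β : ℂ) - 1) * ((τ : ℂ) - x) ^ ((α : ℂ) - 1) =
      ∫ x in (0 : ℝ)..τ, (((τ - x) ^ (α - 1) * x ^ (β - 1) : ℝ) : ℂ) := by
    refine intervalIntegral.integral_congr fun x hx => ?_
    rw [uIcc_of_le hτ.le] at hx
    have h1 : 0 ≤ τ - x := sub_nonneg.2 hx.2
    push_cast [Complex.ofReal_cpow h1, Complex.ofReal_cpow hx.1]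
    ring
  rw [e, intervalIntegral.integral_ofReal] at h
  have h2 : (τ : ℂ) ^ ((β : ℂ) + α - 1) = ((τ ^ (α + β - 1) : ℝ) : ℂ) := by
    push_cast [Complex.ofReal_cpow hτ.le]
    ring_nf
  rw [h2, ← Complex.ofReal_mul] at h
  exact_mod_cast h

/-- Integrability follows from the value of the integral: a non-integrable function has integral 0
by convention, whereas the Beta value is positive. -/
theorem intervalIntegrable_kernel_mul_rpow {α β τ : ℝ} (hα : 0 < α) (hβ : 0 < β) (hτ : 0 ≤ τ) :
    IntervalIntegrable (fun ζ => (τ - ζ) ^ (α - 1) * ζ ^ (β - 1)) volume 0 τ := by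
  rcases hτ.eq_or_lt with rfl | hτ
  · simp
  by_contra hn
  have h := integral_kernel_mul_rpow hα hβ hτ
  rw [intervalIntegral.integral_undef hn] at h
  have := mul_pos (Real.rpow_pos_of_pos hτ (α + β - 1)) (ProbabilityTheory.beta_pos hα hβ)
  linarith

theorem intervalIntegrable_kernel_mul_rpow_mul_exp {α β τ : ℝ} (k : ℝ) (hα : 0 < α) (hβ : 0 < β)
    (hτ : 0 ≤ τ) :
    IntervalIntegrable (fun ζ => (τ - ζ) ^ (α - 1) * (ζ ^ (β - 1) * Real.exp (k * ζ)))
      volume 0 τ := by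
  simp only [← mul_assoc]
  exact (intervalIntegrable_kernel_mul_rpow hα hβ hτ).mul_continuousOn (by fun_prop)

/-- Holds because x^γ ≤ max(1, x) ≤ exp x. It trades exponential decay for a negative power that a
weakly singular kernel can absorb. -/
theorem exp_neg_le_rpow_neg {x γ : ℝ} (hx : 0 < x) (hγ : γ ∈ Icc (0 : ℝ) 1) :
    Real.exp (-x) ≤ x ^ (-γ) := by
  rw [Real.exp_neg, Real.rpow_neg hx.le]
  refine inv_anti₀ (Real.rpow_pos_of_pos hx _) ?_
  rcases le_total x 1 with h | h
  · exact (Real.rpow_le_one hx.le h hγ.1).trans (Real.one_le_exp hx.le)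
  · calc x ^ γ ≤ x ^ (1 : ℝ) := Real.rpow_le_rpow_of_exponent_le h hγ.2
      _ = x := Real.rpow_one x
      _ ≤ Real.exp x := (by linarith [Real.add_one_le_exp x])

/-- With an exponential weight the Abel operator becomes a contraction in the space of functions
with a power singularity at zero. -/
theorem exists_exp_kernel_le {α β b ε : ℝ} (hα : α ∈ Ioo (0 : ℝ) 1) (hβ : 0 < β)
    (hε : 0 < ε) :
    ∃ k : ℝ, 0 < k ∧ ∀ τ ∈ Ioc 0 b,
      ∫ ζ in (0 : ℝ)..τ, (τ - ζ) ^ (α - 1) * (ζ ^ (β - 1) * Real.exp (k * ζ)) ≤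
        ε * (τ ^ (β - 1) * Real.exp (k * τ)) := by
  have hα2 : 0 < α / 2 := half_pos hα.1
  set B := ProbabilityTheory.beta (α / 2) β
  have hB : 0 < B := ProbabilityTheory.beta_pos hα2 hβ
  have ht : Tendsto (fun k : ℝ => k ^ (-(α / 2)) * (B * b ^ (α / 2))) atTop (𝓝 0) := by
    simpa using (tendsto_rpow_neg_atTop hα2).mul_const (B * b ^ (α / 2))
  obtain ⟨k, hk, hkε⟩ := ((eventually_gt_atTop 0).and (ht.eventually_le_const hε)).exists
  refine ⟨k, hk, fun τ hτ => ?_⟩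
  have hp : ∀ ζ ∈ Ioo 0 τ, (τ - ζ) ^ (α - 1) * (ζ ^ (β - 1) * Real.exp (k * ζ)) ≤
      (k ^ (-(α / 2)) * Real.exp (k * τ)) * ((τ - ζ) ^ (α / 2 - 1) * ζ ^ (β - 1)) := by
    intro ζ hζ
    have h1 : 0 < τ - ζ := sub_pos.2 hζ.2
    -- Half of the order α pays for smallness: exp(-k(τ-ζ)) ≤ (k(τ-ζ))^(-α/2) leaves an integrable
    -- kernel of order α/2 and produces the factor k^(-α/2), which tends to 0.
    have h2 : Real.exp (k * ζ) ≤ Real.exp (k * τ) * (k ^ (-(α / 2)) * (τ - ζ) ^ (-(α / 2))) := by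
      rw [← Real.mul_rpow hk.le h1.le,
        show k * ζ = k * τ + -(k * (τ - ζ)) by ring, Real.exp_add]
      gcongr
      exact exp_neg_le_rpow_neg (mul_pos hk h1) ⟨hα2.le, by linarith [hα.2]⟩
    have h3 : (τ - ζ) ^ (α / 2 - 1) = (τ - ζ) ^ (α - 1) * (τ - ζ) ^ (-(α / 2)) := by
      rw [← Real.rpow_add h1]; ring_nf
    rw [h3]
    have := Real.rpow_nonneg h1.le (α - 1)
    have := Real.rpow_nonneg hζ.1.le (β - 1)
    calc _ ≤ (τ - ζ) ^ (α - 1) * (ζ ^ (β - 1) *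
          (Real.exp (k * τ) * (k ^ (-(α / 2)) * (τ - ζ) ^ (-(α / 2))))) := by gcongr
      _ = _ := by ring
  calc _ ≤ ∫ ζ in (0 : ℝ)..τ,
        (k ^ (-(α / 2)) * Real.exp (k * τ)) * ((τ - ζ) ^ (α / 2 - 1) * ζ ^ (β - 1)) :=
        intervalIntegral.integral_mono_on_of_le_Ioo hτ.1.le
          (intervalIntegrable_kernel_mul_rpow_mul_exp k hα.1 hβ hτ.1.le)
          ((intervalIntegrable_kernel_mul_rpow hα2 hβ hτ.1.le).const_mul _) hp
    _ = (k ^ (-(α / 2)) * (B * τ ^ (α / 2))) * (τ ^ (β - 1) * Real.exp (k * τ)) := by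
        rw [intervalIntegral.integral_const_mul, integral_kernel_mul_rpow hα2 hβ hτ.1,
          show α / 2 + β - 1 = α / 2 + (β - 1) by ring, Real.rpow_add hτ.1]
        ring
    _ ≤ _ := by
        have := Real.rpow_nonneg hτ.1.le (β - 1)
        refine mul_le_mul_of_nonneg_right (le_trans ?_ hkε) (by positivity)
        have := hτ.1.le
        have := hτ.2
        gcongr

/-- Monotonicity of the Abel operator, without any regularity of the smaller function. -/
theorem integral_kernel_mono {α τ : ℝ} {u v : ℝ → ℝ} (hτ : 0 ≤ τ)
    (hu : ∀ ζ ∈ Ioc 0 τ, 0 ≤ u ζ) (huv : ∀ ζ ∈ Ioc 0 τ, u ζ ≤ v ζ)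
    (hv : IntervalIntegrable (fun ζ => (τ - ζ) ^ (α - 1) * v ζ) volume 0 τ) :
    ∫ ζ in (0 : ℝ)..τ, (τ - ζ) ^ (α - 1) * u ζ ≤ ∫ ζ in (0 : ℝ)..τ, (τ - ζ) ^ (α - 1) * v ζ := by
  rw [intervalIntegral.integral_of_le hτ, intervalIntegral.integral_of_le hτ]
  refine integral_mono_of_nonneg ?_ hv.1 ?_
  · filter_upwards [ae_restrict_mem measurableSet_Ioc] with ζ hζ
    exact mul_nonneg (Real.rpow_nonneg (sub_nonneg.2 hζ.2) _) (hu ζ hζ)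
  · filter_upwards [ae_restrict_mem measurableSet_Ioc] with ζ hζ
    exact mul_le_mul_of_nonneg_left (huv ζ hζ) (Real.rpow_nonneg (sub_nonneg.2 hζ.2) _)

/-- The Gronwall inequality with a weakly singular kernel in the class of functions with a power
singularity at zero. -/
theorem exists_gronwall_const {α β b : ℝ} (hα : α ∈ Ioo (0 : ℝ) 1) (hβ : 0 < β) (hb : 0 < b)
    {L : ℝ} (hL : 0 ≤ L) :
    ∃ A : ℝ, 0 < A ∧ ∀ (u : ℝ → ℝ) (K C : ℝ), 0 ≤ K → (∀ ϑ ∈ Ioc 0 b, 0 ≤ u ϑ) →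
      (∀ ϑ ∈ Ioc 0 b, u ϑ ≤ C * ϑ ^ (β - 1)) →
      (∀ ϑ ∈ Ioc 0 b,
        u ϑ ≤ K * ϑ ^ (β - 1) + L * ∫ ζ in (0 : ℝ)..ϑ, (ϑ - ζ) ^ (α - 1) * u ζ) →
      ∀ ϑ ∈ Ioc 0 b, u ϑ ≤ A * K * ϑ ^ (β - 1) := by
  obtain ⟨k, hk, hkL⟩ := exists_exp_kernel_le (b := b) (ε := 1 / (2 * (L + 1))) hα hβ (by positivity)
  refine ⟨2 * Real.exp (k * b), by positivity, fun u K C hK hu0 huC hu => ?_⟩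
  set ω : ℝ → ℝ := fun ζ => ζ ^ (β - 1) * Real.exp (k * ζ) with hω
  have hωpos : ∀ ζ, 0 < ζ → 0 < ω ζ := fun ζ hζ =>
    mul_pos (Real.rpow_pos_of_pos hζ _) (Real.exp_pos _)
  have hle : ∀ ζ, 0 < ζ → ζ ^ (β - 1) ≤ ω ζ := fun ζ hζ =>
    le_mul_of_one_le_right (Real.rpow_nonneg hζ.le _) (Real.one_le_exp (by positivity))
  have : Nonempty (Ioc 0 b) := ⟨⟨b, hb, le_rfl⟩⟩
  -- The crude constant `C` serves only to make the weighted supremum finite; it does not enter the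
  -- final bound.
  have hbdd : BddAbove (range fun ϑ : Ioc 0 b => u ϑ / ω ϑ) := by
    refine ⟨max C 0, ?_⟩
    rintro _ ⟨ϑ, rfl⟩
    rw [div_le_iff₀ (hωpos _ ϑ.2.1)]
    calc u ϑ ≤ C * (ϑ : ℝ) ^ (β - 1) := huC _ ϑ.2
      _ ≤ max C 0 * (ϑ : ℝ) ^ (β - 1) :=
        mul_le_mul_of_nonneg_right (le_max_left _ _) (Real.rpow_nonneg ϑ.2.1.le _)
      _ ≤ max C 0 * ω ϑ := mul_le_mul_of_nonneg_left (hle _ ϑ.2.1) (le_max_right _ _)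
  set m := ⨆ ϑ : Ioc 0 b, u ϑ / ω ϑ with hm
  have hum : ∀ ϑ ∈ Ioc 0 b, u ϑ ≤ m * ω ϑ := fun ϑ hϑ =>
    (div_le_iff₀ (hωpos _ hϑ.1)).1 (le_ciSup hbdd ⟨ϑ, hϑ⟩)
  have hm0 : 0 ≤ m := by
    have h := hum b ⟨hb, le_rfl⟩
    have h0 := hu0 b ⟨hb, le_rfl⟩
    by_contra hc
    nlinarith [hωpos b hb]
  -- The choice ε = 1 / (2(L + 1)) gives Lε ≤ 1/2, so the integral term costs at most half of the
  -- supremum and m ≤ 2K.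
  have hmK : m ≤ K + m / 2 := by
    refine ciSup_le fun ϑ => ?_
    obtain ⟨ϑ, hϑ⟩ := ϑ
    rw [div_le_iff₀ (hωpos _ hϑ.1)]
    have hint := intervalIntegrable_kernel_mul_rpow_mul_exp k hα.1 hβ hϑ.1.le
    have h1 : ∫ ζ in (0 : ℝ)..ϑ, (ϑ - ζ) ^ (α - 1) * u ζ ≤
        ∫ ζ in (0 : ℝ)..ϑ, (ϑ - ζ) ^ (α - 1) * (m * ω ζ) := by
      refine integral_kernel_mono hϑ.1.le (fun ζ hζ => hu0 ζ ⟨hζ.1, hζ.2.trans hϑ.2⟩)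
        (fun ζ hζ => hum ζ ⟨hζ.1, hζ.2.trans hϑ.2⟩) ?_
      refine (hint.const_mul m).congr_ae (ae_of_all _ fun ζ => ?_)
      simp only [hω]; ring
    have h2 : ∫ ζ in (0 : ℝ)..ϑ, (ϑ - ζ) ^ (α - 1) * (m * ω ζ) ≤
        m * (1 / (2 * (L + 1)) * ω ϑ) := by
      simp only [mul_left_comm _ m, intervalIntegral.integral_const_mul]
      exact mul_le_mul_of_nonneg_left (hkL ϑ hϑ) hm0
    have h3 : L * (m * (1 / (2 * (L + 1)) * ω ϑ)) ≤ m / 2 * ω ϑ := by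
      have : L / (L + 1) ≤ 1 := (div_le_one (by positivity)).2 (by linarith)
      calc _ = L / (L + 1) * (m / 2 * ω ϑ) := by field_simp
        _ ≤ 1 * (m / 2 * ω ϑ) := mul_le_mul_of_nonneg_right this
            (mul_nonneg (by positivity) (hωpos _ hϑ.1).le)
        _ = _ := one_mul _
    calc u ϑ ≤ _ := hu ϑ hϑ
      _ ≤ K * ω ϑ + m / 2 * ω ϑ :=
        add_le_add (mul_le_mul_of_nonneg_left (hle _ hϑ.1) hK)
          ((mul_le_mul_of_nonneg_left (h1.trans h2) hL).trans h3)
      _ = _ := by ring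
  intro ϑ hϑ
  have hϑp := Real.rpow_nonneg hϑ.1.le (β - 1)
  calc u ϑ ≤ m * ω ϑ := hum ϑ hϑ
    _ ≤ (2 * K) * (ϑ ^ (β - 1) * Real.exp (k * b)) := by
      refine mul_le_mul (by linarith) ?_ (hωpos _ hϑ.1).le (by positivity)
      have := hϑ.2
      simp only [hω]
      gcongr
    _ = _ := by ring

/-! ### Bounds and continuity of the Riemann-Liouville integral -/

section FracInt

variable {E : Type*} [NormedAddCommGroup E] [NormedSpace ℝ E]

theorem intervalIntegrable_kernel_smul {α β b C τ : ℝ} {h : ℝ → E} (hα : 0 < α) (hβ : 0 < β)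
    (hm : AEStronglyMeasurable h (volume.restrict (Ioc 0 b)))
    (hC : ∀ ζ ∈ Ioc 0 b, ‖h ζ‖ ≤ C * ζ ^ (β - 1)) (hτ : τ ∈ Icc 0 b) :
    IntervalIntegrable (fun ζ => (τ - ζ) ^ (α - 1) • h ζ) volume 0 τ := by
  refine ((intervalIntegrable_kernel_mul_rpow hα hβ hτ.1).const_mul C).mono_fun' ?_ ?_
  · rw [uIoc_of_le hτ.1]
    exact AEStronglyMeasurable.smul
      (by fun_prop : Measurable fun ζ : ℝ => (τ - ζ) ^ (α - 1)).aestronglyMeasurable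
      (hm.mono_measure (Measure.restrict_mono (Ioc_subset_Ioc_right hτ.2) le_rfl))
  · rw [uIoc_of_le hτ.1]
    filter_upwards [ae_restrict_mem measurableSet_Ioc] with ζ hζ
    have h1 := Real.rpow_nonneg (sub_nonneg.2 hζ.2) (α - 1)
    rw [norm_smul, Real.norm_of_nonneg h1, mul_left_comm]
    exact mul_le_mul_of_nonneg_left (hC ζ ⟨hζ.1, hζ.2.trans hτ.2⟩) h1

theorem norm_fracInt_le_integral {α τ : ℝ} (h : ℝ → E) (hτ : 0 ≤ τ) :
    ‖fracInt α h τ‖ ≤ ∫ ζ in (0 : ℝ)..τ, (τ - ζ) ^ (α - 1) * ‖h ζ‖ := by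
  refine (intervalIntegral.norm_integral_le_integral_norm hτ).trans_eq
    (intervalIntegral.integral_congr fun ζ hζ => ?_)
  rw [uIcc_of_le hτ] at hζ
  simp only [norm_smul, Real.norm_of_nonneg (Real.rpow_nonneg (sub_nonneg.2 hζ.2) (α - 1))]

theorem norm_fracInt_le {α β C τ : ℝ} {h : ℝ → E} (hα : 0 < α) (hβ : 0 < β)
    (hC : ∀ ζ ∈ Ioc 0 τ, ‖h ζ‖ ≤ C * ζ ^ (β - 1)) (hτ : 0 < τ) :
    ‖fracInt α h τ‖ ≤ C * (τ ^ (α + β - 1) * ProbabilityTheory.beta α β) := by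
  have hi := (intervalIntegrable_kernel_mul_rpow hα hβ hτ.le).const_mul C
  simp only [mul_left_comm C] at hi
  refine (norm_fracInt_le_integral h hτ.le).trans ?_
  refine (integral_kernel_mono hτ.le (fun _ _ => norm_nonneg _) hC hi).trans_eq ?_
  simp only [mul_left_comm _ C, intervalIntegral.integral_const_mul,
    integral_kernel_mul_rpow hα hβ hτ]

theorem fracInt_zero (α : ℝ) (h : ℝ → E) : fracInt α h 0 = 0 := by
  simp [fracInt]

/-- The Riemann-Liouville integral of a function with a power singularity at zero is continuous. -/
theorem continuousOn_fracInt {α β b C : ℝ} {h : ℝ → E} (hα : 0 < α) (hβ : 0 < β)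
    (hm : AEStronglyMeasurable h (volume.restrict (Ioc 0 b)))
    (hC : ∀ ζ ∈ Ioc 0 b, ‖h ζ‖ ≤ C * ζ ^ (β - 1)) :
    ContinuousOn (fracInt α h) (Ioc 0 b) := by
  intro s hs
  set μ : Measure ℝ := volume.restrict (Ioc 0 b) with hμ
  -- The indicator moves the dependence on the upper limit into the kernel, so that all integrals
  -- are over the fixed interval (0, b]. The weight ζ^(β-1) is then put into `k`, since ‖h‖ is
  -- bounded by a multiple of it.
  set κ : ℝ → ℝ → ℝ := fun τ => (Ioc 0 τ).indicator fun ζ => (τ - ζ) ^ (α - 1) with hκ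
  set k : ℝ → ℝ → ℝ := fun τ ζ => κ τ ζ * ζ ^ (β - 1) with hk
  have hkind : ∀ τ, k τ = (Ioc 0 τ).indicator fun ζ => (τ - ζ) ^ (α - 1) * ζ ^ (β - 1) := by
    intro τ; ext ζ; simp only [hk, hκ, indicator_mul_left]
  have hμr : ∀ τ ∈ Ioc 0 b, μ.restrict (Ioc 0 τ) = volume.restrict (Ioc 0 τ) := fun τ hτ => by
    rw [hμ, Measure.restrict_restrict measurableSet_Ioc,
      inter_eq_self_of_subset_left (Ioc_subset_Ioc_right hτ.2)]
  have hkint : ∀ τ ∈ Ioc 0 b, Integrable (k τ) μ := fun τ hτ => by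
    rw [hkind, integrable_indicator_iff measurableSet_Ioc, IntegrableOn, hμr τ hτ]
    exact (intervalIntegrable_kernel_mul_rpow hα hβ hτ.1.le).1
  have hkval : ∀ τ ∈ Ioc 0 b, ∫ ζ, k τ ζ ∂μ = τ ^ (α + β - 1) * ProbabilityTheory.beta α β :=
    fun τ hτ => by
      rw [hkind, integral_indicator measurableSet_Ioc, hμr τ hτ,
        ← intervalIntegral.integral_of_le hτ.1.le, integral_kernel_mul_rpow hα hβ hτ.1]
  have hJ : ∀ τ ∈ Ioc 0 b, fracInt α h τ = ∫ ζ, κ τ ζ • h ζ ∂μ := fun τ hτ => by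
    rw [fracInt, intervalIntegral.integral_of_le hτ.1.le, ← hμr τ hτ,
      ← integral_indicator measurableSet_Ioc]
    congr 1; ext ζ; simp only [hκ, indicator_smul_apply_left]
  have hJint : ∀ τ ∈ Ioc 0 b, Integrable (fun ζ => κ τ ζ • h ζ) μ := fun τ hτ => by
    have := (intervalIntegrable_kernel_smul hα hβ hm hC ⟨hτ.1.le, hτ.2⟩).1
    rw [IntegrableOn, ← hμr τ hτ] at this
    refine ((integrable_indicator_iff measurableSet_Ioc).2 this).congr (ae_of_all _ fun ζ => ?_)
    simp only [hκ, indicator_smul_apply_left]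
  have hF : 𝓝[Ioc 0 b] s ≤ 𝓝 s := nhdsWithin_le_nhds
  have hmem : ∀ᶠ τ in 𝓝[Ioc 0 b] s, τ ∈ Ioc 0 b := self_mem_nhdsWithin
  have hpt : ∀ᵐ ζ ∂μ, Tendsto (fun τ => k τ ζ) (𝓝[Ioc 0 b] s) (𝓝 (k s ζ)) := by
    filter_upwards [ae_restrict_mem measurableSet_Ioc,
      ae_restrict_of_ae (Measure.ae_ne volume s)] with ζ hζ hne
    rcases lt_or_gt_of_ne hne with hlt | hlt
    · have hev : ∀ᶠ τ in 𝓝[Ioc 0 b] s, (τ - ζ) ^ (α - 1) * ζ ^ (β - 1) = k τ ζ := by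
        filter_upwards [hF (lt_mem_nhds hlt)] with τ hτ
        rw [hkind, indicator_of_mem (show ζ ∈ Ioc 0 τ from ⟨hζ.1, le_of_lt hτ⟩)]
      rw [hkind s, indicator_of_mem (show ζ ∈ Ioc 0 s from ⟨hζ.1, hlt.le⟩)]
      refine Tendsto.congr' hev (Tendsto.mono_left ?_ hF)
      have : ContinuousAt (fun τ : ℝ => (τ - ζ) ^ (α - 1) * ζ ^ (β - 1)) s :=
        ((continuousAt_id.sub continuousAt_const).rpow_const
          (Or.inl (sub_pos.2 hlt).ne')).mul continuousAt_const
      exact this.tendsto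
    · have hev : ∀ᶠ τ in 𝓝[Ioc 0 b] s, 0 = k τ ζ := by
        filter_upwards [hF (gt_mem_nhds hlt)] with τ hτ
        rw [hkind, indicator_of_notMem (fun hh : ζ ∈ Ioc 0 τ => absurd hh.2 (not_le.2 hτ))]
      rw [hkind s, indicator_of_notMem (fun hh : ζ ∈ Ioc 0 s => absurd hh.2 (not_le.2 hlt))]
      exact Tendsto.congr' hev tendsto_const_nhds
  have hk0 : ∀ τ, ∀ᵐ ζ ∂μ, 0 ≤ k τ ζ := fun τ => by
    filter_upwards [ae_restrict_mem measurableSet_Ioc] with ζ hζ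
    rw [hkind]
    refine indicator_nonneg (fun x hx => ?_) _
    exact mul_nonneg (Real.rpow_nonneg (sub_nonneg.2 hx.2) _) (Real.rpow_nonneg hx.1.le _)
  have hmeas : ∀ τ, AEStronglyMeasurable (k τ) μ := fun τ => by
    rw [hkind]
    exact ((by fun_prop : Measurable fun ζ : ℝ => (τ - ζ) ^ (α - 1) * ζ ^ (β - 1)).indicator
      measurableSet_Ioc).aestronglyMeasurable
  -- Scheffé's argument. The singularity of `k τ` moves with τ, so no common majorant is at hand;
  -- but the positive part of `k s - k τ` is dominated by `k s`. Together with the convergence of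
  -- the integrals, known explicitly, the identity |a - b| = (a - b) + 2 max(b - a, 0) gives
  -- convergence in L¹.
  have hpos : Tendsto (fun τ => ∫ ζ, max (k s ζ - k τ ζ) 0 ∂μ) (𝓝[Ioc 0 b] s) (𝓝 0) := by
    have := tendsto_integral_filter_of_dominated_convergence (μ := μ) (l := 𝓝[Ioc 0 b] s)
      (F := fun τ ζ => max (k s ζ - k τ ζ) 0) (f := fun _ => (0 : ℝ)) (k s)
      (Eventually.of_forall fun τ => ((hmeas s).sub (hmeas τ)).sup aestronglyMeasurable_const)
      (Eventually.of_forall fun τ => by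
        filter_upwards [hk0 s, hk0 τ] with ζ h1 h2
        rw [Real.norm_of_nonneg (le_max_right _ _)]
        exact max_le (by linarith) h1) (hkint s hs) (by
        filter_upwards [hpt] with ζ hζ
        simpa using (hζ.const_sub (k s ζ)).max (tendsto_const_nhds (x := (0 : ℝ))))
    simpa using this
  have hval : Tendsto (fun τ => ∫ ζ, (k τ ζ - k s ζ) ∂μ) (𝓝[Ioc 0 b] s) (𝓝 0) := by
    have h1 : Tendsto (fun τ : ℝ => τ ^ (α + β - 1) * ProbabilityTheory.beta α β -
        s ^ (α + β - 1) * ProbabilityTheory.beta α β) (𝓝[Ioc 0 b] s) (𝓝 0) := by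
      have : ContinuousAt (fun τ : ℝ => τ ^ (α + β - 1) * ProbabilityTheory.beta α β -
        s ^ (α + β - 1) * ProbabilityTheory.beta α β) s :=
        ((continuousAt_id.rpow_const (Or.inl hs.1.ne')).mul continuousAt_const).sub
          continuousAt_const
      simpa using this.tendsto.mono_left hF
    refine h1.congr' ?_
    filter_upwards [hmem] with τ hτ
    rw [integral_sub (hkint τ hτ) (hkint s hs), hkval τ hτ, hkval s hs]
  have habs : Tendsto (fun τ => ∫ ζ, |k τ ζ - k s ζ| ∂μ) (𝓝[Ioc 0 b] s) (𝓝 0) := by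
    have h1 := hval.add (hpos.const_mul 2)
    simp only [mul_zero, add_zero] at h1
    refine h1.congr' ?_
    filter_upwards [hmem] with τ hτ
    rw [← integral_const_mul, ← integral_add (f := fun ζ => k τ ζ - k s ζ)
      ((hkint τ hτ).sub (hkint s hs))]
    · refine integral_congr_ae (ae_of_all _ fun ζ => ?_)
      rcases le_total (k τ ζ) (k s ζ) with h | h
      · simp only [max_eq_left (sub_nonneg.2 h), abs_of_nonpos (sub_nonpos.2 h)]; ring
      · simp only [max_eq_right (sub_nonpos.2 h), abs_of_nonneg (sub_nonneg.2 h)]; ring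
    · exact (((hkint s hs).sub (hkint τ hτ)).sup (integrable_zero _ _ _)).const_mul 2
  rw [ContinuousWithinAt, tendsto_iff_norm_sub_tendsto_zero]
  have h2 := habs.const_mul C
  rw [mul_zero] at h2
  refine squeeze_zero' (Eventually.of_forall fun _ => norm_nonneg _) ?_ h2
  filter_upwards [hmem] with τ hτ
  rw [hJ τ hτ, hJ s hs, ← integral_sub (hJint τ hτ) (hJint s hs), ← integral_const_mul]
  refine norm_integral_le_of_norm_le (((hkint τ hτ).sub (hkint s hs)).abs.const_mul C) ?_
  filter_upwards [ae_restrict_mem measurableSet_Ioc] with ζ hζ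
  rw [← sub_smul, norm_smul, Real.norm_eq_abs]
  simp only [hk]
  rw [← sub_mul, abs_mul, abs_of_nonneg (Real.rpow_nonneg hζ.1.le (β - 1)), mul_left_comm]
  exact mul_le_mul_of_nonneg_left (hC ζ hζ) (abs_nonneg _)

/-- For a bounded density the integral is O(τ^α), which settles the endpoint 0; elsewhere the
singular case with β = 1 applies. -/
theorem continuousOn_fracInt_Icc {α b C : ℝ} {h : ℝ → E} (hα : 0 < α)
    (hm : AEStronglyMeasurable h (volume.restrict (Ioc 0 b)))
    (hC : ∀ ζ ∈ Ioc 0 b, ‖h ζ‖ ≤ C) :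
    ContinuousOn (fracInt α h) (Icc 0 b) := by
  have hC' : ∀ ζ ∈ Ioc 0 b, ‖h ζ‖ ≤ C * ζ ^ ((1 : ℝ) - 1) := by simpa using hC
  intro s hs
  rcases hs.1.eq_or_lt with rfl | h0
  · rw [ContinuousWithinAt, fracInt_zero, tendsto_zero_iff_norm_tendsto_zero]
    have h1 : ContinuousAt (fun τ : ℝ => C * (τ ^ α * ProbabilityTheory.beta α 1)) 0 :=
      ((continuousAt_id.rpow_const (Or.inr hα.le)).mul continuousAt_const).const_mul C
    have h2 := h1.tendsto.mono_left (nhdsWithin_le_nhds (s := Icc 0 b))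
    simp only [Real.zero_rpow hα.ne', zero_mul, mul_zero] at h2
    refine squeeze_zero' (Eventually.of_forall fun _ => norm_nonneg _) ?_ h2
    filter_upwards [self_mem_nhdsWithin] with τ hτ
    rcases hτ.1.eq_or_lt with rfl | h3
    · simp [fracInt_zero, Real.zero_rpow hα.ne']
    · simpa using norm_fracInt_le hα one_pos
        (fun ζ hζ => hC' ζ ⟨hζ.1, hζ.2.trans hτ.2⟩) h3
  · refine (continuousOn_fracInt hα one_pos hm hC' s ⟨h0, hs.2⟩).mono_of_mem_nhdsWithin ?_
    filter_upwards [self_mem_nhdsWithin, nhdsWithin_le_nhds (lt_mem_nhds h0)] with τ h1 h2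
    exact ⟨h2, h1.2⟩

end FracInt

end FracControl

namespace FracControl

/-! ### The Caputo derivative -/

section FracInt

variable {E : Type*} [NormedAddCommGroup E] [NormedSpace ℝ E]

theorem fracInt_congr_ae {α τ : ℝ} {g h : ℝ → E} (hτ : 0 ≤ τ)
    (hgh : ∀ᵐ ζ ∂(volume.restrict (Ioc 0 τ)), g ζ = h ζ) : fracInt α g τ = fracInt α h τ := by
  rw [fracInt, fracInt, intervalIntegral.integral_of_le hτ, intervalIntegral.integral_of_le hτ]
  refine integral_congr_ae ?_
  filter_upwards [hgh] with ζ hζ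
  rw [hζ]

theorem fracInt_congr {α τ : ℝ} {g h : ℝ → E} (hτ : 0 ≤ τ) (hgh : ∀ ζ ∈ Ioc 0 τ, g ζ = h ζ) :
    fracInt α g τ = fracInt α h τ :=
  fracInt_congr_ae hτ ((ae_restrict_mem measurableSet_Ioc).mono hgh)

theorem integral_kernel_kernel {α β ζ s : ℝ} (hα : 0 < α) (hβ : 0 < β) (h : ζ < s) :
    ∫ ξ in ζ..s, (s - ξ) ^ (β - 1) * (ξ - ζ) ^ (α - 1) =
      ProbabilityTheory.beta β α * (s - ζ) ^ (α + β - 1) := by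
  have h1 := intervalIntegral.integral_comp_sub_right (a := ζ) (b := s)
    (fun x => ((s - ζ) - x) ^ (β - 1) * x ^ (α - 1)) ζ
  simp only [sub_self, sub_sub_sub_cancel_right] at h1
  rw [h1, integral_kernel_mul_rpow hβ hα (sub_pos.2 h), mul_comm, add_comm α β]

/-- The semigroup property of the Riemann-Liouville integral. -/
theorem fracInt_fracInt [CompleteSpace E] {α β C s : ℝ} {g : ℝ → E} (hα : 0 < α) (hβ : 0 < β)
    (hg : StronglyMeasurable g) (hC : ∀ ζ, ‖g ζ‖ ≤ C) (hs : 0 ≤ s) :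
    fracInt β (fracInt α g) s = ProbabilityTheory.beta β α • fracInt (α + β) g s := by
  set μ : Measure ℝ := volume.restrict (Ioc 0 s) with hμ
  -- The triangle ζ ≤ ξ is encoded in the integrand, so that Fubini can be applied on the square (0,
  -- s]².
  set Φ : ℝ → ℝ → E := fun ξ ζ =>
    (if ζ ≤ ξ then (s - ξ) ^ (β - 1) * (ξ - ζ) ^ (α - 1) else 0) • g ζ with hΦ
  have hC' : ∀ b, ∀ ζ ∈ Ioc 0 b, ‖g ζ‖ ≤ C * ζ ^ ((1 : ℝ) - 1) := fun b ζ _ => by simpa using hC ζ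
  have hrestr : ∀ ξ ∈ Ioc 0 s, μ.restrict (Ioc 0 ξ) = volume.restrict (Ioc 0 ξ) := fun ξ hξ => by
    rw [hμ, Measure.restrict_restrict measurableSet_Ioc,
      inter_eq_self_of_subset_left (Ioc_subset_Ioc_right hξ.2)]
  have hind : ∀ ξ, ∀ ζ ∈ Ioc 0 s, Φ ξ ζ = (Ioc 0 ξ).indicator
      (fun ζ => (s - ξ) ^ (β - 1) • (ξ - ζ) ^ (α - 1) • g ζ) ζ := fun ξ ζ hζ => by
    by_cases h : ζ ≤ ξ
    · rw [indicator_of_mem (show ζ ∈ Ioc 0 ξ from ⟨hζ.1, h⟩)]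
      simp only [hΦ, if_pos h, smul_smul]
    · rw [indicator_of_notMem (fun hh : ζ ∈ Ioc 0 ξ => h hh.2)]
      simp only [hΦ, if_neg h, zero_smul]
  have hinner : ∀ ξ ∈ Ioc 0 s, ∫ ζ, Φ ξ ζ ∂μ = (s - ξ) ^ (β - 1) • fracInt α g ξ := fun ξ hξ => by
    rw [integral_congr_ae ((ae_restrict_mem measurableSet_Ioc).mono (hind ξ)),
      integral_indicator measurableSet_Ioc, hrestr ξ hξ, integral_smul, fracInt,
      intervalIntegral.integral_of_le hξ.1.le]
  have hinner' : ∀ ζ ∈ Ioo 0 s, ∫ ξ, Φ ξ ζ ∂μ =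
      ProbabilityTheory.beta β α • (s - ζ) ^ (α + β - 1) • g ζ := fun ζ hζ => by
    simp only [hΦ]
    rw [integral_smul_const, smul_smul]
    congr 1
    rw [← integral_kernel_kernel hα hβ hζ.2, intervalIntegral.integral_of_le hζ.2.le]
    have : ∀ ξ, (if ζ ≤ ξ then (s - ξ) ^ (β - 1) * (ξ - ζ) ^ (α - 1) else 0) =
      (Ici ζ).indicator (fun ξ => (s - ξ) ^ (β - 1) * (ξ - ζ) ^ (α - 1)) ξ := fun ξ => by
      simp [indicator_apply]
    simp only [this]
    rw [integral_indicator measurableSet_Ici, hμ, Measure.restrict_restrict measurableSet_Ici,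
      ← integral_Icc_eq_integral_Ioc]
    congr 2
    ext x
    simp only [mem_inter_iff, mem_Ici, mem_Ioc, mem_Icc]
    have := hζ.1
    constructor
    · rintro ⟨h1, h2, h3⟩; exact ⟨h1, h3⟩
    · rintro ⟨h1, h2⟩; exact ⟨h1, by linarith, h2⟩
  have hmeas : StronglyMeasurable (Function.uncurry Φ) := by
    refine StronglyMeasurable.smul (Measurable.stronglyMeasurable ?_)
      (hg.comp_measurable measurable_snd)
    exact Measurable.ite (measurableSet_le measurable_snd measurable_fst) (by fun_prop)
      measurable_const
  have hint : Integrable (Function.uncurry Φ) (μ.prod μ) := by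
    rw [integrable_prod_iff hmeas.aestronglyMeasurable]
    constructor
    · filter_upwards [ae_restrict_mem measurableSet_Ioc] with ξ hξ
      have h1 := (intervalIntegrable_kernel_smul (b := ξ) hα one_pos
        hg.aestronglyMeasurable (hC' ξ) ⟨hξ.1.le, le_rfl⟩).1
      rw [IntegrableOn, ← hrestr ξ hξ] at h1
      have h2 := (integrable_indicator_iff measurableSet_Ioc).2 (h1.smul ((s - ξ) ^ (β - 1)))
      refine h2.congr ?_
      filter_upwards [ae_restrict_mem measurableSet_Ioc] with ζ hζ
      exact (hind ξ ζ hζ).symm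
    -- The inner integral of the norms is at most a constant times (s-ξ)^(β-1) ξ^α, which accounts
    -- for the exponent α + 1.
    · have hb := ((intervalIntegrable_kernel_mul_rpow hβ (show 0 < α + 1 by linarith) hs).const_mul
        (C * ProbabilityTheory.beta α 1)).1
      refine Integrable.mono' hb hmeas.aestronglyMeasurable.norm.integral_prod_right' ?_
      filter_upwards [ae_restrict_mem measurableSet_Ioc] with ξ hξ
      rw [Real.norm_of_nonneg (integral_nonneg fun _ => norm_nonneg _)]
      have hβ0 := Real.rpow_nonneg (sub_nonneg.2 hξ.2) (β - 1)
      calc ∫ ζ, ‖Φ ξ ζ‖ ∂μ = ∫ ζ, (Ioc 0 ξ).indicator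
            (fun ζ => (s - ξ) ^ (β - 1) * ((ξ - ζ) ^ (α - 1) * ‖g ζ‖)) ζ ∂μ := by
            refine integral_congr_ae ?_
            filter_upwards [ae_restrict_mem measurableSet_Ioc] with ζ hζ
            rw [hind ξ ζ hζ, norm_indicator_eq_indicator_norm]
            refine indicator_congr (fun x hx => ?_) |> congrFun <| ζ
            simp only [norm_smul, Real.norm_of_nonneg hβ0,
              Real.norm_of_nonneg (Real.rpow_nonneg (sub_nonneg.2 hx.2) (α - 1))]
        _ = (s - ξ) ^ (β - 1) * fracInt α (fun ζ => ‖g ζ‖) ξ := by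
            rw [integral_indicator measurableSet_Ioc, hrestr ξ hξ, integral_const_mul, fracInt,
              intervalIntegral.integral_of_le hξ.1.le]
            rfl
        _ ≤ (s - ξ) ^ (β - 1) * (C * (ξ ^ (α + 1 - 1) * ProbabilityTheory.beta α 1)) := by
            refine mul_le_mul_of_nonneg_left ((le_abs_self _).trans ?_) hβ0
            exact norm_fracInt_le (h := fun ζ => ‖g ζ‖) hα one_pos
              (fun ζ hζ => by simpa using hC ζ) hξ.1
        _ = _ := by ring
  have hL : fracInt β (fracInt α g) s = ∫ ξ, ∫ ζ, Φ ξ ζ ∂μ ∂μ := by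
    rw [fracInt, intervalIntegral.integral_of_le hs]
    exact integral_congr_ae ((ae_restrict_mem measurableSet_Ioc).mono
      fun ξ hξ => (hinner ξ hξ).symm)
  have hR : ProbabilityTheory.beta β α • fracInt (α + β) g s = ∫ ζ, ∫ ξ, Φ ξ ζ ∂μ ∂μ := by
    rw [fracInt, intervalIntegral.integral_of_le hs, ← integral_smul]
    refine integral_congr_ae ?_
    filter_upwards [ae_restrict_mem measurableSet_Ioc,
      ae_restrict_of_ae (Measure.ae_ne volume s)] with ζ hζ hne
    exact (hinner' ζ ⟨hζ.1, lt_of_le_of_ne hζ.2 hne⟩).symm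
  rw [hL, hR, integral_integral_swap hint]

end FracInt

variable {n : ℕ}

/-- On `[0, t]` the function `w` is the sum of a constant and the Riemann-Liouville integral of a
measurable function `g` with values in the ball of radius `L`. -/
structure IsGenerator (α t : ℝ) (w g : ℝ → Vec n) (L : ℝ) : Prop where
  meas : StronglyMeasurable g
  bound : ∀ ξ, ‖g ξ‖ ≤ L
  eq : ∀ τ ∈ Icc 0 t, w τ = w 0 + (1 / Real.Gamma α) • fracInt α g τ

theorem IsGenerator.isAC {α t L : ℝ} {w g : ℝ → Vec n} (h : IsGenerator α t w g L) :
    IsAC α t w :=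
  ⟨g, memLp_top_of_bound h.meas.aestronglyMeasurable L (ae_of_all _ h.bound), h.eq⟩

/-- A strongly measurable representative is set to zero where its norm exceeds `L`. Only a null
subset of [0, t] is affected there, and the integrals do not see it; in return the bound holds at
every point. -/
theorem exists_generator_of_ae {α t L : ℝ} {w g : ℝ → Vec n} (hL : 0 ≤ L)
    (hg : AEStronglyMeasurable g (volume.restrict (Icc 0 t)))
    (hb : ∀ᵐ ξ ∂(volume.restrict (Icc 0 t)), ‖g ξ‖ ≤ L)
    (he : ∀ τ ∈ Icc 0 t, w τ = w 0 + (1 / Real.Gamma α) • fracInt α g τ) :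
    ∃ g', IsGenerator α t w g' L ∧ ∀ᵐ ξ ∂(volume.restrict (Icc 0 t)), g ξ = g' ξ := by
  set g₁ := hg.mk g
  have hg₁ : StronglyMeasurable g₁ := hg.stronglyMeasurable_mk
  have hS : MeasurableSet {ξ | ‖g₁ ξ‖ ≤ L} :=
    measurableSet_le hg₁.norm.measurable measurable_const
  have hae : ∀ᵐ ξ ∂(volume.restrict (Icc 0 t)), g ξ = {ξ | ‖g₁ ξ‖ ≤ L}.indicator g₁ ξ := by
    filter_upwards [hb, hg.ae_eq_mk] with ξ h1 h2
    rw [indicator_of_mem (show ξ ∈ {ξ | ‖g₁ ξ‖ ≤ L} from (congrArg norm h2).symm.trans_le h1)]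
    exact h2
  refine ⟨_, ⟨hg₁.indicator hS, fun ξ => ?_, fun τ hτ => ?_⟩, hae⟩
  · by_cases h : ‖g₁ ξ‖ ≤ L
    · rwa [indicator_of_mem (show ξ ∈ {ξ | ‖g₁ ξ‖ ≤ L} from h)]
    · rwa [indicator_of_notMem (show ξ ∉ {ξ | ‖g₁ ξ‖ ≤ L} from h), norm_zero]
  · rw [he τ hτ, fracInt_congr_ae hτ.1 (ae_restrict_of_ae_restrict_of_subset
      (Ioc_subset_Icc_self.trans (Icc_subset_Icc_right hτ.2)) hae)]

theorem IsAC.exists_generator {α t : ℝ} {w : ℝ → Vec n} (h : IsAC α t w) :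
    ∃ g L, 0 ≤ L ∧ IsGenerator α t w g L := by
  obtain ⟨g, hg, he⟩ := h
  have hb : ∀ᵐ ξ ∂(volume.restrict (Icc 0 t)),
      ‖g ξ‖ ≤ (eLpNormEssSup g (volume.restrict (Icc 0 t))).toReal := by
    have hfin : eLpNormEssSup g (volume.restrict (Icc 0 t)) ≠ ⊤ := by
      have := hg.eLpNorm_lt_top
      rw [eLpNorm_exponent_top] at this
      exact this.ne
    filter_upwards [enorm_ae_le_eLpNormEssSup g (volume.restrict (Icc 0 t))] with ξ hξ
    rw [← toReal_enorm]
    exact ENNReal.toReal_mono hfin hξ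
  obtain ⟨g', hg', -⟩ := exists_generator_of_ae ENNReal.toReal_nonneg hg.1 hb he
  exact ⟨g', _, ENNReal.toReal_nonneg, hg'⟩

/-- By the semigroup property, the integral of order 1 - α of the integral of order α of `g` is a
multiple of the primitive of `g`. The Gamma factors cancel because B(1-α, α) = Γ(1-α)Γ(α), and
Lebesgue differentiation recovers `g` almost everywhere. -/
theorem IsGenerator.caputo_ae {α t L : ℝ} {w g : ℝ → Vec n} (hα : α ∈ Ioo (0 : ℝ) 1)
    (h : IsGenerator α t w g L) :
    ∀ᵐ τ ∂(volume.restrict (Icc 0 t)), caputo α w τ = g τ := by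
  have hloc : LocallyIntegrable g volume :=
    (memLp_top_of_bound h.meas.aestronglyMeasurable L (ae_of_all _ h.bound)).locallyIntegrable
      le_top
  have h1α : 0 < 1 - α := sub_pos.2 hα.2
  rw [← restrict_Ioo_eq_restrict_Icc]
  filter_upwards [ae_restrict_mem measurableSet_Ioo,
    ae_restrict_of_ae (LocallyIntegrable.ae_hasDerivAt_integral hloc)] with τ hτ hd
  have hG1 := (Real.Gamma_pos_of_pos hα.1).ne'
  have hG2 := (Real.Gamma_pos_of_pos h1α).ne'
  have hev : (fun s : ℝ => ∫ ξ in (0 : ℝ)..s, (s - ξ) ^ (-α) • (w ξ - w 0)) =ᶠ[𝓝 τ]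
      fun s => Real.Gamma (1 - α) • ∫ ξ in (0 : ℝ)..s, g ξ := by
    filter_upwards [Ioo_mem_nhds hτ.1 hτ.2] with s hs
    have e1 : ∫ ξ in (0 : ℝ)..s, (s - ξ) ^ (-α) • (w ξ - w 0) =
        fracInt (1 - α) (fun ξ => (1 / Real.Gamma α) • fracInt α g ξ) s := by
      rw [fracInt, show 1 - α - 1 = -α by ring]
      refine intervalIntegral.integral_congr fun ξ hξ => ?_
      rw [uIcc_of_le hs.1.le] at hξ
      rw [h.eq ξ ⟨hξ.1, hξ.2.trans hs.2.le⟩, add_sub_cancel_left]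
    have e2 : fracInt (1 - α) (fun ξ => (1 / Real.Gamma α) • fracInt α g ξ) s =
        (1 / Real.Gamma α) • fracInt (1 - α) (fracInt α g) s := by
      rw [fracInt, fracInt, ← intervalIntegral.integral_smul]
      simp only [smul_comm (1 / Real.Gamma α)]
    have e3 : fracInt (α + (1 - α)) g s = ∫ ξ in (0 : ℝ)..s, g ξ := by
      simp [fracInt]
    rw [e1, e2, fracInt_fracInt hα.1 h1α h.meas h.bound hs.1.le, e3, smul_smul]
    congr 1
    rw [ProbabilityTheory.beta, sub_add_cancel, Real.Gamma_one]
    field_simp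
  have hD : HasDerivAt (fun s => Real.Gamma (1 - α) • ∫ ξ in (0 : ℝ)..s, g ξ)
      (Real.Gamma (1 - α) • g τ) τ := (hd 0).fun_const_smul _
  rw [caputo, hev.deriv_eq, hD.deriv, smul_smul, one_div_mul_cancel hG2, one_smul]

end FracControl

namespace FracControl

/-! ### Continuations of positions -/

variable {n : ℕ}

theorem intervalIntegrable_rpow_sub_smul {p τ b : ℝ} {g : ℝ → Vec n} {L : ℝ}
    (hg : StronglyMeasurable g) (hL : ∀ ξ, ‖g ξ‖ ≤ L) (hb : 0 ≤ b) (hτ : b < τ) :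
    IntervalIntegrable (fun ξ => (τ - ξ) ^ p • g ξ) volume 0 b := by
  have hgi : IntervalIntegrable g volume 0 b :=
    (intervalIntegrable_const (c := L)).mono_fun' hg.aestronglyMeasurable (ae_of_all _ hL)
  refine hgi.continuousOn_smul (ContinuousOn.rpow_const (by fun_prop) fun ξ hξ => Or.inl ?_)
  rw [uIcc_of_le hb] at hξ
  linarith [hξ.2]

theorem intervalIntegrable_kernel_smul_of_le {α τ b : ℝ} {g : ℝ → Vec n} {L : ℝ} (hα : 0 < α)
    (hg : StronglyMeasurable g) (hL : ∀ ξ, ‖g ξ‖ ≤ L) (hb : 0 ≤ b) (hτ : b ≤ τ) :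
    IntervalIntegrable (fun ξ => (τ - ξ) ^ (α - 1) • g ξ) volume 0 b := by
  refine (intervalIntegrable_kernel_smul (b := τ) (C := L) hα one_pos hg.aestronglyMeasurable
    (fun ζ _ => by simpa using hL ζ) ⟨hb.trans hτ, le_rfl⟩).mono_set ?_
  rw [uIcc_of_le hb, uIcc_of_le (hb.trans hτ)]
  exact Icc_subset_Icc_right hτ

/-- The exact primitive of the differentiated kernel: it turns integrals over [0, t] into s^(α-1)
with a bound independent of t. -/
theorem integral_rpow_sub {α t s : ℝ} (hα : α < 1) (ht : 0 ≤ t) (hs : 0 < s) :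
    (1 - α) * ∫ ξ in (0 : ℝ)..t, (t + s - ξ) ^ (α - 2) = s ^ (α - 1) - (t + s) ^ (α - 1) := by
  rw [intervalIntegral.integral_comp_sub_left (fun x => x ^ (α - 2)), integral_rpow]
  · rw [show α - 2 + 1 = α - 1 by ring, add_sub_cancel_left, sub_zero]
    have : α - 1 ≠ 0 := by linarith
    field_simp
    ring
  · refine Or.inr ⟨by linarith, ?_⟩
    rw [uIcc_of_le (by linarith)]
    exact fun h => by linarith [h.1]

theorem IsGenerator.integral_caputo {α t L p τ : ℝ} {w g : ℝ → Vec n} (hα : α ∈ Ioo (0 : ℝ) 1)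
    (h : IsGenerator α t w g L) (ht : 0 ≤ t) :
    ∫ ξ in (0 : ℝ)..t, (τ - ξ) ^ p • caputo α w ξ = ∫ ξ in (0 : ℝ)..t, (τ - ξ) ^ p • g ξ := by
  rw [intervalIntegral.integral_of_le ht, intervalIntegral.integral_of_le ht]
  refine integral_congr_ae ?_
  filter_upwards [ae_restrict_of_ae_restrict_of_subset Ioc_subset_Icc_self (h.caputo_ae hα)]
    with ξ hξ
  rw [hξ]

theorem IsGenerator.aExt_eq {α t L τ : ℝ} {w g : ℝ → Vec n} (hα : α ∈ Ioo (0 : ℝ) 1)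
    (h : IsGenerator α t w g L) (ht : 0 ≤ t) (hτ : t ≤ τ) :
    aExt α t w τ = w 0 + (1 / Real.Gamma α) • ∫ ξ in (0 : ℝ)..t, (τ - ξ) ^ (α - 1) • g ξ := by
  rw [aExt]
  split_ifs with h1
  · obtain rfl := le_antisymm h1 hτ
    exact h.eq _ ⟨ht, le_rfl⟩
  · rw [h.integral_caputo hα ht]

/-- The generator of a continuation: `g` before `t` and `v` after `t`. -/
def extGen (t : ℝ) (g : ℝ → Vec n) (v : Vec n) (ξ : ℝ) : Vec n :=
  if ξ ≤ t then g ξ else v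

theorem stronglyMeasurable_extGen {t : ℝ} {g : ℝ → Vec n} {v : Vec n} (hg : StronglyMeasurable g) :
    StronglyMeasurable (extGen t g v) :=
  StronglyMeasurable.ite measurableSet_Iic hg stronglyMeasurable_const

theorem norm_extGen_le {t L : ℝ} {g : ℝ → Vec n} {v : Vec n} (hg : ∀ ξ, ‖g ξ‖ ≤ L) (ξ : ℝ) :
    ‖extGen t g v ξ‖ ≤ max L ‖v‖ := by
  rw [extGen]
  split_ifs
  exacts [(hg ξ).trans (le_max_left _ _), le_max_right _ _]

theorem integral_extGen {α t b τ L : ℝ} {g : ℝ → Vec n} {v : Vec n} (hα : 0 < α)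
    (hg : StronglyMeasurable g) (hL : ∀ ξ, ‖g ξ‖ ≤ L) (ht : 0 ≤ t) (htb : t ≤ b) (hb : b ≤ τ) :
    ∫ ξ in (0 : ℝ)..b, (τ - ξ) ^ (α - 1) • extGen t g v ξ =
      (∫ ξ in (0 : ℝ)..t, (τ - ξ) ^ (α - 1) • g ξ) + (∫ ξ in t..b, (τ - ξ) ^ (α - 1)) • v := by
  have hm := stronglyMeasurable_extGen (t := t) (v := v) hg
  have hn := norm_extGen_le (t := t) (v := v) hL
  have h1 := intervalIntegrable_kernel_smul_of_le hα hm hn ht (htb.trans hb)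
  have h2 := intervalIntegrable_kernel_smul_of_le hα hm hn (ht.trans htb) hb
  rw [← intervalIntegral.integral_add_adjacent_intervals h1 (h1.symm.trans h2)]
  congr 1
  · refine intervalIntegral.integral_congr fun ξ hξ => ?_
    rw [uIcc_of_le ht] at hξ
    simp only [extGen, if_pos hξ.2]
  · rw [← intervalIntegral.integral_smul_const, intervalIntegral.integral_of_le htb,
      intervalIntegral.integral_of_le htb]
    refine setIntegral_congr_fun measurableSet_Ioc fun ξ hξ => ?_
    simp only [extGen, if_neg (not_le.2 hξ.1)]

/-- Continuing with zero Caputo derivative means extending the generator by 0. Thus the continuation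
is one Riemann-Liouville integral of a bounded function, and the general bounds and continuity apply
to it. -/
theorem IsGenerator.aExt_eq_fracInt {α t L τ : ℝ} {w g : ℝ → Vec n} (hα : α ∈ Ioo (0 : ℝ) 1)
    (h : IsGenerator α t w g L) (ht : 0 ≤ t) (hτ : t ≤ τ) :
    aExt α t w τ = w 0 + (1 / Real.Gamma α) • fracInt α (extGen t g 0) τ := by
  rw [h.aExt_eq hα ht hτ, fracInt, integral_extGen hα.1 h.meas h.bound ht hτ le_rfl, smul_zero,
    add_zero]

theorem integral_kernel_sub {α t τ : ℝ} (hα : 0 < α) :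
    ∫ ξ in t..τ, (τ - ξ) ^ (α - 1) = (τ - t) ^ α / α := by
  rw [intervalIntegral.integral_comp_sub_left (fun x => x ^ (α - 1)), sub_self,
    integral_rpow (Or.inl (by linarith)), sub_add_cancel, Real.zero_rpow hα.ne', sub_zero]

/-- The kernel integrated over (t, τ] gives (τ-t)^α/α, and αΓ(α) = Γ(α+1); so the added power
function is exactly what the constant generator `v` after `t` produces. -/
theorem IsGenerator.xDir {α t δ L : ℝ} {w g : ℝ → Vec n} (hα : α ∈ Ioo (0 : ℝ) 1)
    (h : IsGenerator α t w g L) (ht : 0 ≤ t) (v : Vec n) :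
    IsGenerator α (t + δ) (xDir α t w v) (extGen t g v) (max L ‖v‖) := by
  have h0 : FracControl.xDir α t w v 0 = w 0 := by rw [FracControl.xDir, if_pos ht]
  refine ⟨stronglyMeasurable_extGen h.meas, norm_extGen_le h.bound, fun τ hτ => ?_⟩
  rw [h0, FracControl.xDir]
  split_ifs with h1
  · rw [h.eq τ ⟨hτ.1, h1⟩, fracInt_congr (g := extGen t g v) (h := g) hτ.1]
    intro ζ hζ
    rw [extGen, if_pos (hζ.2.trans h1)]
  · have h2 := (not_le.1 h1).le
    rw [h.aExt_eq hα ht h2, fracInt, integral_extGen hα.1 h.meas h.bound ht h2 le_rfl,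
      integral_kernel_sub hα.1, smul_add, smul_smul, add_assoc, Real.Gamma_add_one hα.1.ne']
    congr 3
    have := hα.1.ne'
    have := (Real.Gamma_pos_of_pos hα.1).ne'
    field_simp

theorem mul_mem_Icc {t T ϑ : ℝ} (ht : 0 ≤ t) (htT : t ≤ T) (hϑ : ϑ ∈ Icc (0 : ℝ) 1) :
    t ≤ t + ϑ * (T - t) ∧ t + ϑ * (T - t) ∈ Icc 0 T := by
  have h1 : 0 ≤ ϑ * (T - t) := mul_nonneg hϑ.1 (by linarith)
  have h2 : ϑ * (T - t) ≤ T - t := mul_le_of_le_one_left (by linarith) hϑ.2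
  exact ⟨by linarith, by linarith, by linarith⟩

theorem IsGenerator.continuousOn_aExt {α t T L : ℝ} {w g : ℝ → Vec n} (hα : α ∈ Ioo (0 : ℝ) 1)
    (h : IsGenerator α t w g L) (ht : t ∈ Ico 0 T) :
    ContinuousOn (fun ϑ => aExt α t w (t + ϑ * (T - t))) (Icc 0 1) := by
  have h1 : ContinuousOn (fracInt α (extGen t g 0)) (Icc 0 T) :=
    continuousOn_fracInt_Icc hα.1 (stronglyMeasurable_extGen h.meas).aestronglyMeasurable
      fun ζ _ => norm_extGen_le h.bound ζ
  have h2 : ContinuousOn (fun ϑ => fracInt α (extGen t g 0) (t + ϑ * (T - t))) (Icc 0 1) :=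
    h1.comp (by fun_prop) fun ϑ hϑ => (mul_mem_Icc ht.1 ht.2.le hϑ).2
  refine ((continuousOn_const (c := w 0)).add (h2.const_smul (1 / Real.Gamma α))).congr fun ϑ hϑ => ?_
  exact h.aExt_eq_fracInt hα ht.1 (mul_mem_Icc ht.1 ht.2.le hϑ).1

theorem IsGenerator.norm_aExt_le {α t T L τ : ℝ} {w g : ℝ → Vec n} (hα : α ∈ Ioo (0 : ℝ) 1)
    (h : IsGenerator α t w g L) (ht : 0 ≤ t) (hτ : t ≤ τ) (hτT : τ ≤ T) (hL : 0 ≤ L) :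
    ‖aExt α t w τ‖ ≤
      ‖w 0‖ + (1 / Real.Gamma α) * (L * (T ^ α * ProbabilityTheory.beta α 1)) := by
  have hΓ := Real.Gamma_pos_of_pos hα.1
  have hB := ProbabilityTheory.beta_pos hα.1 one_pos
  rw [h.aExt_eq_fracInt hα ht hτ]
  refine (norm_add_le _ _).trans (add_le_add_right ?_ _)
  rw [norm_smul, Real.norm_of_nonneg (by positivity)]
  refine mul_le_mul_of_nonneg_left ?_ (by positivity)
  have hT : 0 ≤ T ^ α := Real.rpow_nonneg (ht.trans (hτ.trans hτT)) _
  rcases (ht.trans hτ).eq_or_lt with rfl | h0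
  · rw [fracInt_zero, norm_zero]; positivity
  · have := norm_fracInt_le (h := extGen t g 0) (C := L) hα.1 one_pos (τ := τ)
      (fun ζ _ => by simpa [max_eq_left hL] using norm_extGen_le (v := 0) h.bound ζ) h0
    refine this.trans ?_
    have := Real.rpow_le_rpow h0.le hτT hα.1.le
    simp only [add_sub_cancel_right]
    gcongr

theorem IsGenerator.qFun_eq {α t T L : ℝ} {w g : ℝ → Vec n} (hα : α ∈ Ioo (0 : ℝ) 1)
    (h : IsGenerator α t w g L) (ht : 0 ≤ t) (ϑ : ℝ) :
    qFun T α t w ϑ = -((1 - α) * (1 - ϑ) / Real.Gamma α) •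
      ∫ ξ in (0 : ℝ)..t, (t + ϑ * (T - t) - ξ) ^ (α - 2) • g ξ := by
  rw [qFun, h.integral_caputo hα ht]

theorem norm_integral_rpow_sub_smul_le {α t s L : ℝ} {g : ℝ → Vec n} (hα : α ∈ Ioo (0 : ℝ) 1)
    (hL : ∀ ξ, ‖g ξ‖ ≤ L) (hL0 : 0 ≤ L) (ht : 0 ≤ t) (hs : 0 < s) :
    (1 - α) * ∫ ξ in (0 : ℝ)..t, (t + s - ξ) ^ (α - 2) * ‖g ξ‖ ≤ L * s ^ (α - 1) := by
  have h1α : 0 < 1 - α := sub_pos.2 hα.2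
  have hi : IntervalIntegrable (fun ξ => (t + s - ξ) ^ (α - 2)) volume 0 t := by
    refine ContinuousOn.intervalIntegrable (ContinuousOn.rpow_const (by fun_prop) fun ξ hξ => ?_)
    rw [uIcc_of_le ht] at hξ
    exact Or.inl (by linarith [hξ.2])
  have h0 : ∀ ξ ∈ Ioc 0 t, 0 ≤ (t + s - ξ) ^ (α - 2) := fun ξ hξ =>
    Real.rpow_nonneg (by linarith [hξ.2]) _
  calc _ ≤ (1 - α) * ∫ ξ in (0 : ℝ)..t, L * (t + s - ξ) ^ (α - 2) := by
        refine mul_le_mul_of_nonneg_left ?_ h1α.le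
        rw [intervalIntegral.integral_of_le ht, intervalIntegral.integral_of_le ht]
        refine integral_mono_of_nonneg ?_ (hi.const_mul L).1 ?_
        · filter_upwards [ae_restrict_mem measurableSet_Ioc] with ξ hξ
          exact mul_nonneg (h0 ξ hξ) (norm_nonneg _)
        · filter_upwards [ae_restrict_mem measurableSet_Ioc] with ξ hξ
          rw [mul_comm L]
          exact mul_le_mul_of_nonneg_left (hL ξ) (h0 ξ hξ)
    _ = L * (s ^ (α - 1) - (t + s) ^ (α - 1)) := by
        rw [intervalIntegral.integral_const_mul, mul_left_comm, integral_rpow_sub hα.2 ht hs]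
    _ ≤ _ := by
        have := Real.rpow_nonneg (add_nonneg ht hs.le) (α - 1)
        exact mul_le_mul_of_nonneg_left (by linarith) hL0

/-- The exponent α - 2 is not integrable at 0, but integrating it exactly costs one power only.
Hence `qFun` has the same singularity ϑ^(α-1) as `QFun`. -/
theorem IsGenerator.norm_qFun_le {α t T L ϑ : ℝ} {w g : ℝ → Vec n} (hα : α ∈ Ioo (0 : ℝ) 1)
    (h : IsGenerator α t w g L) (hL : 0 ≤ L) (ht : t ∈ Ico 0 T) (hϑ : ϑ ∈ Ioc (0 : ℝ) 1) :
    ‖qFun T α t w ϑ‖ ≤ 1 / Real.Gamma α * L * (T - t) ^ (α - 1) * ϑ ^ (α - 1) := by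
  have hΓ := Real.Gamma_pos_of_pos hα.1
  have h1α : 0 < 1 - α := sub_pos.2 hα.2
  have hs : 0 < T - t := sub_pos.2 ht.2
  have hϑs := mul_pos hϑ.1 hs
  have h1 : ‖∫ ξ in (0 : ℝ)..t, (t + ϑ * (T - t) - ξ) ^ (α - 2) • g ξ‖ ≤
      ∫ ξ in (0 : ℝ)..t, (t + ϑ * (T - t) - ξ) ^ (α - 2) * ‖g ξ‖ := by
    refine (intervalIntegral.norm_integral_le_integral_norm ht.1).trans_eq
      (intervalIntegral.integral_congr fun ξ hξ => ?_)
    rw [uIcc_of_le ht.1] at hξ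
    have : 0 ≤ t + ϑ * (T - t) - ξ := by linarith [hξ.2]
    simp only [norm_smul, Real.norm_of_nonneg (Real.rpow_nonneg this _)]
  have h2 := norm_integral_rpow_sub_smul_le hα h.bound hL ht.1 hϑs
  rw [h.qFun_eq hα ht.1, norm_smul, norm_neg,
    Real.norm_of_nonneg (div_nonneg (mul_nonneg h1α.le (sub_nonneg.2 hϑ.2)) hΓ.le)]
  calc _ ≤ 1 / Real.Gamma α * (1 * ((1 - α) *
        ‖∫ ξ in (0 : ℝ)..t, (t + ϑ * (T - t) - ξ) ^ (α - 2) • g ξ‖)) := by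
        rw [show (1 - α) * (1 - ϑ) / Real.Gamma α = 1 / Real.Gamma α * ((1 - ϑ) * (1 - α)) by ring,
          mul_assoc, mul_assoc (1 - ϑ)]
        gcongr
        linarith [hϑ.1]
    _ ≤ 1 / Real.Gamma α * (1 * (L * (ϑ * (T - t)) ^ (α - 1))) := by
        rw [one_mul, one_mul]
        exact mul_le_mul_of_nonneg_left ((mul_le_mul_of_nonneg_left h1 h1α.le).trans h2)
          (by positivity)
    _ = _ := by rw [Real.mul_rpow hϑ.1.le hs.le]; ring

theorem IsCWeighted.of_norm_le {F : Type} [NormedAddCommGroup F] {α C : ℝ} {q : ℝ → F}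
    (hq : ContinuousOn q (Ioc 0 1)) (hC : ∀ ϑ ∈ Ioc (0 : ℝ) 1, ‖q ϑ‖ ≤ C * ϑ ^ (α - 1)) :
    IsCWeighted α q := by
  refine ⟨hq, C, fun ϑ hϑ => ?_⟩
  have h1 := Real.rpow_pos_of_pos hϑ.1 (1 - α)
  calc _ ≤ ϑ ^ (1 - α) * (C * ϑ ^ (α - 1)) := mul_le_mul_of_nonneg_left (hC ϑ hϑ) h1.le
    _ = C * (ϑ ^ (1 - α) * ϑ ^ (α - 1)) := by ring
    _ = C := by rw [← Real.rpow_add hϑ.1]; simp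

theorem IsCWeighted.exists_norm_le {F : Type} [NormedAddCommGroup F] {α : ℝ} {q : ℝ → F}
    (hq : IsCWeighted α q) : ∃ C, 0 ≤ C ∧ ∀ ϑ ∈ Ioc (0 : ℝ) 1, ‖q ϑ‖ ≤ C * ϑ ^ (α - 1) := by
  obtain ⟨-, C, hC⟩ := hq
  refine ⟨max C 0, le_max_right _ _, fun ϑ hϑ => ?_⟩
  have h1 := Real.rpow_pos_of_pos hϑ.1 (1 - α)
  rw [show α - 1 = -(1 - α) by ring, Real.rpow_neg hϑ.1.le, ← div_eq_mul_inv, le_div_iff₀ h1,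
    mul_comm]
  exact (hC ϑ hϑ).trans (le_max_left _ _)

theorem IsGenerator.isCWeighted_qFun {α t T L : ℝ} {w g : ℝ → Vec n} (hα : α ∈ Ioo (0 : ℝ) 1)
    (h : IsGenerator α t w g L) (hL : 0 ≤ L) (ht : t ∈ Ico 0 T) :
    IsCWeighted α (qFun T α t w) := by
  refine IsCWeighted.of_norm_le ?_ fun ϑ hϑ => h.norm_qFun_le hα hL ht hϑ
  have hs : 0 < T - t := sub_pos.2 ht.2
  rw [funext (h.qFun_eq (T := T) hα ht.1)]
  have hcoef : ContinuousOn (fun ϑ => -((1 - α) * (1 - ϑ) / Real.Gamma α)) (Ioc 0 1) := by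
    fun_prop
  refine hcoef.smul fun ϑ₀ hϑ₀ => ContinuousAt.continuousWithinAt ?_
  -- For ϑ > ϑ₀/2 the base of the power stays above this positive number, which supplies the
  -- constant majorant.
  have hc : 0 < ϑ₀ / 2 * (T - t) := mul_pos (half_pos hϑ₀.1) hs
  have hnear : ∀ᶠ ϑ in 𝓝 ϑ₀, ϑ₀ / 2 < ϑ := lt_mem_nhds (half_lt_self hϑ₀.1)
  refine intervalIntegral.continuousAt_of_dominated_interval
    (bound := fun _ => (ϑ₀ / 2 * (T - t)) ^ (α - 2) * L) ?_ ?_ intervalIntegrable_const ?_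
  · filter_upwards [hnear] with ϑ hϑ
    have h1 : 0 < ϑ * (T - t) := mul_pos ((half_pos hϑ₀.1).trans hϑ) hs
    have := (intervalIntegrable_rpow_sub_smul (p := α - 2) (τ := t + ϑ * (T - t)) h.meas h.bound
      ht.1 (by linarith)).1.aestronglyMeasurable
    rwa [uIoc_of_le ht.1]
  · filter_upwards [hnear] with ϑ hϑ
    refine ae_of_all _ fun ξ hξ => ?_
    rw [uIoc_of_le ht.1] at hξ
    have h1 : ϑ₀ / 2 * (T - t) ≤ t + ϑ * (T - t) - ξ := by
      have := mul_le_mul_of_nonneg_right hϑ.le hs.le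
      linarith [hξ.2]
    rw [norm_smul, Real.norm_of_nonneg (Real.rpow_nonneg (hc.le.trans h1) _)]
    refine mul_le_mul ?_ (h.bound ξ) (norm_nonneg _) (Real.rpow_nonneg hc.le _)
    exact Real.rpow_le_rpow_of_nonpos hc h1 (by linarith [hα.2])
  · refine ae_of_all _ fun ξ hξ => ?_
    rw [uIoc_of_le ht.1] at hξ
    have h1 : 0 < ϑ₀ * (T - t) := mul_pos hϑ₀.1 hs
    refine ContinuousAt.smul (ContinuousAt.rpow_const (by fun_prop) (Or.inl ?_))
      continuousAt_const
    linarith [hξ.2]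

theorem QFun_eq {α t T ϑ : ℝ} (ht : t < T) (hϑ : 0 < ϑ) :
    QFun T α n t ϑ = (1 / Real.Gamma α * (T - t) ^ (α - 1) * ϑ ^ (α - 1)) •
      ContinuousLinearMap.id ℝ (Vec n) := by
  rw [QFun, show α - 1 = -(1 - α) by ring, Real.rpow_neg hϑ.le, Real.rpow_neg (sub_pos.2 ht).le]
  congr 1
  simp only [one_div, mul_inv]
  ring

theorem norm_QFun_le {α t T ϑ : ℝ} (hα : 0 < α) (ht : t < T) (hϑ : 0 < ϑ) :
    ‖QFun T α n t ϑ‖ ≤ 1 / Real.Gamma α * (T - t) ^ (α - 1) * ϑ ^ (α - 1) := by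
  have hΓ := Real.Gamma_pos_of_pos hα
  have h1 := Real.rpow_nonneg (sub_pos.2 ht).le (α - 1)
  have h2 := Real.rpow_nonneg hϑ.le (α - 1)
  rw [QFun_eq ht hϑ, norm_smul, Real.norm_of_nonneg (by positivity)]
  exact mul_le_of_le_one_right (by positivity) ContinuousLinearMap.norm_id_le

theorem isCWeighted_QFun {α t T : ℝ} (hα : 0 < α) (ht : t < T) :
    IsCWeighted α (QFun T α n t) := by
  refine IsCWeighted.of_norm_le ?_ fun ϑ hϑ => norm_QFun_le hα ht hϑ.1
  refine ContinuousOn.congr ?_ fun ϑ hϑ => QFun_eq ht hϑ.1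
  exact (continuousOn_const.mul
    (continuousOn_id.rpow_const fun ϑ hϑ => Or.inl (ne_of_gt hϑ.1))).smul continuousOn_const

end FracControl

namespace FracControl

/-! ### The increment of the continuation with respect to the initial position -/

theorem abs_rpow_sub_rpow_le {p c x y : ℝ} (hp : p ≤ 1) (hc : 0 < c) (hx : c ≤ x) (hy : c ≤ y) :
    |x ^ p - y ^ p| ≤ |p| * c ^ (p - 1) * |x - y| := by
  refine Convex.norm_image_sub_le_of_norm_hasDerivWithin_le (s := Ici c)
    (f := fun z : ℝ => z ^ p) (f' := fun z => p * z ^ (p - 1)) (fun z hz => ?_) (fun z hz => ?_)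
    (convex_Ici c) hy hx
  · exact (Real.hasDerivAt_rpow_const (Or.inl (hc.trans_le hz).ne')).hasDerivWithinAt
  · rw [Real.norm_eq_abs, abs_mul, abs_of_nonneg (Real.rpow_nonneg (hc.le.trans hz) _)]
    exact mul_le_mul_of_nonneg_left (Real.rpow_le_rpow_of_nonpos hc hz (by linarith))
      (abs_nonneg _)

/-- The mean value inequality is applied to σ ↦ (x+σ)^p - pσx^(p-1), whose derivative p((x+σ)^(p-1)
- x^(p-1)) is estimated by the preceding lemma. The condition p ≤ 2 makes x^(p-2) the largest value
of that power on [x, x+h]. -/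
theorem abs_rpow_add_sub_sub_le {p x h : ℝ} (hp : p ≤ 2) (hx : 0 < x) (hh : 0 ≤ h) :
    |(x + h) ^ p - x ^ p - p * h * x ^ (p - 1)| ≤ |p| * |p - 1| * x ^ (p - 2) * h ^ 2 := by
  have := Convex.norm_image_sub_le_of_norm_hasDerivWithin_le (s := Icc 0 h)
    (f := fun σ : ℝ => (x + σ) ^ p - p * σ * x ^ (p - 1))
    (f' := fun σ => p * (x + σ) ^ (p - 1) - p * x ^ (p - 1))
    (C := |p| * (|p - 1| * x ^ (p - 2) * h)) (fun σ hσ => ?_) (fun σ hσ => ?_)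
    (convex_Icc 0 h) (left_mem_Icc.2 hh) (right_mem_Icc.2 hh)
  · simp only [Real.norm_eq_abs, add_zero, mul_zero, zero_mul, sub_zero, abs_of_nonneg hh] at this
    calc _ = |(x + h) ^ p - p * h * x ^ (p - 1) - x ^ p| := by congr 1; ring
      _ ≤ _ := this
      _ = _ := by ring
  · have h1 : HasDerivAt (fun σ : ℝ => x + σ) 1 σ := by
      simpa using (hasDerivAt_id σ).const_add x
    have h2 := h1.rpow_const (p := p) (Or.inl (add_pos_of_pos_of_nonneg hx hσ.1).ne')
    have h3 : HasDerivAt (fun σ : ℝ => p * σ * x ^ (p - 1)) (p * x ^ (p - 1)) σ := by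
      simpa using ((hasDerivAt_id σ).const_mul p).mul_const (x ^ (p - 1))
    exact ((h2.fun_sub h3).congr_deriv (by ring)).hasDerivWithinAt
  · rw [← mul_sub, Real.norm_eq_abs, abs_mul]
    refine mul_le_mul_of_nonneg_left ?_ (abs_nonneg _)
    have h1 := abs_rpow_sub_rpow_le (p := p - 1) (by linarith) hx
      (show x ≤ x + σ by linarith [hσ.1]) le_rfl
    rw [show p - 1 - 1 = p - 2 by ring, add_sub_cancel_left, abs_of_nonneg hσ.1] at h1
    refine h1.trans (mul_le_mul_of_nonneg_left hσ.2 ?_)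
    exact mul_nonneg (abs_nonneg _) (Real.rpow_nonneg hx.le _)

variable {n : ℕ}

/-- Raising the initial time by δ shifts the evaluation point by δ(1-ϑ), and the generator of the
new position equals `v` on (t, t+δ]. The two integrals record these two effects; to first order they
give q and Qv. -/
theorem IsGenerator.aExt_xDir_sub {α t T δ ϑ L : ℝ} {w g : ℝ → Vec n} (hα : α ∈ Ioo (0 : ℝ) 1)
    (h : IsGenerator α t w g L) (v : Vec n) (ht : 0 ≤ t) (hδ : 0 ≤ δ) (hT : t + δ < T)
    (hϑ : ϑ ∈ Ioc (0 : ℝ) 1) :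
    aExt α (t + δ) (FracControl.xDir α t w v) (t + δ + ϑ * (T - (t + δ))) -
        aExt α t w (t + ϑ * (T - t)) =
      (1 / Real.Gamma α) • ((∫ ξ in (0 : ℝ)..t, ((t + ϑ * (T - t) - ξ + δ * (1 - ϑ)) ^ (α - 1) -
        (t + ϑ * (T - t) - ξ) ^ (α - 1)) • g ξ) +
        (∫ ξ in t..t + δ, (t + δ + ϑ * (T - (t + δ)) - ξ) ^ (α - 1)) • v) := by
  have h1 := mul_pos hϑ.1 (sub_pos.2 hT)
  have h2 : 0 < ϑ * (T - t) := mul_pos hϑ.1 (by linarith)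
  have h0 : FracControl.xDir α t w v 0 = w 0 := by rw [FracControl.xDir, if_pos ht]
  rw [(h.xDir hα ht v (δ := δ)).aExt_eq hα (by linarith) (by linarith),
    h.aExt_eq hα ht (by linarith), h0, add_sub_add_left_eq_sub, ← smul_sub,
    integral_extGen hα.1 h.meas h.bound ht (by linarith) (by linarith), add_sub_right_comm,
    ← intervalIntegral.integral_sub]
  · simp only [sub_smul]
    congr 2
    refine intervalIntegral.integral_congr fun ξ _ => ?_
    rw [show t + δ + ϑ * (T - (t + δ)) - ξ = t + ϑ * (T - t) - ξ + δ * (1 - ϑ) by ring]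
  · exact intervalIntegrable_rpow_sub_smul h.meas h.bound ht (by linarith)
  · exact intervalIntegrable_rpow_sub_smul h.meas h.bound ht (by linarith)

/-- The difference of kernels is at most δ(1-ϑ)(1-α) times the kernel with exponent α - 2, whose
integral is computed exactly. On (t, t+δ] the kernel is at most (ϑη/2)^(α-1), because δ ≤ η/2 leaves
T - (t+δ) ≥ η/2. -/
theorem exists_norm_aExt_sub_le {α T η L M : ℝ} (hα : α ∈ Ioo (0 : ℝ) 1) (hη : 0 < η)
    (hL : 0 ≤ L) (hM : 0 ≤ M) :
    ∃ C, 0 ≤ C ∧ ∀ (t : ℝ) (w g : ℝ → Vec n) (v : Vec n) (δ ϑ : ℝ), t ∈ Icc 0 (T - η) →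
      IsGenerator α t w g L → ‖v‖ ≤ M → δ ∈ Ioc 0 (η / 2) → ϑ ∈ Ioc (0 : ℝ) 1 →
      ‖aExt α (t + δ) (xDir α t w v) (t + δ + ϑ * (T - (t + δ))) -
        aExt α t w (t + ϑ * (T - t))‖ ≤ C * δ * ϑ ^ (α - 1) := by
  have hΓ := Real.Gamma_pos_of_pos hα.1
  refine ⟨1 / Real.Gamma α * (L * η ^ (α - 1) + M * (η / 2) ^ (α - 1)), by positivity,
    fun t w g v δ ϑ ht hg hv hδ hϑ => ?_⟩
  have h1α : 0 < 1 - α := sub_pos.2 hα.2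
  have hs : η ≤ T - t := by linarith [ht.2]
  have hsδ : η / 2 ≤ T - (t + δ) := by linarith [hδ.2]
  have hϑη : 0 < ϑ * η := mul_pos hϑ.1 hη
  have hϑη2 : 0 < ϑ * (η / 2) := mul_pos hϑ.1 (half_pos hη)
  have hϑs : ϑ * η ≤ ϑ * (T - t) := mul_le_mul_of_nonneg_left hs hϑ.1.le
  have hϑsδ : ϑ * (η / 2) ≤ ϑ * (T - (t + δ)) := mul_le_mul_of_nonneg_left hsδ hϑ.1.le
  have hh : 0 ≤ δ * (1 - ϑ) := mul_nonneg hδ.1.le (by linarith [hϑ.2])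
  have hh' : δ * (1 - ϑ) ≤ δ := mul_le_of_le_one_right hδ.1.le (by linarith [hϑ.1])
  rw [hg.aExt_xDir_sub hα v ht.1 hδ.1.le (by linarith) hϑ, norm_smul,
    Real.norm_of_nonneg (by positivity)]
  have hA : ‖∫ ξ in (0 : ℝ)..t, ((t + ϑ * (T - t) - ξ + δ * (1 - ϑ)) ^ (α - 1) -
      (t + ϑ * (T - t) - ξ) ^ (α - 1)) • g ξ‖ ≤ δ * (L * (ϑ * η) ^ (α - 1)) := by
    have hi : IntervalIntegrable (fun ξ => (t + ϑ * (T - t) - ξ) ^ (α - 2)) volume 0 t := by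
      refine ContinuousOn.intervalIntegrable (ContinuousOn.rpow_const (by fun_prop) fun ξ hξ => ?_)
      rw [uIcc_of_le ht.1] at hξ
      exact Or.inl (by linarith [hξ.2])
    calc _ ≤ ∫ ξ in (0 : ℝ)..t,
          (δ * (1 - ϑ) * L * (1 - α)) * (t + ϑ * (T - t) - ξ) ^ (α - 2) := by
          refine intervalIntegral.norm_integral_le_of_norm_le ht.1 (ae_of_all _ fun ξ hξ => ?_)
            (hi.const_mul _)
          have hx : 0 < t + ϑ * (T - t) - ξ := by linarith [hξ.2]
          have h1 := abs_rpow_sub_rpow_le (p := α - 1) (by linarith) hx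
            (show _ ≤ t + ϑ * (T - t) - ξ + δ * (1 - ϑ) by linarith) le_rfl
          rw [add_sub_cancel_left, abs_of_nonneg hh, abs_of_neg (show α - 1 < 0 by linarith),
            show α - 1 - 1 = α - 2 by ring] at h1
          rw [norm_smul, Real.norm_eq_abs]
          calc _ ≤ (-(α - 1) * (t + ϑ * (T - t) - ξ) ^ (α - 2) * (δ * (1 - ϑ))) * L :=
                mul_le_mul h1 (hg.bound ξ) (norm_nonneg _) ((abs_nonneg _).trans h1)
            _ = _ := by ring
      _ = δ * (1 - ϑ) * L * ((ϑ * (T - t)) ^ (α - 1) - (t + ϑ * (T - t)) ^ (α - 1)) := by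
          rw [intervalIntegral.integral_const_mul, mul_assoc _ (1 - α),
            integral_rpow_sub hα.2 ht.1 (by linarith)]
      _ ≤ δ * L * (ϑ * η) ^ (α - 1) := by
          have h1 := Real.rpow_le_rpow_of_nonpos hϑη hϑs (show α - 1 ≤ 0 by linarith)
          have h2 := Real.rpow_nonneg (show 0 ≤ t + ϑ * (T - t) by linarith [ht.1]) (α - 1)
          have h3 := Real.rpow_nonneg hϑη.le (α - 1)
          refine (mul_le_mul_of_nonneg_left (show _ ≤ (ϑ * η) ^ (α - 1) by linarith)
            (by positivity)).trans (mul_le_mul_of_nonneg_right ?_ h3)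
          exact mul_le_mul_of_nonneg_right hh' hL
      _ = _ := by ring
  have hB : ‖∫ ξ in t..t + δ, (t + δ + ϑ * (T - (t + δ)) - ξ) ^ (α - 1)‖ ≤
      (ϑ * (η / 2)) ^ (α - 1) * δ := by
    refine (intervalIntegral.norm_integral_le_of_norm_le_const fun ξ hξ => ?_).trans_eq
      (by rw [add_sub_cancel_left, abs_of_pos hδ.1])
    rw [uIoc_of_le (by linarith [hδ.1])] at hξ
    have hx : ϑ * (η / 2) ≤ t + δ + ϑ * (T - (t + δ)) - ξ := by linarith [hξ.2]
    rw [Real.norm_of_nonneg (Real.rpow_nonneg (hϑη2.le.trans hx) _)]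
    exact Real.rpow_le_rpow_of_nonpos hϑη2 hx (by linarith)
  calc _ ≤ 1 / Real.Gamma α * (δ * (L * (ϑ * η) ^ (α - 1)) +
        (ϑ * (η / 2)) ^ (α - 1) * δ * M) := by
        refine mul_le_mul_of_nonneg_left ((norm_add_le _ _).trans (add_le_add hA ?_))
          (by positivity)
        rw [norm_smul]
        exact mul_le_mul hB hv (norm_nonneg _) ((norm_nonneg _).trans hB)
    _ = _ := by
        rw [Real.mul_rpow hϑ.1.le hη.le, Real.mul_rpow hϑ.1.le (half_pos hη).le]
        ring

/-- For ϑ ≥ ϑ₀ all kernels are evaluated away from their singularity, so Taylor's formula gives an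
error of order δ². The constant degenerates as ϑ₀ → 0, which is why small ϑ is treated by the cruder
first-order bound. -/
theorem exists_norm_aExt_sub_sub_le {α T η L M ϑ₀ : ℝ} (hα : α ∈ Ioo (0 : ℝ) 1) (hη : 0 < η)
    (hL : 0 ≤ L) (hM : 0 ≤ M) (hϑ₀ : 0 < ϑ₀) :
    ∃ C, 0 ≤ C ∧ ∀ (t : ℝ) (w g : ℝ → Vec n) (v : Vec n) (δ ϑ : ℝ), t ∈ Icc 0 (T - η) →
      IsGenerator α t w g L → ‖v‖ ≤ M → δ ∈ Ioc 0 (η / 2) → ϑ ∈ Icc ϑ₀ 1 →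
      ‖aExt α (t + δ) (xDir α t w v) (t + δ + ϑ * (T - (t + δ))) -
        aExt α t w (t + ϑ * (T - t)) - δ • (qFun T α t w ϑ + QFun T α n t ϑ v)‖ ≤ C * δ ^ 2 := by
  have hΓ := Real.Gamma_pos_of_pos hα.1
  refine ⟨1 / Real.Gamma α * (2 * (ϑ₀ * η) ^ (α - 3) * L * |T| + (ϑ₀ * (η / 2)) ^ (α - 2) * M),
    by positivity, fun t w g v δ ϑ ht hg hv hδ hϑ => ?_⟩
  have h1α : 0 < 1 - α := sub_pos.2 hα.2
  have hϑ0 : 0 < ϑ := hϑ₀.trans_le hϑ.1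
  have hs : η ≤ T - t := by linarith [ht.2]
  have hsδ : η / 2 ≤ T - (t + δ) := by linarith [hδ.2]
  have hϑη : 0 < ϑ₀ * η := mul_pos hϑ₀ hη
  have hϑη2 : 0 < ϑ₀ * (η / 2) := mul_pos hϑ₀ (half_pos hη)
  have hϑs : ϑ₀ * η ≤ ϑ * (T - t) := mul_le_mul hϑ.1 hs hη.le hϑ0.le
  have hϑsδ : ϑ₀ * (η / 2) ≤ ϑ * (T - (t + δ)) := mul_le_mul hϑ.1 hsδ (half_pos hη).le hϑ0.le
  have hh : 0 ≤ δ * (1 - ϑ) := mul_nonneg hδ.1.le (by linarith [hϑ.2])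
  have hh' : δ * (1 - ϑ) ≤ δ := mul_le_of_le_one_right hδ.1.le (by linarith)
  have hϑδ : ϑ * δ ≤ δ := mul_le_of_le_one_left hδ.1.le hϑ.2
  rw [hg.aExt_xDir_sub hα v ht.1 hδ.1.le (by linarith) ⟨hϑ0, hϑ.2⟩, hg.qFun_eq hα ht.1,
    QFun_eq (by linarith) hϑ0]
  set τ := t + ϑ * (T - t) with hτ
  have hi1 : ∀ p : ℝ, IntervalIntegrable (fun ξ => (τ - ξ) ^ p • g ξ) volume 0 t := fun p =>
    intervalIntegrable_rpow_sub_smul hg.meas hg.bound ht.1 (by linarith)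
  have hi2 : IntervalIntegrable (fun ξ => (τ - ξ + δ * (1 - ϑ)) ^ (α - 1) • g ξ) volume 0 t := by
    simp only [sub_add_eq_add_sub]
    exact intervalIntegrable_rpow_sub_smul hg.meas hg.bound ht.1 (by linarith)
  -- Up to the factor 1/Γ(α), the second summand on the left is -δ q; the right side is the
  -- second-order Taylor remainder of the kernel.
  have e1 : (∫ ξ in (0 : ℝ)..t,
        ((τ - ξ + δ * (1 - ϑ)) ^ (α - 1) - (τ - ξ) ^ (α - 1)) • g ξ) +
      ((1 - α) * (1 - ϑ) * δ) • (∫ ξ in (0 : ℝ)..t, (τ - ξ) ^ (α - 2) • g ξ) =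
      ∫ ξ in (0 : ℝ)..t, ((τ - ξ + δ * (1 - ϑ)) ^ (α - 1) - (τ - ξ) ^ (α - 1) -
        (α - 1) * (δ * (1 - ϑ)) * (τ - ξ) ^ (α - 1 - 1)) • g ξ := by
    rw [← intervalIntegral.integral_smul, ← intervalIntegral.integral_add]
    · congr 1
      ext1 ξ
      rw [smul_smul, ← add_smul, show α - 1 - 1 = α - 2 by ring]
      congr 1
      ring
    · simpa only [sub_smul] using hi2.sub (hi1 _)
    · exact (hi1 _).smul ((1 - α) * (1 - ϑ) * δ)
  -- Up to the factor 1/Γ(α), the subtracted term is δ Q, written as the integral of a constant over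
  -- an interval of length δ.
  have e2 : (∫ ξ in t..t + δ, (t + δ + ϑ * (T - (t + δ)) - ξ) ^ (α - 1)) -
      δ * ((T - t) ^ (α - 1) * ϑ ^ (α - 1)) =
      ∫ ξ in t..t + δ,
        ((t + δ + ϑ * (T - (t + δ)) - ξ) ^ (α - 1) - (ϑ * (T - t)) ^ (α - 1)) := by
    rw [intervalIntegral.integral_sub _ intervalIntegrable_const, intervalIntegral.integral_const,
      add_sub_cancel_left, Real.mul_rpow hϑ0.le (by linarith), smul_eq_mul, mul_comm (ϑ ^ _)]
    refine ContinuousOn.intervalIntegrable (ContinuousOn.rpow_const (by fun_prop) fun ξ hξ => ?_)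
    rw [uIcc_of_le (by linarith [hδ.1])] at hξ
    exact Or.inl (by linarith [hξ.2])
  have hA : ‖∫ ξ in (0 : ℝ)..t, ((τ - ξ + δ * (1 - ϑ)) ^ (α - 1) - (τ - ξ) ^ (α - 1) -
        (α - 1) * (δ * (1 - ϑ)) * (τ - ξ) ^ (α - 1 - 1)) • g ξ‖ ≤
      2 * (ϑ₀ * η) ^ (α - 3) * L * |T| * δ ^ 2 := by
    have h1 : ∀ ξ ∈ uIoc 0 t, ‖((τ - ξ + δ * (1 - ϑ)) ^ (α - 1) - (τ - ξ) ^ (α - 1) -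
        (α - 1) * (δ * (1 - ϑ)) * (τ - ξ) ^ (α - 1 - 1)) • g ξ‖ ≤
        2 * (ϑ₀ * η) ^ (α - 3) * δ ^ 2 * L := by
      intro ξ hξ
      rw [uIoc_of_le ht.1] at hξ
      have hx : ϑ₀ * η ≤ τ - ξ := by linarith [hξ.2]
      rw [norm_smul, Real.norm_eq_abs]
      refine mul_le_mul ?_ (hg.bound ξ) (norm_nonneg _) (by positivity)
      refine (abs_rpow_add_sub_sub_le (by linarith) (hϑη.trans_le hx) hh).trans ?_
      have h2 : |α - 1| * |α - 1 - 1| ≤ 2 := by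
        rw [abs_of_neg (by linarith), abs_of_neg (by linarith)]
        nlinarith [hα.1]
      have h3 : (τ - ξ) ^ (α - 1 - 2) ≤ (ϑ₀ * η) ^ (α - 3) := by
        rw [show α - 1 - 2 = α - 3 by ring]
        exact Real.rpow_le_rpow_of_nonpos hϑη hx (by linarith)
      have h4 : 0 ≤ (τ - ξ) ^ (α - 1 - 2) := Real.rpow_nonneg (hϑη.le.trans hx) _
      gcongr
    refine (intervalIntegral.norm_integral_le_of_norm_le_const h1).trans ?_
    have h2 : |t - 0| ≤ |T| := by
      rw [sub_zero]
      exact abs_le_abs_of_nonneg ht.1 (by linarith)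
    calc _ ≤ 2 * (ϑ₀ * η) ^ (α - 3) * δ ^ 2 * L * |T| :=
          mul_le_mul_of_nonneg_left h2 (by positivity)
      _ = _ := by ring
  have hB : ‖∫ ξ in t..t + δ,
      ((t + δ + ϑ * (T - (t + δ)) - ξ) ^ (α - 1) - (ϑ * (T - t)) ^ (α - 1))‖ ≤
      (ϑ₀ * (η / 2)) ^ (α - 2) * δ ^ 2 := by
    have h1 : ∀ ξ ∈ uIoc t (t + δ),
        ‖(t + δ + ϑ * (T - (t + δ)) - ξ) ^ (α - 1) - (ϑ * (T - t)) ^ (α - 1)‖ ≤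
          (ϑ₀ * (η / 2)) ^ (α - 2) * δ := by
      intro ξ hξ
      rw [uIoc_of_le (by linarith [hδ.1])] at hξ
      refine (abs_rpow_sub_rpow_le (p := α - 1) (by linarith) hϑη2 (by linarith [hξ.2])
        (by nlinarith)).trans ?_
      have h2 : |α - 1| ≤ 1 := by rw [abs_le]; constructor <;> linarith [hα.1]
      -- The difference of the two arguments is (t + δ - ξ) - ϑδ, and both terms lie in [0, δ].
      have h3 : |t + δ + ϑ * (T - (t + δ)) - ξ - ϑ * (T - t)| ≤ δ := by
        rw [abs_le]; constructor <;> nlinarith [hξ.1, hξ.2]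
      rw [show α - 1 - 1 = α - 2 by ring]
      calc _ ≤ 1 * (ϑ₀ * (η / 2)) ^ (α - 2) * δ := by gcongr
        _ = _ := by ring
    refine (intervalIntegral.norm_integral_le_of_norm_le_const h1).trans_eq ?_
    rw [add_sub_cancel_left, abs_of_pos hδ.1]
    ring
  rw [← e1] at hA
  rw [← e2] at hB
  set J := ∫ ξ in (0 : ℝ)..t, (τ - ξ) ^ (α - 2) • g ξ
  set I := ∫ ξ in (0 : ℝ)..t, ((τ - ξ + δ * (1 - ϑ)) ^ (α - 1) - (τ - ξ) ^ (α - 1)) • g ξ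
  set R := ∫ ξ in t..t + δ, (t + δ + ϑ * (T - (t + δ)) - ξ) ^ (α - 1)
  have e3 : (1 / Real.Gamma α) • (I + R • v) - δ • (-((1 - α) * (1 - ϑ) / Real.Gamma α) • J +
      ((1 / Real.Gamma α * (T - t) ^ (α - 1) * ϑ ^ (α - 1)) •
        ContinuousLinearMap.id ℝ (Vec n)) v) =
      (1 / Real.Gamma α) • ((I + ((1 - α) * (1 - ϑ) * δ) • J) +
        (R - δ * ((T - t) ^ (α - 1) * ϑ ^ (α - 1))) • v) := by
    simp only [smul_apply, ContinuousLinearMap.id_apply]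
    module
  rw [e3, norm_smul, Real.norm_of_nonneg (by positivity)]
  calc _ ≤ 1 / Real.Gamma α * (2 * (ϑ₀ * η) ^ (α - 3) * L * |T| * δ ^ 2 +
        (ϑ₀ * (η / 2)) ^ (α - 2) * δ ^ 2 * M) := by
        refine mul_le_mul_of_nonneg_left ((norm_add_le _ _).trans (add_le_add hA ?_))
          (by positivity)
        rw [norm_smul]
        exact mul_le_mul hB hv (norm_nonneg _) ((norm_nonneg _).trans hB)
    _ = _ := by ring

end FracControl

namespace FracControl

/-! ### Weakly singular Volterra equations -/

section Volterra

variable {F : Type*} [NormedAddCommGroup F]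

/-- Measurable functions on `(0, 1]` bounded by a multiple of `ζ ^ (β - 1)`. -/
def HasPowerBound (β : ℝ) (h : ℝ → F) : Prop :=
  AEStronglyMeasurable h (volume.restrict (Ioc 0 1)) ∧
    ∃ C, 0 ≤ C ∧ ∀ ζ ∈ Ioc (0 : ℝ) 1, ‖h ζ‖ ≤ C * ζ ^ (β - 1)

theorem HasPowerBound.of_bound {β C : ℝ} {h : ℝ → F}
    (hm : AEStronglyMeasurable h (volume.restrict (Ioc 0 1)))
    (hC : ∀ ζ ∈ Ioc (0 : ℝ) 1, ‖h ζ‖ ≤ C * ζ ^ (β - 1)) : HasPowerBound β h :=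
  ⟨hm, max C 0, le_max_right _ _, fun ζ hζ => (hC ζ hζ).trans
    (mul_le_mul_of_nonneg_right (le_max_left _ _) (Real.rpow_nonneg hζ.1.le _))⟩

theorem HasPowerBound.add {β : ℝ} {h h' : ℝ → F} (hh : HasPowerBound β h)
    (hh' : HasPowerBound β h') : HasPowerBound β (fun ζ => h ζ + h' ζ) := by
  obtain ⟨hm, C, hC0, hC⟩ := hh
  obtain ⟨hm', C', hC0', hC'⟩ := hh'
  refine ⟨hm.add hm', C + C', add_nonneg hC0 hC0', fun ζ hζ => (norm_add_le _ _).trans ?_⟩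
  rw [add_mul]
  exact add_le_add (hC ζ hζ) (hC' ζ hζ)

theorem rpow_le_rpow_of_mem_Ioc {β γ ζ : ℝ} (hβγ : β ≤ γ) (hζ : ζ ∈ Ioc (0 : ℝ) 1) :
    ζ ^ (γ - 1) ≤ ζ ^ (β - 1) :=
  Real.rpow_le_rpow_of_exponent_ge hζ.1 hζ.2 (by linarith)

theorem HasPowerBound.mono {β γ : ℝ} {h : ℝ → F} (hh : HasPowerBound γ h) (hβγ : β ≤ γ) :
    HasPowerBound β h := by
  obtain ⟨hm, C, hC0, hC⟩ := hh
  exact ⟨hm, C, hC0, fun ζ hζ => (hC ζ hζ).trans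
    (mul_le_mul_of_nonneg_left (rpow_le_rpow_of_mem_Ioc hβγ hζ) hC0)⟩

theorem hasPowerBound_of_continuousOn {β C : ℝ} {h : ℝ → F} (hc : ContinuousOn h (Ioc 0 1))
    (hC : ∀ ζ ∈ Ioc (0 : ℝ) 1, ‖h ζ‖ ≤ C * ζ ^ (β - 1)) : HasPowerBound β h :=
  HasPowerBound.of_bound (hc.aestronglyMeasurable measurableSet_Ioc) hC

variable [NormedSpace ℝ F]

theorem HasPowerBound.const_smul {β : ℝ} {h : ℝ → F} (hh : HasPowerBound β h) (c : ℝ) :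
    HasPowerBound β (fun ζ => c • h ζ) := by
  obtain ⟨hm, C, hC0, hC⟩ := hh
  refine ⟨hm.const_smul c, ‖c‖ * C, by positivity, fun ζ hζ => ?_⟩
  rw [norm_smul, mul_assoc]
  exact mul_le_mul_of_nonneg_left (hC ζ hζ) (norm_nonneg _)

theorem HasPowerBound.sub {β : ℝ} {h h' : ℝ → F} (hh : HasPowerBound β h)
    (hh' : HasPowerBound β h') : HasPowerBound β (fun ζ => h ζ - h' ζ) := by
  simpa [sub_eq_add_neg] using hh.add (hh'.const_smul (-1))

theorem HasPowerBound.intervalIntegrable {α β τ : ℝ} {h : ℝ → F} (hα : 0 < α) (hβ : 0 < β)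
    (hh : HasPowerBound β h) (hτ : τ ∈ Icc (0 : ℝ) 1) :
    IntervalIntegrable (fun ζ => (τ - ζ) ^ (α - 1) • h ζ) volume 0 τ :=
  let ⟨hm, _, _, hC⟩ := hh
  intervalIntegrable_kernel_smul hα hβ hm hC hτ

theorem HasPowerBound.continuousOn_fracInt {α β : ℝ} {h : ℝ → F} (hα : 0 < α) (hβ : 0 < β)
    (hh : HasPowerBound β h) : ContinuousOn (fracInt α h) (Ioc 0 1) :=
  let ⟨hm, _, _, hC⟩ := hh
  FracControl.continuousOn_fracInt hα hβ hm hC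

theorem fracInt_const_smul (α c τ : ℝ) (h : ℝ → F) :
    fracInt α (fun ζ => c • h ζ) τ = c • fracInt α h τ := by
  simp only [fracInt, smul_comm _ c, intervalIntegral.integral_smul]

theorem HasPowerBound.fracInt_sub {α β τ : ℝ} {h h' : ℝ → F} (hα : 0 < α) (hβ : 0 < β)
    (hh : HasPowerBound β h) (hh' : HasPowerBound β h') (hτ : τ ∈ Icc (0 : ℝ) 1) :
    fracInt α (fun ζ => h ζ - h' ζ) τ = fracInt α h τ - fracInt α h' τ := by
  simp only [fracInt, smul_sub]
  exact intervalIntegral.integral_sub (hh.intervalIntegrable hα hβ hτ)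
    (hh'.intervalIntegrable hα hβ hτ)

theorem HasPowerBound.norm_fracInt_sub_le {α β τ : ℝ} {h h' : ℝ → F} (hα : 0 < α) (hβ : 0 < β)
    (hh : HasPowerBound β h) (hh' : HasPowerBound β h') (hτ : τ ∈ Icc (0 : ℝ) 1) :
    ‖fracInt α h τ - fracInt α h' τ‖ ≤
      ∫ ζ in (0 : ℝ)..τ, (τ - ζ) ^ (α - 1) * ‖h ζ - h' ζ‖ := by
  rw [← hh.fracInt_sub hα hβ hh' hτ]
  exact norm_fracInt_le_integral _ hτ.1

/-- Solvability of a Volterra equation with a weakly singular kernel and a Lipschitz right-hand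
side in the class of continuous functions with a power singularity at zero. -/
theorem exists_volterra_solution [CompleteSpace F] {α β L C C₀ : ℝ} (hα : α ∈ Ioo (0 : ℝ) 1)
    (hβ : 0 < β) (hL : 0 ≤ L) {g : ℝ → F} {G : ℝ → F → F} (hg : ContinuousOn g (Ioc 0 1))
    (hgC : ∀ ϑ ∈ Ioc (0 : ℝ) 1, ‖g ϑ‖ ≤ C * ϑ ^ (β - 1))
    (hG0 : ∀ ζ ∈ Ioc (0 : ℝ) 1, ‖G ζ 0‖ ≤ C₀ * ζ ^ (β - 1))
    (hGL : ∀ ζ ∈ Ioc (0 : ℝ) 1, ∀ x x', ‖G ζ x - G ζ x'‖ ≤ L * ‖x - x'‖)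
    (hGm : ∀ x : ℝ → F, ContinuousOn x (Ioc 0 1) →
      AEStronglyMeasurable (fun ζ => G ζ (x ζ)) (volume.restrict (Ioc 0 1))) :
    ∃ x : ℝ → F, ContinuousOn x (Ioc 0 1) ∧ HasPowerBound β x ∧
      HasPowerBound β (fun ζ => G ζ (x ζ)) ∧
      ∀ ϑ ∈ Ioc (0 : ℝ) 1, x ϑ = g ϑ + fracInt α (fun ζ => G ζ (x ζ)) ϑ := by
  obtain ⟨k, hk, hkL⟩ := exists_exp_kernel_le (b := 1) (ε := 1 / (2 * (L + 1))) hα hβ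
    (by positivity)
  set ω : ℝ → ℝ := fun ζ => ζ ^ (β - 1) * Real.exp (k * ζ) with hω
  have hωpos : ∀ ζ, 0 < ζ → 0 < ω ζ := fun ζ hζ =>
    mul_pos (Real.rpow_pos_of_pos hζ _) (Real.exp_pos _)
  have hle : ∀ ζ, 0 < ζ → ζ ^ (β - 1) ≤ ω ζ := fun ζ hζ =>
    le_mul_of_one_le_right (Real.rpow_nonneg hζ.le _) (Real.one_le_exp (by positivity))
  have hωle : ∀ ζ ∈ Ioc (0 : ℝ) 1, ω ζ ≤ Real.exp k * ζ ^ (β - 1) := fun ζ hζ => by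
    rw [mul_comm (Real.exp k)]
    refine mul_le_mul_of_nonneg_left (Real.exp_le_exp.2 ?_) (Real.rpow_nonneg hζ.1.le _)
    exact mul_le_of_le_one_right hk.le hζ.2
  have hωc : ContinuousOn ω (Ioc 0 1) :=
    (continuousOn_id.rpow_const fun ζ hζ => Or.inl (ne_of_gt hζ.1)).mul
      (by fun_prop : Continuous fun ζ => Real.exp (k * ζ)).continuousOn
  let B := BoundedContinuousFunction (Ioc (0 : ℝ) 1) F
  -- A bounded continuous ψ encodes the singular function ωψ. This makes the weighted class a
  -- complete metric space without a new type.
  let X : B → ℝ → F := fun ψ ζ => if h : ζ ∈ Ioc (0 : ℝ) 1 then ω ζ • ψ ⟨ζ, h⟩ else 0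
  have hX : ∀ (ψ : B) (ζ : Ioc (0 : ℝ) 1), X ψ ζ = ω ζ • ψ ζ := fun ψ ζ => dif_pos ζ.2
  have hXc : ∀ ψ, ContinuousOn (X ψ) (Ioc 0 1) := fun ψ => by
    rw [continuousOn_iff_continuous_domRestrict] at hωc ⊢
    exact (hωc.smul ψ.continuous).congr fun ζ => (hX ψ ζ).symm
  have hXn : ∀ (ψ : B), ∀ ζ ∈ Ioc (0 : ℝ) 1, ‖X ψ ζ‖ ≤ ω ζ * ‖ψ‖ := fun ψ ζ hζ => by
    rw [hX ψ ⟨ζ, hζ⟩, norm_smul, Real.norm_of_nonneg (hωpos ζ hζ.1).le]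
    exact mul_le_mul_of_nonneg_left (ψ.norm_coe_le_norm _) (hωpos ζ hζ.1).le
  have hXd : ∀ (ψ φ : B), ∀ ζ ∈ Ioc (0 : ℝ) 1, ‖X ψ ζ - X φ ζ‖ ≤ ω ζ * dist ψ φ :=
    fun ψ φ ζ hζ => by
      rw [hX ψ ⟨ζ, hζ⟩, hX φ ⟨ζ, hζ⟩, ← smul_sub, norm_smul,
        Real.norm_of_nonneg (hωpos ζ hζ.1).le, ← dist_eq_norm]
      exact mul_le_mul_of_nonneg_left (BoundedContinuousFunction.dist_coe_le_dist _)
        (hωpos ζ hζ.1).le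
  have hGX : ∀ ψ, HasPowerBound β (fun ζ => G ζ (X ψ ζ)) := fun ψ => by
    refine HasPowerBound.of_bound (C := C₀ + L * (Real.exp k * ‖ψ‖)) (hGm _ (hXc ψ))
      fun ζ hζ => ?_
    calc _ = ‖G ζ 0 + (G ζ (X ψ ζ) - G ζ 0)‖ := by congr 1; abel
      _ ≤ C₀ * ζ ^ (β - 1) + L * (Real.exp k * ζ ^ (β - 1) * ‖ψ‖) := by
        refine (norm_add_le _ _).trans (add_le_add (hG0 ζ hζ) ((hGL ζ hζ _ _).trans ?_))
        rw [sub_zero]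
        exact mul_le_mul_of_nonneg_left ((hXn ψ ζ hζ).trans
          (mul_le_mul_of_nonneg_right (hωle ζ hζ) (norm_nonneg _))) hL
      _ = _ := by ring
  let Y : B → ℝ → F := fun ψ ϑ => g ϑ + fracInt α (fun ζ => G ζ (X ψ ζ)) ϑ
  have hYc : ∀ ψ, ContinuousOn (Y ψ) (Ioc 0 1) := fun ψ =>
    hg.add ((hGX ψ).continuousOn_fracInt hα.1 hβ)
  have hYb : ∀ ψ, ∃ D, ∀ ϑ ∈ Ioc (0 : ℝ) 1, ‖Y ψ ϑ‖ ≤ D * ϑ ^ (β - 1) := fun ψ => by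
    obtain ⟨-, D, hD0, hD⟩ := hGX ψ
    refine ⟨C + D * ProbabilityTheory.beta α β, fun ϑ hϑ => ?_⟩
    have h1 := norm_fracInt_le hα.1 hβ (fun ζ hζ => hD ζ ⟨hζ.1, hζ.2.trans hϑ.2⟩) hϑ.1
    have h2 : ϑ ^ (α + β - 1) ≤ ϑ ^ (β - 1) :=
      Real.rpow_le_rpow_of_exponent_ge hϑ.1 hϑ.2 (by linarith [hα.1])
    have h3 := (ProbabilityTheory.beta_pos hα.1 hβ).le
    calc _ ≤ C * ϑ ^ (β - 1) + D * (ϑ ^ (β - 1) * ProbabilityTheory.beta α β) := by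
          refine (norm_add_le _ _).trans (add_le_add (hgC ϑ hϑ) (h1.trans ?_))
          gcongr
      _ = _ := by ring
  choose D hD using hYb
  let Φ : B → B := fun ψ => BoundedContinuousFunction.ofNormedAddCommGroup
    (fun ϑ : Ioc (0 : ℝ) 1 => (ω ϑ)⁻¹ • Y ψ ϑ)
    (by
      have h1 := continuousOn_iff_continuous_domRestrict.1 (hYc ψ)
      have h2 := continuousOn_iff_continuous_domRestrict.1
        (hωc.inv₀ fun ζ hζ => (hωpos ζ hζ.1).ne')
      exact h2.smul h1)
    (max (D ψ) 0) (fun ϑ => by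
      rw [norm_smul, norm_inv, Real.norm_of_nonneg (hωpos _ ϑ.2.1).le,
        inv_mul_le_iff₀ (hωpos _ ϑ.2.1), mul_comm]
      calc _ ≤ D ψ * (ϑ : ℝ) ^ (β - 1) := hD ψ ϑ ϑ.2
        _ ≤ max (D ψ) 0 * (ϑ : ℝ) ^ (β - 1) :=
          mul_le_mul_of_nonneg_right (le_max_left _ _) (Real.rpow_nonneg ϑ.2.1.le _)
        _ ≤ _ := mul_le_mul_of_nonneg_left (hle _ ϑ.2.1) (le_max_right _ _))
  have hΦ : ∀ (ψ : B) (ϑ : Ioc (0 : ℝ) 1), Φ ψ ϑ = (ω ϑ)⁻¹ • Y ψ ϑ := fun ψ ϑ => rfl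
  -- The factor is L / (2(L+1)) ≤ 1/2 by the choice of the exponential weight.
  have hcontr : ContractingWith (1 / 2) Φ := by
    refine ⟨by rw [← NNReal.coe_lt_coe]; norm_num,
      LipschitzWith.of_dist_le_mul fun ψ φ => ?_⟩
    rw [BoundedContinuousFunction.dist_le (by positivity)]
    rintro ⟨ϑ, hϑ⟩
    rw [hΦ, hΦ, dist_eq_norm, ← smul_sub, norm_smul, norm_inv,
      Real.norm_of_nonneg (hωpos _ hϑ.1).le, inv_mul_le_iff₀ (hωpos _ hϑ.1)]
    simp only [Y, add_sub_add_left_eq_sub]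
    have hint := intervalIntegrable_kernel_mul_rpow_mul_exp k hα.1 hβ hϑ.1.le
    calc _ ≤ ∫ ζ in (0 : ℝ)..ϑ, (ϑ - ζ) ^ (α - 1) * ‖G ζ (X ψ ζ) - G ζ (X φ ζ)‖ :=
          (hGX ψ).norm_fracInt_sub_le hα.1 hβ (hGX φ) ⟨hϑ.1.le, hϑ.2⟩
      _ ≤ ∫ ζ in (0 : ℝ)..ϑ, (ϑ - ζ) ^ (α - 1) * (L * (ω ζ * dist ψ φ)) := by
          refine integral_kernel_mono hϑ.1.le (fun _ _ => norm_nonneg _) (fun ζ hζ => ?_) ?_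
          · have hζ' : ζ ∈ Ioc (0 : ℝ) 1 := ⟨hζ.1, hζ.2.trans hϑ.2⟩
            exact (hGL ζ hζ' _ _).trans (mul_le_mul_of_nonneg_left (hXd ψ φ ζ hζ') hL)
          · refine (hint.const_mul (L * dist ψ φ)).congr_ae (ae_of_all _ fun ζ => ?_)
            simp only [hω]; ring
      _ = L * dist ψ φ * ∫ ζ in (0 : ℝ)..ϑ, (ϑ - ζ) ^ (α - 1) * ω ζ := by
          rw [← intervalIntegral.integral_const_mul]
          congr 1; ext ζ; ring
      _ ≤ L * dist ψ φ * (1 / (2 * (L + 1)) * ω ϑ) :=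
          mul_le_mul_of_nonneg_left (hkL ϑ hϑ) (by positivity)
      _ = L / (L + 1) * (ω ϑ * (1 / 2 * dist ψ φ)) := by field_simp
      _ ≤ 1 * (ω ϑ * (1 / 2 * dist ψ φ)) :=
          mul_le_mul_of_nonneg_right ((div_le_one (by positivity)).2 (by linarith))
            (mul_nonneg (hωpos _ hϑ.1).le (by positivity))
      _ = _ := by
        rw [one_mul]
        push_cast
        ring
  have : Nonempty B := ⟨0⟩
  set ψ := hcontr.fixedPoint Φ
  have hψ : Φ ψ = ψ := hcontr.fixedPoint_isFixedPt
  refine ⟨X ψ, hXc ψ, ?_, hGX ψ, fun ϑ hϑ => ?_⟩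
  · refine hasPowerBound_of_continuousOn (C := Real.exp k * ‖ψ‖) (hXc ψ) fun ζ hζ => ?_
    calc _ ≤ ω ζ * ‖ψ‖ := hXn ψ ζ hζ
      _ ≤ Real.exp k * ζ ^ (β - 1) * ‖ψ‖ :=
        mul_le_mul_of_nonneg_right (hωle ζ hζ) (norm_nonneg ψ)
      _ = _ := by ring
  · have h1 := hX ψ ⟨ϑ, hϑ⟩
    rw [← hψ, hΦ, smul_inv_smul₀ (hωpos _ hϑ.1).ne', hψ] at h1
    exact h1

/-- The Gronwall inequality with zero free term. The integrands are kept abstract so that one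
statement serves the nonlinear equation and both linear ones. -/
theorem eqOn_of_volterra {α β L : ℝ} (hα : α ∈ Ioo (0 : ℝ) 1) (hβ : 0 < β) (hL : 0 ≤ L)
    {g x x' h h' : ℝ → F} (hx : HasPowerBound β x) (hx' : HasPowerBound β x')
    (hh : HasPowerBound β h) (hh' : HasPowerBound β h')
    (hLip : ∀ ζ ∈ Ioc (0 : ℝ) 1, ‖h ζ - h' ζ‖ ≤ L * ‖x ζ - x' ζ‖)
    (he : ∀ ϑ ∈ Ioc (0 : ℝ) 1, x ϑ = g ϑ + fracInt α h ϑ)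
    (he' : ∀ ϑ ∈ Ioc (0 : ℝ) 1, x' ϑ = g ϑ + fracInt α h' ϑ) :
    EqOn x x' (Ioc 0 1) := by
  obtain ⟨A, hA, hgron⟩ := exists_gronwall_const hα hβ one_pos hL
  have hd := hx.sub hx'
  obtain ⟨-, D, -, hD⟩ := id hd
  intro ϑ hϑ
  have := hgron (fun ζ => ‖x ζ - x' ζ‖) 0 D le_rfl (fun ζ _ => norm_nonneg (x ζ - x' ζ)) hD (fun τ hτ => ?_)
    ϑ hϑ
  · simp only [mul_zero, zero_mul] at this
    exact sub_eq_zero.1 (norm_le_zero_iff.1 this)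
  · rw [zero_mul, zero_add, he τ hτ, he' τ hτ, add_sub_add_left_eq_sub,
      ← intervalIntegral.integral_const_mul]
    refine (hh.norm_fracInt_sub_le hα.1 hβ hh' ⟨hτ.1.le, hτ.2⟩).trans ?_
    simp only [mul_left_comm L]
    refine integral_kernel_mono (u := fun ζ => ‖h ζ - h' ζ‖) (v := fun ζ => L * ‖x ζ - x' ζ‖)
      hτ.1.le (fun _ _ => norm_nonneg _)
      (fun ζ hζ => hLip ζ ⟨hζ.1, hζ.2.trans hτ.2⟩) ?_
    have hn : HasPowerBound β fun ζ => L • ‖x ζ - x' ζ‖ :=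
      HasPowerBound.const_smul ⟨hd.1.norm, by simpa using hd.2⟩ L
    exact hn.intervalIntegrable hα.1 hβ ⟨hτ.1.le, hτ.2⟩

end Volterra

end FracControl

namespace FracControl

/-! ### Averaging with respect to relaxed controls -/

section Average

variable {m : ℕ} {P : Set (Vec m)} {F : Type*} [NormedAddCommGroup F]

theorem integrable_average (hP : IsCompact P) {h : Vec m → F} (hh : ContinuousOn h P)
    (μ : ProbabilityMeasure P) : Integrable (fun u : P => h u) (μ : Measure P) := by
  have : CompactSpace P := isCompact_iff_compactSpace.1 hP
  exact (continuousOn_iff_continuous_domRestrict.1 hh).integrable_of_hasCompactSupport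
    (HasCompactSupport.of_compactSpace _)

variable [NormedSpace ℝ F]

/-- A measurable version of the control is a Markov kernel from ℝ to `P`. The integrand, extended by
zero off (0, 1] × P, is jointly measurable, so its integral against the kernel is measurable in
time. -/
theorem aestronglyMeasurable_average [SecondCountableTopology F]
    {ν : ℝ → ProbabilityMeasure P} (hν : IsRelaxedControl ν) {h : ℝ → Vec m → F}
    (hh : ContinuousOn (fun q : ℝ × Vec m => h q.1 q.2) (Ioc 0 1 ×ˢ P)) :
    AEStronglyMeasurable (fun ζ => ∫ u, h ζ (u : Vec m) ∂(ν ζ : Measure P))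
      (volume.restrict (Ioc 0 1)) := by
  classical
  borelize F
  have hν' : AEMeasurable ν (volume.restrict (Ioc 0 1)) :=
    hν.mono_measure (Measure.restrict_mono Ioc_subset_Icc_self le_rfl)
  let ν' : ℝ → ProbabilityMeasure P := hν'.mk ν
  let κ : ProbabilityTheory.Kernel ℝ P :=
    ⟨fun ζ => (ν' ζ : Measure P), measurable_subtype_coe.comp hν'.measurable_mk⟩
  have : ProbabilityTheory.IsMarkovKernel κ :=
    ⟨fun ζ => inferInstanceAs (IsProbabilityMeasure (ν' ζ : Measure P))⟩
  let S : Set (ℝ × P) := Ioc 0 1 ×ˢ univ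
  have hc : ContinuousOn (fun q : ℝ × P => h q.1 q.2) S :=
    hh.comp (f := fun q : ℝ × P => (q.1, (q.2 : Vec m))) (by fun_prop)
      fun q hq => ⟨hq.1, q.2.2⟩
  have hm : Measurable (S.piecewise (fun q : ℝ × P => h q.1 q.2) fun _ => 0) :=
    hc.measurable_piecewise continuousOn_const (measurableSet_Ioc.prod MeasurableSet.univ)
  have h1 := StronglyMeasurable.integral_kernel_prod_right' (κ := κ) hm.stronglyMeasurable
  refine ⟨_, h1, ?_⟩
  filter_upwards [ae_restrict_mem measurableSet_Ioc, hν'.ae_eq_mk] with ζ hζ he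
  rw [he]
  refine integral_congr_ae (ae_of_all _ fun u => ?_)
  simp only [piecewise_eq_of_mem S _ _ (show (ζ, u) ∈ S from ⟨hζ, mem_univ _⟩)]

theorem norm_average_le {C : ℝ} {h : Vec m → F} (hC : ∀ u ∈ P, ‖h u‖ ≤ C)
    (μ : ProbabilityMeasure P) : ‖∫ u : P, h u ∂(μ : Measure P)‖ ≤ C := by
  have := norm_integral_le_of_norm_le_const (μ := (μ : Measure P)) (f := fun u : P => h u)
    (ae_of_all _ fun u => hC u u.2)
  simpa using this

end Average

/-! ### The right-hand side -/

section RightHandSide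

variable {n m : ℕ} {T α : ℝ} {P : Set (Vec m)} {f : ℝ → Vec n → Vec m → Vec n}

/-- The rescaled right-hand side. -/
def RFun (T α : ℝ) (f : ℝ → Vec n → Vec m → Vec n) (t ϑ : ℝ) (x : Vec n) (u : Vec m) : Vec n :=
  (T - t) ^ α • f (t + ϑ * (T - t)) x u

/-- The rescaled right-hand side averaged with respect to a probability measure. -/
def RStar (T α : ℝ) (f : ℝ → Vec n → Vec m → Vec n) (t ϑ : ℝ) (x : Vec n)
    (μ : ProbabilityMeasure P) : Vec n :=
  ∫ u, RFun T α f t ϑ x (u : Vec m) ∂(μ : Measure P)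

theorem RStar_eq (T α : ℝ) (f : ℝ → Vec n → Vec m → Vec n) (t ϑ : ℝ) (x : Vec n)
    (μ : ProbabilityMeasure P) :
    RStar T α f t ϑ x μ = (T - t) ^ α • fStar f (t + ϑ * (T - t)) x μ :=
  integral_smul _ _

/-- This is where b comes from: the physical time t + σ + ϑ(T-t-σ) has σ-derivative 1 - ϑ, and
differentiating the prefactor (T-t-σ)^α yields the second term. -/
theorem hasDerivWithinAt_RFun {t δ σ ϑ : ℝ} {x : Vec n} {u : Vec m} (hf4 : CondF4 T f P)
    (ht : 0 ≤ t) (hδ : t + δ < T) (hσ : σ ∈ Icc 0 δ) (hϑ : ϑ ∈ Icc (0 : ℝ) 1) (hu : u ∈ P) :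
    HasDerivWithinAt (fun σ => RFun T α f (t + σ) ϑ x u)
      (bFun T α f (t + σ) (fun _ => x) ϑ u) (Icc 0 δ) σ := by
  have hmaps : MapsTo (fun σ => t + σ + ϑ * (T - (t + σ))) (Icc 0 δ) (Icc 0 T) := fun s hs =>
    (mul_mem_Icc (by linarith [hs.1]) (by linarith [hs.2]) hϑ).2
  have hs : 0 < T - (t + σ) := by linarith [hσ.2]
  have h1 : HasDerivWithinAt (fun s => f s x u) (dtau T f (t + σ + ϑ * (T - (t + σ))) x u)
      (Icc 0 T) (t + σ + ϑ * (T - (t + σ))) :=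
    ((hf4.1 _ (hmaps hσ) x u hu).1).hasDerivWithinAt
  have h2 : HasDerivWithinAt (fun σ => t + σ + ϑ * (T - (t + σ))) (1 - ϑ) (Icc 0 δ) σ := by
    have h : HasDerivAt (fun σ => t + σ + ϑ * (T - (t + σ))) (1 + ϑ * (-1)) σ :=
      ((hasDerivAt_id σ).const_add t).fun_add
        ((((hasDerivAt_id σ).const_add t).const_sub T).const_mul ϑ)
    exact (h.congr_deriv (by ring)).hasDerivWithinAt
  have h3 : HasDerivWithinAt (fun σ => (T - (t + σ)) ^ α) (-(α / (T - (t + σ)) ^ (1 - α)))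
      (Icc 0 δ) σ := by
    have h := ((((hasDerivAt_id σ).const_add t).const_sub T).rpow_const (p := α) (Or.inl hs.ne'))
    refine (h.congr_deriv ?_).hasDerivWithinAt
    simp only [id]
    rw [show α - 1 = -(1 - α) by ring, Real.rpow_neg hs.le]
    ring
  have h4 := h3.fun_smul (h1.scomp σ h2 hmaps)
  refine h4.congr_deriv ?_
  simp only [bFun, Function.comp_apply]
  module

/-- The increment is split into a move in x at time t + δ and a move in time at fixed x, each
handled by a mean value inequality. With `A` and `b` zero this is a Lipschitz bound; with the true
derivatives it is differentiability. -/
theorem norm_RFun_sub_sub_le {t δ ϑ ε : ℝ} {x x' b : Vec n} {u : Vec m}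
    {A : Vec n →L[ℝ] Vec n} (hf4 : CondF4 T f P) (ht : 0 ≤ t) (hδ0 : 0 ≤ δ) (hδ : t + δ < T)
    (hϑ : ϑ ∈ Icc (0 : ℝ) 1) (hu : u ∈ P)
    (hA : ∀ z ∈ segment ℝ x x', ‖AFun T α f (t + δ) (fun _ => z) ϑ u - A‖ ≤ ε)
    (hb : ∀ σ ∈ Icc 0 δ, ‖bFun T α f (t + σ) (fun _ => x) ϑ u - b‖ ≤ ε) :
    ‖RFun T α f (t + δ) ϑ x' u - RFun T α f t ϑ x u - A (x' - x) - δ • b‖ ≤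
      ε * (‖x' - x‖ + δ) := by
  have hτ : t + δ + ϑ * (T - (t + δ)) ∈ Icc 0 T := (mul_mem_Icc (by linarith) hδ.le hϑ).2
  have h1 : ‖RFun T α f (t + δ) ϑ x' u - RFun T α f (t + δ) ϑ x u - A (x' - x)‖ ≤
      ε * ‖x' - x‖ := by
    refine Convex.norm_image_sub_le_of_norm_hasFDerivWithin_le'
      (f := fun z => RFun T α f (t + δ) ϑ z u)
      (f' := fun z => AFun T α f (t + δ) (fun _ => z) ϑ u) (fun z _ => ?_) hA
      (convex_segment x x') (left_mem_segment ℝ x x') (right_mem_segment ℝ x x')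
    exact ((hf4.1 _ hτ z u hu).2.hasFDerivAt.const_smul ((T - (t + δ)) ^ α)).hasFDerivWithinAt
  have h2 : ‖(RFun T α f (t + δ) ϑ x u - δ • b) - (RFun T α f (t + 0) ϑ x u - (0 : ℝ) • b)‖ ≤
      ε * ‖δ - 0‖ := by
    refine Convex.norm_image_sub_le_of_norm_hasDerivWithin_le
      (f := fun σ => RFun T α f (t + σ) ϑ x u - σ • b)
      (f' := fun σ => bFun T α f (t + σ) (fun _ => x) ϑ u - b) (fun σ hσ => ?_) hb
      (convex_Icc 0 δ) (left_mem_Icc.2 hδ0) (right_mem_Icc.2 hδ0)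
    have h := (hasDerivWithinAt_RFun (α := α) (x := x) hf4 ht hδ hσ hϑ hu).fun_sub
      ((hasDerivWithinAt_id σ (Icc 0 δ)).smul_const b)
    exact h.congr_deriv (by rw [one_smul])
  rw [sub_zero, Real.norm_of_nonneg hδ0, add_zero, zero_smul, sub_zero] at h2
  calc _ = ‖(RFun T α f (t + δ) ϑ x' u - RFun T α f (t + δ) ϑ x u - A (x' - x)) +
        (RFun T α f (t + δ) ϑ x u - δ • b - RFun T α f t ϑ x u)‖ := by congr 1; abel
    _ ≤ _ := by rw [mul_add]; exact (norm_add_le _ _).trans (add_le_add h1 h2)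

theorem mapsTo_time {η : ℝ} (hη : 0 < η) :
    MapsTo (fun q : ℝ × ℝ × Vec n × Vec m => (q.1 + q.2.1 * (T - q.1), q.2.2.1, q.2.2.2))
      (Icc 0 (T - η) ×ˢ Icc 0 1 ×ˢ univ ×ˢ P) (Icc 0 T ×ˢ univ ×ˢ P) := fun q hq =>
  ⟨(mul_mem_Icc hq.1.1 (by linarith [hq.1.2]) hq.2.1).2, mem_univ _, hq.2.2.2⟩

theorem continuousOn_pow_time {η p : ℝ} (hη : 0 < η) (S : Set (ℝ × Vec n × Vec m)) :
    ContinuousOn (fun q : ℝ × ℝ × Vec n × Vec m => (T - q.1) ^ p) (Icc 0 (T - η) ×ˢ S) :=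
  ContinuousOn.rpow_const (by fun_prop) fun q hq => Or.inl (by linarith [hq.1.2] : 0 < T - q.1).ne'

theorem continuousOn_RFun (hf1 : CondF1 T f P) {η : ℝ} (hη : 0 < η) :
    ContinuousOn (fun q : ℝ × ℝ × Vec n × Vec m => RFun T α f q.1 q.2.1 q.2.2.1 q.2.2.2)
      (Icc 0 (T - η) ×ˢ Icc 0 1 ×ˢ univ ×ˢ P) :=
  (continuousOn_pow_time hη _).smul
    (ContinuousOn.comp (g := fun q : ℝ × Vec n × Vec m => f q.1 q.2.1 q.2.2) hf1
      (by fun_prop) (mapsTo_time hη))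

theorem continuousOn_AFun (hf4 : CondF4 T f P) {η : ℝ} (hη : 0 < η) :
    ContinuousOn (fun q : ℝ × ℝ × Vec n × Vec m =>
      AFun T α f q.1 (fun _ => q.2.2.1) q.2.1 q.2.2.2) (Icc 0 (T - η) ×ˢ Icc 0 1 ×ˢ univ ×ˢ P) :=
  (continuousOn_pow_time hη _).smul
    (ContinuousOn.comp (g := fun q : ℝ × Vec n × Vec m => dx f q.1 q.2.1 q.2.2) hf4.2.2
      (by fun_prop) (mapsTo_time hη))

theorem continuousOn_bFun (hf1 : CondF1 T f P) (hf4 : CondF4 T f P) {η : ℝ} (hη : 0 < η) :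
    ContinuousOn (fun q : ℝ × ℝ × Vec n × Vec m =>
      bFun T α f q.1 (fun _ => q.2.2.1) q.2.1 q.2.2.2)
      (Icc 0 (T - η) ×ˢ Icc 0 1 ×ˢ univ ×ˢ P) := by
  refine ContinuousOn.sub (ContinuousOn.smul (ContinuousOn.mul (by fun_prop)
    (continuousOn_pow_time hη _)) ?_) (ContinuousOn.smul (continuousOn_const.div
    (continuousOn_pow_time hη _) fun q hq => ?_) ?_)
  · exact ContinuousOn.comp (g := fun q : ℝ × Vec n × Vec m => dtau T f q.1 q.2.1 q.2.2) hf4.2.1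
      (by fun_prop) (mapsTo_time hη)
  · exact (Real.rpow_pos_of_pos (by linarith [hq.1.2] : 0 < T - q.1) _).ne'
  · exact ContinuousOn.comp (g := fun q : ℝ × Vec n × Vec m => f q.1 q.2.1 q.2.2) hf1
      (by fun_prop) (mapsTo_time hη)

/-! ### Uniform bounds and moduli of continuity on compact sets -/

section Slices

variable {E : Type*} [NormedAddCommGroup E] {η t : ℝ} {H : ℝ × ℝ × Vec n × Vec m → E}

theorem ContinuousOn.slice_control
    (hH : ContinuousOn H (Icc 0 (T - η) ×ˢ Icc 0 1 ×ˢ univ ×ˢ P)) (ht : t ∈ Icc 0 (T - η))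
    {ϑ : ℝ} (hϑ : ϑ ∈ Icc (0 : ℝ) 1) (x : Vec n) : ContinuousOn (fun u => H (t, ϑ, x, u)) P :=
  hH.comp (f := fun u => (t, ϑ, x, u)) (by fun_prop) fun _ hu => ⟨ht, hϑ, mem_univ _, hu⟩

theorem ContinuousOn.slice_time
    (hH : ContinuousOn H (Icc 0 (T - η) ×ˢ Icc 0 1 ×ˢ univ ×ˢ P)) (ht : t ∈ Icc 0 (T - η))
    {y : ℝ → Vec n} (hy : ContinuousOn y (Ioc 0 1)) :
    ContinuousOn (fun q : ℝ × Vec m => H (t, q.1, y q.1, q.2)) (Ioc 0 1 ×ˢ P) :=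
  hH.comp (f := fun q : ℝ × Vec m => (t, q.1, y q.1, q.2))
    (continuousOn_const.prodMk (continuousOn_fst.prodMk
      ((hy.comp continuousOn_fst fun _ hq => hq.1).prodMk continuousOn_snd)))
    fun _ hq => ⟨ht, Ioc_subset_Icc_self hq.1, mem_univ _, hq.2⟩

theorem exists_bound_of_continuousOn (hP : IsCompact P)
    (hH : ContinuousOn H (Icc 0 (T - η) ×ˢ Icc 0 1 ×ˢ univ ×ˢ P)) (R : ℝ) :
    ∃ C, 0 ≤ C ∧ ∀ t ∈ Icc 0 (T - η), ∀ ϑ ∈ Icc (0 : ℝ) 1, ∀ x : Vec n, ‖x‖ ≤ R → ∀ u ∈ P,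
      ‖H (t, ϑ, x, u)‖ ≤ C := by
  have hK : IsCompact (Icc 0 (T - η) ×ˢ Icc (0 : ℝ) 1 ×ˢ Metric.closedBall (0 : Vec n) R ×ˢ P) :=
    isCompact_Icc.prod (isCompact_Icc.prod ((isCompact_closedBall _ _).prod hP))
  obtain ⟨C, hC⟩ := hK.exists_bound_of_continuousOn (hH.mono
    (prod_mono_right (prod_mono_right (prod_mono_left (subset_univ _)))))
  refine ⟨max C 0, le_max_right _ _, fun t ht ϑ hϑ x hx u hu => (hC _ ?_).trans (le_max_left _ _)⟩
  exact ⟨ht, hϑ, by simpa using hx, hu⟩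

theorem exists_modulus_of_continuousOn (hP : IsCompact P)
    (hH : ContinuousOn H (Icc 0 (T - η) ×ˢ Icc 0 1 ×ˢ univ ×ˢ P)) (R : ℝ) {ε : ℝ} (hε : 0 < ε) :
    ∃ ρ, 0 < ρ ∧ ∀ t ∈ Icc 0 (T - η), ∀ t' ∈ Icc 0 (T - η), |t' - t| ≤ ρ →
      ∀ ϑ ∈ Icc (0 : ℝ) 1, ∀ x x' : Vec n, ‖x‖ ≤ R → ‖x'‖ ≤ R → ‖x' - x‖ ≤ ρ → ∀ u ∈ P,
      ‖H (t', ϑ, x', u) - H (t, ϑ, x, u)‖ ≤ ε := by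
  have hK : IsCompact (Icc 0 (T - η) ×ˢ Icc (0 : ℝ) 1 ×ˢ Metric.closedBall (0 : Vec n) R ×ˢ P) :=
    isCompact_Icc.prod (isCompact_Icc.prod ((isCompact_closedBall _ _).prod hP))
  have huc := hK.uniformContinuousOn_of_continuous (hH.mono
    (prod_mono_right (prod_mono_right (prod_mono_left (subset_univ _)))))
  obtain ⟨ρ, hρ, h⟩ := Metric.uniformContinuousOn_iff_le.1 huc ε hε
  refine ⟨ρ, hρ, fun t ht t' ht' htt ϑ hϑ x x' hx hx' hxx u hu => ?_⟩
  rw [← dist_eq_norm]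
  refine h _ ⟨ht', hϑ, by simpa using hx', hu⟩ _ ⟨ht, hϑ, by simpa using hx, hu⟩ ?_
  refine max_le htt (max_le ?_ (max_le ((dist_eq_norm _ _).trans_le hxx) ?_))
  · simpa using hρ.le
  · simpa using hρ.le

end Slices

theorem norm_le_of_mem_segment {R : ℝ} {x x' z : Vec n} (hx : ‖x‖ ≤ R) (hx' : ‖x'‖ ≤ R)
    (hz : z ∈ segment ℝ x x') : ‖z‖ ≤ R := by
  have := (convex_closedBall (0 : Vec n) R).segment_subset (by simpa using hx)
    (by simpa using hx') hz
  simpa using this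

theorem norm_sub_le_of_mem_segment {x x' z : Vec n} (hz : z ∈ segment ℝ x x') :
    ‖z - x‖ ≤ ‖x' - x‖ := by
  have := (convex_closedBall x ‖x' - x‖).segment_subset (by simp)
    (by simp [dist_eq_norm]) hz
  simpa [dist_eq_norm] using this

theorem RStar_sub_sub_eq (hP : IsCompact P) (hf1 : CondF1 T f P) (hf4 : CondF4 T f P) {η : ℝ}
    (hη : 0 < η) {t t' ϑ : ℝ} (ht : t ∈ Icc 0 (T - η)) (ht' : t' ∈ Icc 0 (T - η))
    (hϑ : ϑ ∈ Icc (0 : ℝ) 1) (x' z : Vec n) (δ : ℝ) (y : ℝ → Vec n)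
    (μ : ProbabilityMeasure P) :
    RStar T α f t' ϑ x' μ - RStar T α f t ϑ (y ϑ) μ - AStar T α f t y ϑ μ z -
        δ • bStar T α f t y ϑ μ =
      ∫ u : P, (RFun T α f t' ϑ x' u - RFun T α f t ϑ (y ϑ) u - AFun T α f t y ϑ u z -
        δ • bFun T α f t y ϑ u) ∂(μ : Measure P) := by
  have h1 : Integrable (fun u : P => RFun T α f t' ϑ x' u) (μ : Measure P) :=
    integrable_average hP ((continuousOn_RFun hf1 hη).slice_control ht' hϑ x') μ
  have h2 : Integrable (fun u : P => RFun T α f t ϑ (y ϑ) u) (μ : Measure P) :=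
    integrable_average hP ((continuousOn_RFun hf1 hη).slice_control ht hϑ (y ϑ)) μ
  have h3 : Integrable (fun u : P => AFun T α f t y ϑ u) (μ : Measure P) :=
    integrable_average hP ((continuousOn_AFun hf4 hη).slice_control ht hϑ (y ϑ)) μ
  have h4 : Integrable (fun u : P => bFun T α f t y ϑ u) (μ : Measure P) :=
    integrable_average hP ((continuousOn_bFun hf1 hf4 hη).slice_control ht hϑ (y ϑ)) μ
  have h3' := h3.apply_continuousLinearMap z
  have e := integral_sub ((h1.sub h2).sub h3') (h4.smul δ)
  have e' := integral_sub (h1.sub h2) h3'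
  simp only [Pi.sub_apply, Pi.smul_apply] at e e'
  rw [e, e', integral_sub h1 h2, integral_smul, AStar, ContinuousLinearMap.integral_apply h3]
  rfl

theorem RStar_sub_eq (hP : IsCompact P) (hf1 : CondF1 T f P) {η : ℝ}
    (hη : 0 < η) {t t' ϑ : ℝ} (ht : t ∈ Icc 0 (T - η)) (ht' : t' ∈ Icc 0 (T - η))
    (hϑ : ϑ ∈ Icc (0 : ℝ) 1) (x x' : Vec n) (μ : ProbabilityMeasure P) :
    RStar T α f t' ϑ x' μ - RStar T α f t ϑ x μ =
      ∫ u : P, (RFun T α f t' ϑ x' u - RFun T α f t ϑ x u) ∂(μ : Measure P) :=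
  (integral_sub
    (integrable_average hP ((continuousOn_RFun (α := α) hf1 hη).slice_control ht' hϑ x') μ)
    (integrable_average hP ((continuousOn_RFun (α := α) hf1 hη).slice_control ht hϑ x) μ)).symm

/-- Bounds for the averaged right-hand side and its derivatives on bounded sets. -/
theorem exists_star_bounds (hP : IsCompact P) (hf1 : CondF1 T f P) (hf4 : CondF4 T f P) {η : ℝ}
    (hη : 0 < η) (R : ℝ) :
    ∃ C, 0 ≤ C ∧ ∀ t ∈ Icc 0 (T - η), ∀ ϑ ∈ Icc (0 : ℝ) 1, ∀ μ : ProbabilityMeasure P,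
      (∀ y : ℝ → Vec n, ‖y ϑ‖ ≤ R → ‖AStar T α f t y ϑ μ‖ ≤ C ∧ ‖bStar T α f t y ϑ μ‖ ≤ C) ∧
      ∀ t' ∈ Icc t (T - η), ∀ x x' : Vec n, ‖x‖ ≤ R → ‖x'‖ ≤ R →
        ‖RStar T α f t' ϑ x' μ - RStar T α f t ϑ x μ‖ ≤ C * (‖x' - x‖ + (t' - t)) := by
  obtain ⟨C₁, hC₁, h₁⟩ := exists_bound_of_continuousOn hP (continuousOn_AFun (α := α) hf4 hη) R
  obtain ⟨C₂, hC₂, h₂⟩ := exists_bound_of_continuousOn hP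
    (continuousOn_bFun (α := α) hf1 hf4 hη) R
  refine ⟨max C₁ C₂, le_max_of_le_left hC₁, fun t ht ϑ hϑ μ => ⟨fun y hy => ⟨?_, ?_⟩, ?_⟩⟩
  · exact norm_average_le (fun u hu => (h₁ t ht ϑ hϑ _ hy u hu).trans (le_max_left _ _)) μ
  · exact norm_average_le (fun u hu => (h₂ t ht ϑ hϑ _ hy u hu).trans (le_max_right _ _)) μ
  · intro t' ht' x x' hx hx'
    rw [RStar_sub_eq hP hf1 hη ht ⟨ht.1.trans ht'.1, ht'.2⟩ hϑ]
    refine norm_average_le (h := fun u => RFun T α f t' ϑ x' u - RFun T α f t ϑ x u)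
      (fun u hu => ?_) μ
    -- With zero linear part the role of ε is played by the bound on the derivatives.
    have := norm_RFun_sub_sub_le (α := α) (t := t) (δ := t' - t) (x := x) (x' := x') (b := 0)
      (A := 0) (ε := max C₁ C₂) hf4 ht.1 (sub_nonneg.2 ht'.1) (by linarith [ht'.2]) hϑ hu
      (fun z hz => ?_) (fun σ hσ => ?_)
    · simpa using this
    · rw [sub_zero, add_sub_cancel]
      exact (h₁ t' ⟨ht.1.trans ht'.1, ht'.2⟩ ϑ hϑ _ (norm_le_of_mem_segment hx hx' hz) u hu).trans
        (le_max_left _ _)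
    · rw [sub_zero]
      exact (h₂ (t + σ) ⟨by linarith [ht.1, hσ.1], by linarith [hσ.2, ht'.2]⟩ ϑ hϑ _ hx u hu).trans
        (le_max_right _ _)

/-- Uniform differentiability of the averaged right-hand side on bounded sets. -/
theorem exists_star_modulus (hP : IsCompact P) (hf1 : CondF1 T f P) (hf4 : CondF4 T f P) {η : ℝ}
    (hη : 0 < η) (R : ℝ) {ε : ℝ} (hε : 0 < ε) :
    ∃ ρ, 0 < ρ ∧ ∀ t ∈ Icc 0 (T - η), ∀ t' ∈ Icc t (T - η), t' - t ≤ ρ →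
      ∀ ϑ ∈ Icc (0 : ℝ) 1, ∀ (y : ℝ → Vec n) (x' : Vec n), ‖y ϑ‖ ≤ R → ‖x'‖ ≤ R →
      ‖x' - y ϑ‖ ≤ ρ → ∀ μ : ProbabilityMeasure P,
      ‖RStar T α f t' ϑ x' μ - RStar T α f t ϑ (y ϑ) μ - AStar T α f t y ϑ μ (x' - y ϑ) -
        (t' - t) • bStar T α f t y ϑ μ‖ ≤ ε * (‖x' - y ϑ‖ + (t' - t)) := by
  obtain ⟨ρ₁, hρ₁, h₁⟩ := exists_modulus_of_continuousOn hP
    (continuousOn_AFun (α := α) hf4 hη) R hε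
  obtain ⟨ρ₂, hρ₂, h₂⟩ := exists_modulus_of_continuousOn hP
    (continuousOn_bFun (α := α) hf1 hf4 hη) R hε
  refine ⟨min ρ₁ ρ₂, lt_min hρ₁ hρ₂, fun t ht t' ht' htt ϑ hϑ y x' hy hx' hxy μ => ?_⟩
  have ht'' : t' ∈ Icc 0 (T - η) := ⟨ht.1.trans ht'.1, ht'.2⟩
  rw [RStar_sub_sub_eq hP hf1 hf4 hη ht ht'' hϑ]
  refine norm_average_le (h := fun u => RFun T α f t' ϑ x' u - RFun T α f t ϑ (y ϑ) u -
    AFun T α f t y ϑ u (x' - y ϑ) - (t' - t) • bFun T α f t y ϑ u) (fun u hu => ?_) μ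
  have := norm_RFun_sub_sub_le (α := α) (t := t) (δ := t' - t) (x := y ϑ) (x' := x')
    (b := bFun T α f t y ϑ u) (A := AFun T α f t y ϑ u) (ε := ε) hf4 ht.1 (sub_nonneg.2 ht'.1)
    (by linarith [ht'.2]) hϑ hu (fun z hz => ?_) (fun σ hσ => ?_)
  · rwa [add_sub_cancel] at this
  · rw [add_sub_cancel]
    refine h₁ t ht t' ht'' ?_ ϑ hϑ _ _ hy (norm_le_of_mem_segment hy hx' hz) ?_ u hu
    · rw [abs_of_nonneg (sub_nonneg.2 ht'.1)]
      exact htt.trans (min_le_left _ _)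
    · exact (norm_sub_le_of_mem_segment hz).trans (hxy.trans (min_le_left _ _))
  · refine h₂ t ht (t + σ) ⟨by linarith [ht.1, hσ.1], by linarith [hσ.2, ht'.2]⟩ ?_ ϑ hϑ _ _ hy hy
      (by simpa using hρ₂.le) u hu
    rw [add_sub_cancel_left, abs_of_nonneg hσ.1]
    exact hσ.2.trans (htt.trans (min_le_right _ _))

theorem aestronglyMeasurable_RStar (hf1 : CondF1 T f P) {t : ℝ} (ht : t ∈ Ico 0 T)
    {ν : ℝ → ProbabilityMeasure P} (hν : IsRelaxedControl ν) {y : ℝ → Vec n}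
    (hy : ContinuousOn y (Ioc 0 1)) :
    AEStronglyMeasurable (fun ζ => RStar T α f t ζ (y ζ) (ν ζ)) (volume.restrict (Ioc 0 1)) :=
  aestronglyMeasurable_average hν ((continuousOn_RFun (α := α) hf1 (sub_pos.2 ht.2)).slice_time
    ⟨ht.1, by linarith⟩ hy)

theorem aestronglyMeasurable_AStar (hf4 : CondF4 T f P) {t : ℝ} (ht : t ∈ Ico 0 T)
    {ν : ℝ → ProbabilityMeasure P} (hν : IsRelaxedControl ν) {y : ℝ → Vec n}
    (hy : ContinuousOn y (Ioc 0 1)) :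
    AEStronglyMeasurable (fun ζ => AStar T α f t y ζ (ν ζ)) (volume.restrict (Ioc 0 1)) :=
  aestronglyMeasurable_average hν ((continuousOn_AFun (α := α) hf4 (sub_pos.2 ht.2)).slice_time
    ⟨ht.1, by linarith⟩ hy)

theorem aestronglyMeasurable_bStar (hf1 : CondF1 T f P) (hf4 : CondF4 T f P) {t : ℝ}
    (ht : t ∈ Ico 0 T) {ν : ℝ → ProbabilityMeasure P} (hν : IsRelaxedControl ν) {y : ℝ → Vec n}
    (hy : ContinuousOn y (Ioc 0 1)) :
    AEStronglyMeasurable (fun ζ => bStar T α f t y ζ (ν ζ)) (volume.restrict (Ioc 0 1)) :=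
  aestronglyMeasurable_average hν
    ((continuousOn_bFun (α := α) hf1 hf4 (sub_pos.2 ht.2)).slice_time ⟨ht.1, by linarith⟩ hy)

theorem norm_RStar_le {c : ℝ} (hf3 : CondF3 T f P c) {t ϑ : ℝ} (ht : t ∈ Ico 0 T)
    (hϑ : ϑ ∈ Icc (0 : ℝ) 1) (hα : 0 ≤ α) (x : Vec n) (μ : ProbabilityMeasure P) :
    ‖RStar T α f t ϑ x μ‖ ≤ T ^ α * c * (1 + ‖x‖) := by
  refine norm_average_le (h := RFun T α f t ϑ x) (fun u hu => ?_) μ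
  have h0 : 0 ≤ T - t := by linarith [ht.2]
  rw [RFun, norm_smul, Real.norm_of_nonneg (Real.rpow_nonneg h0 _), mul_assoc]
  exact mul_le_mul (Real.rpow_le_rpow h0 (by linarith [ht.1]) hα)
    (hf3 _ (mul_mem_Icc ht.1 ht.2.le hϑ).2 x u hu) (norm_nonneg _)
    (Real.rpow_nonneg (ht.1.trans ht.2.le) _)

end RightHandSide

end FracControl

namespace FracControl

/-! ### Existence and uniqueness of solutions -/

/-- A priori bound for solutions of Volterra equations with sublinear growth. -/
theorem exists_volterra_bound {α b c K : ℝ} (hα : α ∈ Ioo (0 : ℝ) 1) (hb : 0 < b) (hc : 0 ≤ c)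
    (hK : 0 ≤ K) :
    ∃ R, 0 ≤ R ∧ ∀ {F : Type} [NormedAddCommGroup F] [NormedSpace ℝ F] (y a h : ℝ → F),
      ContinuousOn y (Icc 0 b) → (∀ ϑ ∈ Icc 0 b, ‖a ϑ‖ ≤ K) →
      (∀ ζ ∈ Ioc 0 b, ‖h ζ‖ ≤ c * (1 + ‖y ζ‖)) →
      (∀ ϑ ∈ Icc 0 b, y ϑ = a ϑ + fracInt α h ϑ) → ∀ ϑ ∈ Icc 0 b, ‖y ϑ‖ ≤ R := by
  obtain ⟨A, hA, hgron⟩ := exists_gronwall_const hα one_pos hb hc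
  -- The inequality is applied to 1 + ‖y‖, whence 1 + K. The extra K covers ϑ = 0, which the
  -- Gronwall inequality on (0, b] leaves out.
  refine ⟨A * (1 + K) + K, by positivity, fun y a h hy ha hh he ϑ hϑ => ?_⟩
  rcases hϑ.1.eq_or_lt with rfl | h0
  · rw [he 0 hϑ, fracInt_zero, add_zero]
    exact (ha 0 hϑ).trans (by linarith [mul_nonneg hA.le (add_nonneg zero_le_one hK)])
  obtain ⟨D, hD⟩ := isCompact_Icc.exists_bound_of_continuousOn hy
  have hD' : ∀ τ ∈ Ioc 0 b, 1 + ‖y τ‖ ≤ (1 + D) * τ ^ ((1 : ℝ) - 1) := fun τ hτ => by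
    simpa using hD τ (Ioc_subset_Icc_self hτ)
  have h1 := hgron (fun τ => 1 + ‖y τ‖) (1 + K) (1 + D) (by positivity) (fun _ _ => by positivity)
    hD' (fun τ hτ => ?_) ϑ ⟨h0, hϑ.2⟩
  · simp only [sub_self, Real.rpow_zero, mul_one] at h1
    linarith
  · have hτ' := Ioc_subset_Icc_self hτ
    have hi : IntervalIntegrable (fun ζ => (τ - ζ) ^ (α - 1) * (c * (1 + ‖y ζ‖))) volume 0 τ := by
      refine intervalIntegrable_kernel_smul (b := b) (C := c * (1 + D))
        (h := fun ζ => c * (1 + ‖y ζ‖)) hα.1 one_pos ?_ (fun ζ hζ => ?_) hτ'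
      · exact ((continuousOn_const.mul (continuousOn_const.add hy.norm)).mono
          Ioc_subset_Icc_self).aestronglyMeasurable measurableSet_Ioc
      · rw [Real.norm_of_nonneg (by positivity), mul_assoc]
        exact mul_le_mul_of_nonneg_left (hD' ζ hζ) hc
    have h2 := (norm_fracInt_le_integral (α := α) h hτ.1.le).trans
      (integral_kernel_mono hτ.1.le (fun ζ _ => norm_nonneg (h ζ))
        (fun ζ hζ => hh ζ ⟨hζ.1, hζ.2.trans hτ.2⟩) hi)
    simp only [mul_left_comm _ c, intervalIntegral.integral_const_mul] at h2
    simp only [sub_self, Real.rpow_zero, mul_one]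
    have h3 := norm_add_le (a τ) (fracInt α h τ)
    rw [← he τ hτ'] at h3
    have h4 := ha τ hτ'
    linarith

/-- The radial retraction onto the ball of radius `R`. -/
def ballRetract {n : ℕ} (R : ℝ) (x : Vec n) : Vec n := (R / max R ‖x‖) • x

theorem ballRetract_of_le {n : ℕ} {R : ℝ} (hR : 0 < R) {x : Vec n} (hx : ‖x‖ ≤ R) :
    ballRetract R x = x := by
  rw [ballRetract, max_eq_left hx, div_self hR.ne', one_smul]

theorem norm_ballRetract_le {n : ℕ} {R : ℝ} (hR : 0 < R) (x : Vec n) :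
    ‖ballRetract R x‖ ≤ R ∧ ‖ballRetract R x‖ ≤ ‖x‖ := by
  have h : 0 < max R ‖x‖ := lt_max_of_lt_left hR
  rw [ballRetract, norm_smul, Real.norm_of_nonneg (by positivity)]
  refine ⟨?_, mul_le_of_le_one_left (norm_nonneg _) ((div_le_one h).2 (le_max_left _ _))⟩
  rw [div_mul_eq_mul_div, div_le_iff₀ h]
  exact mul_le_mul_of_nonneg_left (le_max_right _ _) hR.le

/-- Only some Lipschitz constant is needed; 2 comes from changing the vector and the scalar factor
separately. -/
theorem norm_ballRetract_sub_le {n : ℕ} {R : ℝ} (hR : 0 < R) (x x' : Vec n) :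
    ‖ballRetract R x - ballRetract R x'‖ ≤ 2 * ‖x - x'‖ := by
  have h : 0 < max R ‖x‖ := lt_max_of_lt_left hR
  have h' : 0 < max R ‖x'‖ := lt_max_of_lt_left hR
  have e : ballRetract R x - ballRetract R x' = (R / max R ‖x‖) • (x - x') +
      (R / max R ‖x‖ - R / max R ‖x'‖) • x' := by
    simp only [ballRetract]
    module
  have h1 : ‖(R / max R ‖x‖) • (x - x')‖ ≤ ‖x - x'‖ := by
    rw [norm_smul, Real.norm_of_nonneg (by positivity)]
    exact mul_le_of_le_one_left (norm_nonneg _) ((div_le_one h).2 (le_max_left _ _))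
  have h2 : ‖(R / max R ‖x‖ - R / max R ‖x'‖) • x'‖ ≤ ‖x - x'‖ := by
    rw [norm_smul, Real.norm_eq_abs]
    have e1 : R / max R ‖x‖ - R / max R ‖x'‖ =
        R / max R ‖x‖ * ((max R ‖x'‖ - max R ‖x‖) / max R ‖x'‖) := by
      field_simp
    rw [e1, abs_mul, abs_of_pos (div_pos hR h), abs_div, abs_of_pos h', mul_assoc,
      div_mul_eq_mul_div _ _ ‖x'‖]
    have h3 : |max R ‖x'‖ - max R ‖x‖| ≤ ‖x - x'‖ := by
      rw [max_comm R, max_comm R]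
      refine (abs_max_sub_max_le_abs _ _ _).trans ?_
      rw [norm_sub_rev]
      exact abs_norm_sub_norm_le _ _
    calc _ ≤ 1 * (‖x - x'‖ * max R ‖x'‖ / max R ‖x'‖) := by
          gcongr
          · exact (div_le_one h).2 (le_max_left _ _)
          · exact le_max_right _ _
      _ = _ := by rw [one_mul, mul_div_cancel_right₀ _ h'.ne']
  rw [e, two_mul]
  exact (norm_add_le _ _).trans (add_le_add h1 h2)

theorem continuous_ballRetract {n : ℕ} {R : ℝ} (hR : 0 < R) :
    Continuous (ballRetract R : Vec n → Vec n) :=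
  ((continuous_const.div (continuous_const.max continuous_norm)
    fun _ => (lt_max_of_lt_left hR).ne').smul continuous_id)

section Existence

variable {n m : ℕ} {T α : ℝ} {P : Set (Vec m)} {f : ℝ → Vec n → Vec m → Vec n} {t : ℝ}
  {w : ℝ → Vec n} {ν : ℝ → ProbabilityMeasure P}

theorem isY_iff {y : ℝ → Vec n} :
    IsY T α f t w ν y ↔ ContinuousOn y (Icc 0 1) ∧ ∀ ϑ ∈ Icc (0 : ℝ) 1,
      y ϑ = aExt α t w (t + ϑ * (T - t)) +
        fracInt α (fun ζ => (1 / Real.Gamma α) • RStar T α f t ζ (y ζ) (ν ζ)) ϑ := by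
  refine and_congr_right fun _ => forall₂_congr fun ϑ _ => ?_
  simp only [RStar_eq, smul_smul, fracInt_const_smul]
  rw [fracInt, one_div_mul_eq_div]

theorem isZvec_iff {y z : ℝ → Vec n} :
    IsZvec T α f t w ν y z ↔ IsCWeighted α z ∧ ∀ ϑ ∈ Ioc (0 : ℝ) 1,
      z ϑ = qFun T α t w ϑ + fracInt α (fun ζ => (1 / Real.Gamma α) •
        (AStar T α f t y ζ (ν ζ) (z ζ) + bStar T α f t y ζ (ν ζ))) ϑ := by
  simp only [fracInt_const_smul]
  rfl

theorem isZmat_iff {y : ℝ → Vec n} {Z : ℝ → Vec n →L[ℝ] Vec n} :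
    IsZmat T α f t ν y Z ↔ IsCWeighted α Z ∧ ∀ ϑ ∈ Ioc (0 : ℝ) 1,
      Z ϑ = QFun T α n t ϑ + fracInt α (fun ζ => (1 / Real.Gamma α) •
        (AStar T α f t y ζ (ν ζ)).comp (Z ζ)) ϑ := by
  simp only [fracInt_const_smul]
  rfl

theorem IsCWeighted.hasPowerBound {F : Type} [NormedAddCommGroup F] {q : ℝ → F}
    (hq : IsCWeighted α q) : HasPowerBound α q :=
  let ⟨_, _, hC⟩ := hq.exists_norm_le
  hasPowerBound_of_continuousOn hq.1 hC

theorem HasPowerBound.isCWeighted {F : Type} [NormedAddCommGroup F] {q : ℝ → F}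
    (hq : HasPowerBound α q) (hc : ContinuousOn q (Ioc 0 1)) : IsCWeighted α q :=
  let ⟨_, _, _, hC⟩ := hq
  IsCWeighted.of_norm_le hc hC

theorem hasPowerBound_one_of_bound {F : Type*} [NormedAddCommGroup F] {h : ℝ → F} {C : ℝ}
    (hm : AEStronglyMeasurable h (volume.restrict (Ioc 0 1)))
    (hC : ∀ ζ ∈ Ioc (0 : ℝ) 1, ‖h ζ‖ ≤ C) : HasPowerBound 1 h :=
  HasPowerBound.of_bound (C := C) hm (by simpa using hC)

/-- A priori bound for `y(· | t, w, ν)`, uniform in positions with bounded data. -/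
theorem exists_isY_bound {c N L : ℝ} (hα : α ∈ Ioo (0 : ℝ) 1) (hT : 0 < T) (hc : 0 ≤ c)
    (hN : 0 ≤ N) (hL : 0 ≤ L) :
    ∃ R, 0 < R ∧ ∀ (y h g w : ℝ → Vec n) (t : ℝ), t ∈ Ico 0 T → IsGenerator α t w g L →
      ‖w 0‖ ≤ N → ContinuousOn y (Icc 0 1) →
      (∀ ζ ∈ Ioc (0 : ℝ) 1, ‖h ζ‖ ≤ 1 / Real.Gamma α * (T ^ α * c * (1 + ‖y ζ‖))) →
      (∀ ϑ ∈ Icc (0 : ℝ) 1, y ϑ = aExt α t w (t + ϑ * (T - t)) + fracInt α h ϑ) →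
      ∀ ϑ ∈ Icc (0 : ℝ) 1, ‖y ϑ‖ ≤ R := by
  have hΓ := Real.Gamma_pos_of_pos hα.1
  have hB := ProbabilityTheory.beta_pos hα.1 one_pos
  obtain ⟨R, hR, h⟩ := exists_volterra_bound (b := 1) (c := 1 / Real.Gamma α * (T ^ α * c))
    (K := N + (1 / Real.Gamma α) * (L * (T ^ α * ProbabilityTheory.beta α 1)))
    hα one_pos (by positivity) (by positivity)
  -- The added 1 makes the radius positive, as `ballRetract` requires.
  refine ⟨R + 1, by positivity, fun y h' g w t ht hg hw hy hh he ϑ hϑ => ?_⟩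
  refine (h y _ h' hy (fun τ hτ => ?_) (fun ζ hζ => ?_) he ϑ hϑ).trans (by linarith)
  · have h1 := mul_mem_Icc ht.1 ht.2.le hτ
    exact (hg.norm_aExt_le hα ht.1 h1.1 h1.2.2 hL).trans (add_le_add_left hw _)
  · simpa only [mul_assoc] using hh ζ hζ

theorem norm_inv_Gamma_RStar_le {c : ℝ} (hα : α ∈ Ioo (0 : ℝ) 1) (hf3 : CondF3 T f P c)
    (ht : t ∈ Ico 0 T) {ϑ : ℝ} (hϑ : ϑ ∈ Ioc (0 : ℝ) 1) (x : Vec n) (μ : ProbabilityMeasure P) :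
    ‖(1 / Real.Gamma α) • RStar T α f t ϑ x μ‖ ≤
      1 / Real.Gamma α * (T ^ α * c * (1 + ‖x‖)) := by
  have hΓ := Real.Gamma_pos_of_pos hα.1
  rw [norm_smul, Real.norm_of_nonneg (by positivity)]
  exact mul_le_mul_of_nonneg_left (norm_RStar_le hf3 ht (Ioc_subset_Icc_self hϑ) hα.1.le x μ)
    (by positivity)

/-- The right-hand side is only locally Lipschitz in x, so its argument is retracted to a ball whose
radius comes from the a priori bound. The truncated equation has a globally Lipschitz right-hand
side with the same growth; its solution stays in the ball, where the truncation has no effect. -/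
theorem exists_isY (hα : α ∈ Ioo (0 : ℝ) 1) (hP : IsCompact P) (hf1 : CondF1 T f P) {c : ℝ}
    (hc : 0 ≤ c) (hf3 : CondF3 T f P c) (hf4 : CondF4 T f P) (ht : t ∈ Ico 0 T)
    (hw : IsAC α t w) (hν : IsRelaxedControl ν) : ∃ y, IsY T α f t w ν y := by
  have hΓ := Real.Gamma_pos_of_pos hα.1
  have hT : 0 < T := ht.1.trans_lt ht.2
  obtain ⟨g, L, hL, hg⟩ := hw.exists_generator
  obtain ⟨R, hR, hbound⟩ := exists_isY_bound (n := n) hα hT hc (norm_nonneg (w 0)) hL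
  -- For a single position η = T - t is admissible.
  have htη : t ∈ Icc 0 (T - (T - t)) := ⟨ht.1, by linarith⟩
  obtain ⟨C, hC, hstar⟩ := exists_star_bounds (α := α) hP hf1 hf4 (sub_pos.2 ht.2) R
  have hac := hg.continuousOn_aExt hα ht
  obtain ⟨K, hK⟩ := isCompact_Icc.exists_bound_of_continuousOn hac
  let G : ℝ → Vec n → Vec n := fun ζ x =>
    (1 / Real.Gamma α) • RStar T α f t ζ (ballRetract R x) (ν ζ)
  have hG : ∀ ζ ∈ Ioc (0 : ℝ) 1, ∀ x, ‖G ζ x‖ ≤ 1 / Real.Gamma α * (T ^ α * c * (1 + ‖x‖)) :=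
    fun ζ hζ x => by
      refine (norm_inv_Gamma_RStar_le hα hf3 ht hζ _ _).trans ?_
      have := (norm_ballRetract_le hR x).2
      gcongr
  obtain ⟨x, hxc, hxb, hGb, hx⟩ := exists_volterra_solution (β := 1) (C := K)
    (C₀ := 1 / Real.Gamma α * (T ^ α * c)) (L := 1 / Real.Gamma α * (C * 2)) (G := G) hα one_pos
    (by positivity) (hac.mono Ioc_subset_Icc_self)
    (fun ϑ hϑ => by simpa using hK ϑ (Ioc_subset_Icc_self hϑ))
    (fun ζ hζ => by simpa using hG ζ hζ 0)
    (fun ζ hζ x x' => by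
      simp only [G]
      rw [← smul_sub, norm_smul, Real.norm_of_nonneg (by positivity), mul_assoc, mul_assoc]
      refine mul_le_mul_of_nonneg_left ?_ (by positivity)
      have h := (hstar t htη ζ (Ioc_subset_Icc_self hζ) (ν ζ)).2 t ⟨le_rfl, htη.2⟩ _ _
        (norm_ballRetract_le hR x').1 (norm_ballRetract_le hR x).1
      rw [sub_self, add_zero] at h
      exact h.trans (mul_le_mul_of_nonneg_left (norm_ballRetract_sub_le hR x x') hC))
    (fun x hx => (aestronglyMeasurable_RStar (α := α) hf1 ht hν
      ((continuous_ballRetract hR).comp_continuousOn hx)).const_smul (1 / Real.Gamma α))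
  -- The solution obtained so far is controlled on (0, 1] only. The right-hand side of its equation
  -- agrees with it there and is continuous at 0 as well.
  let y : ℝ → Vec n := fun ϑ => aExt α t w (t + ϑ * (T - t)) + fracInt α (fun ζ => G ζ (x ζ)) ϑ
  have hyx : ∀ ϑ ∈ Ioc (0 : ℝ) 1, y ϑ = x ϑ := fun ϑ hϑ => (hx ϑ hϑ).symm
  have hyc : ContinuousOn y (Icc 0 1) := by
    obtain ⟨hm, D, -, hD⟩ := hGb
    exact hac.add (continuousOn_fracInt_Icc hα.1 hm (C := D) (by simpa using hD))
  have hye : ∀ ϑ ∈ Icc (0 : ℝ) 1, y ϑ = aExt α t w (t + ϑ * (T - t)) +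
      fracInt α (fun ζ => G ζ (y ζ)) ϑ := fun ϑ hϑ => by
    simp only [y]
    congr 1
    refine fracInt_congr hϑ.1 fun ζ hζ => ?_
    rw [← hyx ζ ⟨hζ.1, hζ.2.trans hϑ.2⟩]
  have hyR := hbound y _ g w t ht hg le_rfl hyc (fun ζ hζ => hG ζ hζ (y ζ)) hye
  refine ⟨y, isY_iff.2 ⟨hyc, fun ϑ hϑ => ?_⟩⟩
  rw [hye ϑ hϑ]
  congr 1
  refine fracInt_congr hϑ.1 fun ζ hζ => ?_
  simp only [G]
  rw [ballRetract_of_le hR (hyR ζ ⟨hζ.1.le, hζ.2.trans hϑ.2⟩)]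

theorem IsY.hasPowerBound_RStar (hf1 : CondF1 T f P) {c : ℝ} (hα : α ∈ Ioo (0 : ℝ) 1)
    (hc : 0 ≤ c) (hf3 : CondF3 T f P c) (ht : t ∈ Ico 0 T) (hν : IsRelaxedControl ν)
    {y : ℝ → Vec n} (hy : ContinuousOn y (Icc 0 1)) :
    HasPowerBound 1 (fun ζ => (1 / Real.Gamma α) • RStar T α f t ζ (y ζ) (ν ζ)) := by
  have hΓ := Real.Gamma_pos_of_pos hα.1
  have hT : 0 < T := ht.1.trans_lt ht.2
  obtain ⟨D, hD⟩ := isCompact_Icc.exists_bound_of_continuousOn hy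
  refine hasPowerBound_one_of_bound (C := 1 / Real.Gamma α * (T ^ α * c * (1 + D)))
    ((aestronglyMeasurable_RStar (α := α) hf1 ht hν (hy.mono Ioc_subset_Icc_self)).const_smul
      (1 / Real.Gamma α))
    fun ζ hζ => (norm_inv_Gamma_RStar_le hα hf3 ht hζ _ _).trans ?_
  have := hD ζ (Ioc_subset_Icc_self hζ)
  gcongr

theorem IsY.eqOn (hα : α ∈ Ioo (0 : ℝ) 1) (hP : IsCompact P) (hf1 : CondF1 T f P) {c : ℝ}
    (hc : 0 ≤ c) (hf3 : CondF3 T f P c) (hf4 : CondF4 T f P) (ht : t ∈ Ico 0 T)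
    (hν : IsRelaxedControl ν) {y y' : ℝ → Vec n} (hy : IsY T α f t w ν y)
    (hy' : IsY T α f t w ν y') : EqOn y y' (Icc 0 1) := by
  have hΓ := Real.Gamma_pos_of_pos hα.1
  rw [isY_iff] at hy hy'
  obtain ⟨D, hD⟩ := isCompact_Icc.exists_bound_of_continuousOn hy.1
  obtain ⟨D', hD'⟩ := isCompact_Icc.exists_bound_of_continuousOn hy'.1
  have htη : t ∈ Icc 0 (T - (T - t)) := ⟨ht.1, by linarith⟩
  obtain ⟨C, hC, hstar⟩ := exists_star_bounds (α := α) hP hf1 hf4 (sub_pos.2 ht.2) (max D D')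
  have key : EqOn y y' (Ioc 0 1) := by
    refine eqOn_of_volterra (β := 1) (L := 1 / Real.Gamma α * C) hα one_pos (by positivity)
      (hasPowerBound_one_of_bound (C := D) ((hy.1.mono Ioc_subset_Icc_self).aestronglyMeasurable
        measurableSet_Ioc) fun ζ hζ => hD ζ (Ioc_subset_Icc_self hζ))
      (hasPowerBound_one_of_bound (C := D') ((hy'.1.mono Ioc_subset_Icc_self).aestronglyMeasurable
        measurableSet_Ioc) fun ζ hζ => hD' ζ (Ioc_subset_Icc_self hζ))
      (IsY.hasPowerBound_RStar hf1 hα hc hf3 ht hν hy.1)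
      (IsY.hasPowerBound_RStar hf1 hα hc hf3 ht hν hy'.1) (fun ζ hζ => ?_)
      (fun ϑ hϑ => hy.2 ϑ (Ioc_subset_Icc_self hϑ)) (fun ϑ hϑ => hy'.2 ϑ (Ioc_subset_Icc_self hϑ))
    have hζ' := Ioc_subset_Icc_self hζ
    rw [← smul_sub, norm_smul, Real.norm_of_nonneg (by positivity), mul_assoc]
    refine mul_le_mul_of_nonneg_left ?_ (by positivity)
    simpa using (hstar t htη ζ hζ' (ν ζ)).2 t ⟨le_rfl, htη.2⟩ _ _
      ((hD' ζ hζ').trans (le_max_right _ _)) ((hD ζ hζ').trans (le_max_left _ _))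
  intro ϑ hϑ
  rcases hϑ.1.eq_or_lt with rfl | h0
  · rw [hy.2 0 hϑ, hy'.2 0 hϑ, fracInt_zero, fracInt_zero]
  · exact key ⟨h0, hϑ.2⟩

/-! ### The linear equations for z and Z -/

section Linear

variable {y : ℝ → Vec n}

theorem exists_norm_AStar_bStar_le (hP : IsCompact P) (hf1 : CondF1 T f P) (hf4 : CondF4 T f P)
    (ht : t ∈ Ico 0 T) (hy : ContinuousOn y (Icc 0 1)) :
    ∃ C, 0 ≤ C ∧ ∀ ζ ∈ Ioc (0 : ℝ) 1, ∀ μ : ProbabilityMeasure P,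
      ‖AStar T α f t y ζ μ‖ ≤ C ∧ ‖bStar T α f t y ζ μ‖ ≤ C := by
  obtain ⟨D, hD⟩ := isCompact_Icc.exists_bound_of_continuousOn hy
  obtain ⟨C, hC, hstar⟩ := exists_star_bounds (α := α) hP hf1 hf4 (sub_pos.2 ht.2) D
  exact ⟨C, hC, fun ζ hζ μ => (hstar t ⟨ht.1, by linarith⟩ ζ (Ioc_subset_Icc_self hζ) μ).1 y
    (hD ζ (Ioc_subset_Icc_self hζ))⟩

theorem hasPowerBound_AStar_apply (hP : IsCompact P) (hf1 : CondF1 T f P) (hf4 : CondF4 T f P)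
    (ht : t ∈ Ico 0 T) (hν : IsRelaxedControl ν) (hy : ContinuousOn y (Icc 0 1)) {β : ℝ}
    {z : ℝ → Vec n} (hz : HasPowerBound β z) :
    HasPowerBound β (fun ζ => AStar T α f t y ζ (ν ζ) (z ζ)) := by
  obtain ⟨C, hC, hb⟩ := exists_norm_AStar_bStar_le (α := α) hP hf1 hf4 ht hy
  obtain ⟨hm, D, hD, hzD⟩ := hz
  refine HasPowerBound.of_bound (C := C * D) ?_ fun ζ hζ => ?_
  · exact isBoundedBilinearMap_apply.continuous.comp_aestronglyMeasurable
      ((aestronglyMeasurable_AStar hf4 ht hν (hy.mono Ioc_subset_Icc_self)).prodMk hm)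
  · rw [mul_assoc]
    exact (ContinuousLinearMap.le_opNorm _ _).trans
      (mul_le_mul (hb ζ hζ _).1 (hzD ζ hζ) (norm_nonneg _) hC)

theorem hasPowerBound_AStar_comp (hP : IsCompact P) (hf1 : CondF1 T f P) (hf4 : CondF4 T f P)
    (ht : t ∈ Ico 0 T) (hν : IsRelaxedControl ν) (hy : ContinuousOn y (Icc 0 1)) {β : ℝ}
    {Z : ℝ → Vec n →L[ℝ] Vec n} (hZ : HasPowerBound β Z) :
    HasPowerBound β (fun ζ => (AStar T α f t y ζ (ν ζ)).comp (Z ζ)) := by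
  obtain ⟨C, hC, hb⟩ := exists_norm_AStar_bStar_le (α := α) hP hf1 hf4 ht hy
  obtain ⟨hm, D, hD, hzD⟩ := hZ
  refine HasPowerBound.of_bound (C := C * D) ?_ fun ζ hζ => ?_
  · exact isBoundedBilinearMap_comp.continuous.comp_aestronglyMeasurable
      ((aestronglyMeasurable_AStar hf4 ht hν (hy.mono Ioc_subset_Icc_self)).prodMk hm)
  · rw [mul_assoc]
    exact (ContinuousLinearMap.opNorm_comp_le _ _).trans
      (mul_le_mul (hb ζ hζ _).1 (hzD ζ hζ) (norm_nonneg _) hC)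

theorem hasPowerBound_bStar (hP : IsCompact P) (hf1 : CondF1 T f P) (hf4 : CondF4 T f P)
    (ht : t ∈ Ico 0 T) (hν : IsRelaxedControl ν) (hy : ContinuousOn y (Icc 0 1)) :
    HasPowerBound 1 (fun ζ => bStar T α f t y ζ (ν ζ)) := by
  obtain ⟨C, hC, hb⟩ := exists_norm_AStar_bStar_le (α := α) hP hf1 hf4 ht hy
  exact hasPowerBound_one_of_bound
    (aestronglyMeasurable_bStar hf1 hf4 ht hν (hy.mono Ioc_subset_Icc_self))
    fun ζ hζ => (hb ζ hζ _).2

theorem exists_isZvec (hα : α ∈ Ioo (0 : ℝ) 1) (hP : IsCompact P) (hf1 : CondF1 T f P)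
    (hf4 : CondF4 T f P) (ht : t ∈ Ico 0 T) (hw : IsAC α t w) (hν : IsRelaxedControl ν)
    (hy : ContinuousOn y (Icc 0 1)) : ∃ z, IsZvec T α f t w ν y z := by
  have hΓ := Real.Gamma_pos_of_pos hα.1
  obtain ⟨g, L, hL, hg⟩ := hw.exists_generator
  obtain ⟨C, hC, hb⟩ := exists_norm_AStar_bStar_le (α := α) hP hf1 hf4 ht hy
  have hq := hg.isCWeighted_qFun hα hL ht
  obtain ⟨D, hD, hqD⟩ := hq.exists_norm_le
  obtain ⟨z, hzc, hzb, -, hz⟩ := exists_volterra_solution (β := α) (C := D)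
    (C₀ := 1 / Real.Gamma α * C) (L := 1 / Real.Gamma α * C)
    (G := fun ζ x => (1 / Real.Gamma α) •
      (AStar T α f t y ζ (ν ζ) x + bStar T α f t y ζ (ν ζ))) hα hα.1 (by positivity) hq.1 hqD
    (fun ζ hζ => by
      rw [map_zero, zero_add, norm_smul, Real.norm_of_nonneg (by positivity), mul_assoc]
      refine mul_le_mul_of_nonneg_left ((hb ζ hζ _).2.trans (le_mul_of_one_le_right hC ?_))
        (by positivity)
      exact Real.one_le_rpow_of_pos_of_le_one_of_nonpos hζ.1 hζ.2 (by linarith [hα.2]))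
    (fun ζ hζ x x' => by
      rw [← smul_sub, add_sub_add_right_eq_sub, ← map_sub, norm_smul,
        Real.norm_of_nonneg (by positivity), mul_assoc]
      exact mul_le_mul_of_nonneg_left (ContinuousLinearMap.le_of_opNorm_le _ (hb ζ hζ _).1 _)
        (by positivity))
    (fun x hx => by
      refine AEStronglyMeasurable.const_smul (AEStronglyMeasurable.add ?_
        (aestronglyMeasurable_bStar hf1 hf4 ht hν (hy.mono Ioc_subset_Icc_self))) (1 / Real.Gamma α)
      exact isBoundedBilinearMap_apply.continuous.comp_aestronglyMeasurable
        ((aestronglyMeasurable_AStar hf4 ht hν (hy.mono Ioc_subset_Icc_self)).prodMk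
          (hx.aestronglyMeasurable measurableSet_Ioc)))
  exact ⟨z, isZvec_iff.2 ⟨hzb.isCWeighted hzc, hz⟩⟩

theorem exists_isZmat (hα : α ∈ Ioo (0 : ℝ) 1) (hP : IsCompact P) (hf1 : CondF1 T f P)
    (hf4 : CondF4 T f P) (ht : t ∈ Ico 0 T) (hν : IsRelaxedControl ν)
    (hy : ContinuousOn y (Icc 0 1)) : ∃ Z, IsZmat T α f t ν y Z := by
  have hΓ := Real.Gamma_pos_of_pos hα.1
  obtain ⟨C, hC, hb⟩ := exists_norm_AStar_bStar_le (α := α) hP hf1 hf4 ht hy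
  have hq := isCWeighted_QFun (n := n) hα.1 ht.2
  obtain ⟨D, hD, hqD⟩ := hq.exists_norm_le
  obtain ⟨Z, hZc, hZb, -, hZ⟩ := exists_volterra_solution (F := Vec n →L[ℝ] Vec n) (β := α) (C := D)
    (C₀ := 0) (L := 1 / Real.Gamma α * C)
    (G := fun ζ x => (1 / Real.Gamma α) • (AStar T α f t y ζ (ν ζ)).comp x)
    hα hα.1 (by positivity) hq.1 hqD
    (fun ζ hζ => by
      rw [ContinuousLinearMap.comp_zero, zero_mul]
      exact (norm_eq_zero.2 (smul_zero (A := Vec n →L[ℝ] Vec n) (1 / Real.Gamma α))).le)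
    (fun ζ hζ x x' => by
      have h1 := ((ContinuousLinearMap.opNorm_comp_le (AStar T α f t y ζ (ν ζ)) (x - x')).trans
        (mul_le_mul_of_nonneg_right (hb ζ hζ _).1 (norm_nonneg _)))
      have h2 := norm_smul_le (1 / Real.Gamma α) ((AStar T α f t y ζ (ν ζ)).comp (x - x'))
      rw [Real.norm_of_nonneg (by positivity), ContinuousLinearMap.comp_sub] at h2
      rw [ContinuousLinearMap.comp_sub] at h1
      rw [mul_assoc]
      exact (congrArg norm (smul_sub _ _ _).symm).trans_le
        (h2.trans (mul_le_mul_of_nonneg_left h1 (by positivity))))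
    (fun x hx => by
      refine AEStronglyMeasurable.const_smul ?_ (1 / Real.Gamma α)
      exact isBoundedBilinearMap_comp.continuous.comp_aestronglyMeasurable
        ((aestronglyMeasurable_AStar hf4 ht hν (hy.mono Ioc_subset_Icc_self)).prodMk
          (hx.aestronglyMeasurable measurableSet_Ioc)))
  exact ⟨Z, isZmat_iff.2 ⟨hZb.isCWeighted hZc, hZ⟩⟩

theorem IsZvec.eqOn (hα : α ∈ Ioo (0 : ℝ) 1) (hP : IsCompact P) (hf1 : CondF1 T f P)
    (hf4 : CondF4 T f P) (ht : t ∈ Ico 0 T) (hν : IsRelaxedControl ν)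
    (hy : ContinuousOn y (Icc 0 1)) {z z' : ℝ → Vec n} (hz : IsZvec T α f t w ν y z)
    (hz' : IsZvec T α f t w ν y z') : EqOn z z' (Ioc 0 1) := by
  have hΓ := Real.Gamma_pos_of_pos hα.1
  obtain ⟨C, hC, hb⟩ := exists_norm_AStar_bStar_le (α := α) hP hf1 hf4 ht hy
  rw [isZvec_iff] at hz hz'
  have hbs := (hasPowerBound_bStar (α := α) hP hf1 hf4 ht hν hy).mono hα.2.le
  refine eqOn_of_volterra (L := 1 / Real.Gamma α * C) hα hα.1 (by positivity)
    hz.1.hasPowerBound hz'.1.hasPowerBound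
    (((hasPowerBound_AStar_apply hP hf1 hf4 ht hν hy hz.1.hasPowerBound).add hbs).const_smul _)
    (((hasPowerBound_AStar_apply hP hf1 hf4 ht hν hy hz'.1.hasPowerBound).add hbs).const_smul _)
    (fun ζ hζ => ?_) hz.2 hz'.2
  rw [← smul_sub, add_sub_add_right_eq_sub, ← map_sub, norm_smul,
    Real.norm_of_nonneg (by positivity), mul_assoc]
  exact mul_le_mul_of_nonneg_left (ContinuousLinearMap.le_of_opNorm_le _ (hb ζ hζ _).1 _)
    (by positivity)

theorem IsZmat.eqOn (hα : α ∈ Ioo (0 : ℝ) 1) (hP : IsCompact P) (hf1 : CondF1 T f P)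
    (hf4 : CondF4 T f P) (ht : t ∈ Ico 0 T) (hν : IsRelaxedControl ν)
    (hy : ContinuousOn y (Icc 0 1)) {Z Z' : ℝ → Vec n →L[ℝ] Vec n} (hZ : IsZmat T α f t ν y Z)
    (hZ' : IsZmat T α f t ν y Z') : EqOn Z Z' (Ioc 0 1) := by
  have hΓ := Real.Gamma_pos_of_pos hα.1
  obtain ⟨C, hC, hb⟩ := exists_norm_AStar_bStar_le (α := α) hP hf1 hf4 ht hy
  rw [isZmat_iff] at hZ hZ'
  refine eqOn_of_volterra (L := 1 / Real.Gamma α * C) hα hα.1 (by positivity)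
    hZ.1.hasPowerBound hZ'.1.hasPowerBound
    ((hasPowerBound_AStar_comp hP hf1 hf4 ht hν hy hZ.1.hasPowerBound).const_smul _)
    ((hasPowerBound_AStar_comp hP hf1 hf4 ht hν hy hZ'.1.hasPowerBound).const_smul _)
    (fun ζ hζ => ?_) hZ.2 hZ'.2
  rw [← smul_sub, ← ContinuousLinearMap.comp_sub, norm_smul,
    Real.norm_of_nonneg (by positivity), mul_assoc]
  refine mul_le_mul_of_nonneg_left ((ContinuousLinearMap.opNorm_comp_le _ _).trans ?_)
    (by positivity)
  exact mul_le_mul_of_nonneg_right (hb ζ hζ _).1 (norm_nonneg _)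

end Linear

end Existence

end FracControl

namespace FracControl

/-! ### Uniform bounds on the sets of positions -/

variable {n : ℕ}

/-- The growth condition on the Caputo derivative bounds ‖x‖ by some R common to the whole set, by
the Volterra a priori bound. The generator is then at most N(1 + R) almost everywhere. -/
theorem exists_generator_of_mem_XN {α T N : ℝ} (hα : α ∈ Ioo (0 : ℝ) 1) (hT : 0 < T)
    (hN : 0 ≤ N) :
    ∃ L, 0 ≤ L ∧ ∀ x ∈ XN n α T N, ∃ g, IsGenerator α T x g L := by
  have hΓ := Real.Gamma_pos_of_pos hα.1
  obtain ⟨R, hR, hbound⟩ := exists_volterra_bound (c := 1 / Real.Gamma α * N) hα hT (by positivity)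
    hN
  refine ⟨N * (1 + R), by positivity, fun x hx => ?_⟩
  obtain ⟨hac, hx0, hxN⟩ := hx
  obtain ⟨g, L, -, hg⟩ := hac.exists_generator
  have hgN : ∀ᵐ τ ∂(volume.restrict (Icc 0 T)), ‖g τ‖ ≤ N * (1 + ‖x τ‖) := by
    filter_upwards [hxN, hg.caputo_ae hα] with τ h1 h2
    rwa [← h2]
  have hxc : ContinuousOn x (Icc 0 T) :=
    ((continuousOn_const (c := x 0)).add ((continuousOn_fracInt_Icc hα.1
      hg.meas.aestronglyMeasurable fun ζ _ => hg.bound ζ).const_smul (1 / Real.Gamma α))).congr hg.eq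
  classical
  -- The a priori bound asks for growth at every point, but here it holds almost everywhere; the
  -- generator is set to zero on the exceptional set.
  let h : ℝ → Vec n := fun τ =>
    (1 / Real.Gamma α) • if ‖g τ‖ ≤ N * (1 + ‖x τ‖) then g τ else 0
  have hxR := hbound x (fun _ => x 0) h hxc (fun _ _ => hx0) (fun ζ _ => by
    simp only [h]
    rw [norm_smul, Real.norm_of_nonneg (by positivity), mul_assoc]
    refine mul_le_mul_of_nonneg_left ?_ (by positivity)
    split_ifs with h1
    · exact h1
    · rw [norm_zero]; positivity) (fun τ hτ => by
    rw [fracInt_const_smul]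
    refine (hg.eq τ hτ).trans ?_
    congr 2
    refine fracInt_congr_ae hτ.1 ?_
    filter_upwards [ae_restrict_of_ae_restrict_of_subset
      (Ioc_subset_Icc_self.trans (Icc_subset_Icc_right hτ.2)) hgN] with ζ hζ
    rw [if_pos hζ])
  obtain ⟨g', hg', -⟩ := exists_generator_of_ae (L := N * (1 + R)) (by positivity)
    hg.meas.aestronglyMeasurable (by
      filter_upwards [hgN, ae_restrict_mem measurableSet_Icc] with τ h1 h2
      have := hxR τ h2
      refine h1.trans ?_
      gcongr) hg.eq
  exact ⟨g', hg'⟩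

theorem exists_generator_of_mem_GNη {α T N η : ℝ} (hα : α ∈ Ioo (0 : ℝ) 1) (hT : 0 < T)
    (hN : 0 ≤ N) (hη : 0 < η) :
    ∃ L, 0 ≤ L ∧ ∀ t (w : ℝ → Vec n), (t, w) ∈ GNη n α T N η →
      t ∈ Icc 0 (T - η) ∧ ‖w 0‖ ≤ N ∧ ∃ g, IsGenerator α t w g L := by
  obtain ⟨L, hL, h⟩ := exists_generator_of_mem_XN (n := n) hα hT hN
  refine ⟨L, hL, fun t w hw => ?_⟩
  obtain ⟨ht, -, x, hx, hwx⟩ := hw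
  obtain ⟨g, hg⟩ := h x hx
  have hw0 : w 0 = x 0 := hwx ⟨le_rfl, ht.1⟩
  refine ⟨ht, hw0 ▸ hx.2.1, g, hg.meas, hg.bound, fun τ hτ => ?_⟩
  rw [hw0]
  exact (hwx hτ).trans (hg.eq τ ⟨hτ.1, hτ.2.trans (ht.2.trans (by linarith))⟩)

theorem IsGenerator.mono {α t L L' : ℝ} {w g : ℝ → Vec n} (h : IsGenerator α t w g L)
    (hL : L ≤ L') : IsGenerator α t w g L' :=
  ⟨h.meas, fun ξ => (h.bound ξ).trans hL, h.eq⟩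

theorem xDir_zero {α t : ℝ} (ht : 0 ≤ t) (w : ℝ → Vec n) (v : Vec n) :
    FracControl.xDir α t w v 0 = w 0 := by
  rw [FracControl.xDir, if_pos ht]

/-- A form of the Gronwall inequality for perturbed linear Volterra inequalities. -/
theorem exists_gronwall_perturbed {α β L : ℝ} (hα : α ∈ Ioo (0 : ℝ) 1) (hβ : 0 < β)
    (hL : 0 ≤ L) :
    ∃ A, 0 < A ∧ ∀ (x h : ℝ → Vec n) (K E : ℝ), 0 ≤ K → 0 ≤ E → HasPowerBound β x →
      (∀ ϑ ∈ Ioc (0 : ℝ) 1,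
        ‖x ϑ‖ ≤ K * ϑ ^ (β - 1) + ∫ ζ in (0 : ℝ)..ϑ, (ϑ - ζ) ^ (α - 1) * ‖h ζ‖) →
      (∀ ζ ∈ Ioc (0 : ℝ) 1, ‖h ζ‖ ≤ L * ‖x ζ‖ + E * ζ ^ (β - 1)) →
      ∀ ϑ ∈ Ioc (0 : ℝ) 1, ‖x ϑ‖ ≤ A * (K + E) * ϑ ^ (β - 1) := by
  obtain ⟨A, hA, hgron⟩ := exists_gronwall_const hα hβ one_pos hL
  have hB := ProbabilityTheory.beta_pos hα.1 hβ
  set B := ProbabilityTheory.beta α β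
  -- The forcing Eζ^(β-1) contributes EBτ^(α+β-1) ≤ EBτ^(β-1), as τ ≤ 1, and K + EB ≤ (1 + B)(K +
  -- E).
  refine ⟨A * (1 + B), by positivity, fun x h K E hK hE hxb hx hh ϑ hϑ => ?_⟩
  obtain ⟨hxm, D, hD, hxD⟩ := id hxb
  have h1 := hgron (fun τ => ‖x τ‖) (K + E * B) D (by positivity)
    (fun τ _ => norm_nonneg (x τ)) hxD (fun τ hτ => ?_) ϑ hϑ
  · have hp := Real.rpow_nonneg hϑ.1.le (β - 1)
    refine h1.trans (mul_le_mul_of_nonneg_right ?_ hp)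
    rw [mul_assoc]
    refine mul_le_mul_of_nonneg_left ?_ hA.le
    nlinarith [mul_nonneg hB.le hK]
  · have hn : HasPowerBound β fun ζ => L * ‖x ζ‖ :=
      HasPowerBound.const_smul ⟨hxm.norm, by simpa using hxb.2⟩ L
    have hi1 : IntervalIntegrable (fun ζ => (τ - ζ) ^ (α - 1) * (L * ‖x ζ‖)) volume 0 τ :=
      hn.intervalIntegrable hα.1 hβ ⟨hτ.1.le, hτ.2⟩
    have hi2 := (intervalIntegrable_kernel_mul_rpow hα.1 hβ hτ.1.le).const_mul E
    simp only [mul_left_comm E] at hi2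
    have hi : IntervalIntegrable (fun ζ => (τ - ζ) ^ (α - 1) * (L * ‖x ζ‖ + E * ζ ^ (β - 1)))
        volume 0 τ := by
      simp only [mul_add]
      exact hi1.add hi2
    have h2 := integral_kernel_mono hτ.1.le (fun ζ _ => norm_nonneg (h ζ))
      (fun ζ hζ => hh ζ ⟨hζ.1, hζ.2.trans hτ.2⟩) hi
    simp only [mul_add] at h2
    rw [intervalIntegral.integral_add hi1 hi2] at h2
    simp only [mul_left_comm _ L, mul_left_comm _ E, intervalIntegral.integral_const_mul,
      integral_kernel_mul_rpow hα.1 hβ hτ.1] at h2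
    have h3 : τ ^ (α + β - 1) ≤ τ ^ (β - 1) :=
      Real.rpow_le_rpow_of_exponent_ge hτ.1 hτ.2 (by linarith [hα.1])
    have h4 : E * (τ ^ (α + β - 1) * B) ≤ E * (τ ^ (β - 1) * B) := by gcongr
    have h5 := hx τ hτ
    calc _ ≤ K * τ ^ (β - 1) + (L * (∫ ζ in (0 : ℝ)..τ, (τ - ζ) ^ (α - 1) * ‖x ζ‖) +
          E * (τ ^ (β - 1) * B)) := by linarith
      _ = _ := by ring

/-- Below ϑ₀ the spare factor ϑ^(α/2) makes the crude bound small in the weaker weight; above ϑ₀ the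
second hypothesis takes over. This converts convergence away from zero into convergence on all of
(0, 1]. -/
theorem le_mul_rpow_half {α C ε ϑ₀ ϑ r : ℝ} (hα : 0 < α) (hϑ : ϑ ∈ Ioc (0 : ℝ) 1)
    (hC : 0 ≤ C) (hCε : C * ϑ₀ ^ (α / 2) ≤ ε) (hε : 0 ≤ ε) (h1 : r ≤ C * ϑ ^ (α - 1))
    (h2 : ϑ₀ ≤ ϑ → r ≤ ε * ϑ ^ (α - 1)) : r ≤ ε * ϑ ^ (α / 2 - 1) := by
  have hp := Real.rpow_nonneg hϑ.1.le (α / 2 - 1)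
  rcases le_total ϑ₀ ϑ with h | h
  · exact (h2 h).trans (mul_le_mul_of_nonneg_left
      (rpow_le_rpow_of_mem_Ioc (by linarith) hϑ) hε)
  · refine h1.trans ?_
    rw [show α - 1 = α / 2 + (α / 2 - 1) by ring, Real.rpow_add hϑ.1, ← mul_assoc]
    refine mul_le_mul_of_nonneg_right (le_trans ?_ hCε) hp
    have := hϑ.1.le
    gcongr

theorem exists_pos_mul_rpow_le {γ C ε : ℝ} (hγ : 0 < γ) (hε : 0 < ε) :
    ∃ s, 0 < s ∧ C * s ^ γ ≤ ε := by
  have h : ContinuousAt (fun s : ℝ => C * s ^ γ) 0 :=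
    (continuousAt_id.rpow_const (Or.inr hγ.le)).const_mul C
  have h1 : Tendsto (fun s : ℝ => C * s ^ γ) (𝓝[>] 0) (𝓝 0) := by
    have := h.tendsto.mono_left (nhdsWithin_le_nhds (s := Ioi 0))
    simpa [Real.zero_rpow hγ.ne'] using this
  obtain ⟨s, hs, hs0⟩ := ((h1.eventually_le_const hε).and self_mem_nhdsWithin).exists
  exact ⟨s, hs0, hs⟩

theorem one_div_smul_sub_smul {E : Type*} [AddCommGroup E] [Module ℝ E] {δ : ℝ} (hδ : δ ≠ 0)
    (x y : E) : (1 / δ) • (x - δ • y) = (1 / δ) • x - y := by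
  rw [smul_sub, smul_smul, one_div_mul_cancel hδ, one_smul]

/-- Uniform smallness of the error of the linear approximation of the free term. -/
theorem exists_freeTerm_error_le {α T η L M ε : ℝ} (hα : α ∈ Ioo (0 : ℝ) 1) (hη : 0 < η)
    (hL : 0 ≤ L) (hM : 0 ≤ M) (hε : 0 < ε) :
    ∃ δ₀ ∈ Ioc 0 (η / 2), ∀ (t : ℝ) (w g : ℝ → Vec n) (v : Vec n) (δ ϑ : ℝ), t ∈ Icc 0 (T - η) →
      IsGenerator α t w g L → ‖v‖ ≤ M → δ ∈ Ioc 0 δ₀ → ϑ ∈ Ioc (0 : ℝ) 1 →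
      ‖(1 / δ) • (aExt α (t + δ) (xDir α t w v) (t + δ + ϑ * (T - (t + δ))) -
        aExt α t w (t + ϑ * (T - t))) - qFun T α t w ϑ - QFun T α n t ϑ v‖ ≤
        ε * ϑ ^ (α / 2 - 1) := by
  have hΓ := Real.Gamma_pos_of_pos hα.1
  obtain ⟨C₁, hC₁, h₁⟩ := exists_norm_aExt_sub_le (n := n) (T := T) hα hη hL hM
  -- The three summands bound the difference quotient, q and Qv, each as a multiple of ϑ^(α-1).
  set C := C₁ + 1 / Real.Gamma α * L * η ^ (α - 1) + 1 / Real.Gamma α * η ^ (α - 1) * M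
  have hC : 0 ≤ C := by positivity
  obtain ⟨ϑ₀, hϑ₀, hCϑ₀⟩ := exists_pos_mul_rpow_le (C := C) (half_pos hα.1) hε
  obtain ⟨C₂, hC₂, h₂⟩ := exists_norm_aExt_sub_sub_le (n := n) (T := T) hα hη hL hM hϑ₀
  -- For ϑ ≥ ϑ₀ the error is at most C₂δ after division by δ.
  refine ⟨min (η / 2) (ε / (C₂ + 1)), ⟨lt_min (half_pos hη) (by positivity), min_le_left _ _⟩,
    fun t w g v δ ϑ ht hg hv hδ hϑ => ?_⟩
  have hδ' : δ ∈ Ioc 0 (η / 2) := ⟨hδ.1, hδ.2.trans (min_le_left _ _)⟩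
  have hδn : ‖1 / δ‖ = 1 / δ := Real.norm_of_nonneg (by have := hδ.1; positivity)
  have hp := Real.rpow_nonneg hϑ.1.le (α - 1)
  have ht' : t ∈ Ico 0 T := ⟨ht.1, by linarith [ht.2]⟩
  have hs : (T - t) ^ (α - 1) ≤ η ^ (α - 1) :=
    Real.rpow_le_rpow_of_nonpos hη (by linarith [ht.2]) (by linarith [hα.2])
  refine le_mul_rpow_half hα.1 hϑ hC hCϑ₀ hε.le ?_ fun hge => ?_
  · have e1 := h₁ t w g v δ ϑ ht hg hv hδ' hϑ
    have e2 : ‖qFun T α t w ϑ‖ ≤ 1 / Real.Gamma α * L * η ^ (α - 1) * ϑ ^ (α - 1) :=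
      (hg.norm_qFun_le hα hL ht' hϑ).trans (by gcongr)
    have e3 : ‖QFun T α n t ϑ v‖ ≤ 1 / Real.Gamma α * η ^ (α - 1) * ϑ ^ (α - 1) * M := by
      refine (ContinuousLinearMap.le_opNorm _ _).trans (mul_le_mul
        ((norm_QFun_le hα.1 ht'.2 hϑ.1).trans ?_) hv (norm_nonneg _) (by positivity))
      gcongr
    refine (norm_sub_le _ _).trans ((add_le_add ((norm_sub_le _ _).trans
      (add_le_add (b := C₁ * ϑ ^ (α - 1)) ?_ e2)) e3).trans_eq (by ring))
    rw [norm_smul, hδn]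
    calc _ ≤ 1 / δ * (C₁ * δ * ϑ ^ (α - 1)) :=
          mul_le_mul_of_nonneg_left e1 (by have := hδ.1; positivity)
      _ = _ := by have := hδ.1.ne'; field_simp
  · have e1 := h₂ t w g v δ ϑ ht hg hv hδ' ⟨hge, hϑ.2⟩
    have e2 : δ * (C₂ + 1) ≤ ε := (le_div_iff₀ (by positivity)).1 (hδ.2.trans (min_le_right _ _))
    have hδ0 := hδ.1
    set D := aExt α (t + δ) (xDir α t w v) (t + δ + ϑ * (T - (t + δ))) -
      aExt α t w (t + ϑ * (T - t))
    calc _ = ‖(1 / δ) • (D - δ • (qFun T α t w ϑ + QFun T α n t ϑ v))‖ := by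
          congr 1
          rw [one_div_smul_sub_smul hδ0.ne', sub_add_eq_sub_sub]
      _ ≤ 1 / δ * (C₂ * δ ^ 2) := by
          rw [norm_smul, hδn]
          exact mul_le_mul_of_nonneg_left e1 (by positivity)
      _ = δ * C₂ := by field_simp
      _ ≤ ε := by linarith
      _ ≤ _ := le_mul_of_one_le_right hε.le
        (Real.one_le_rpow_of_pos_of_le_one_of_nonpos hϑ.1 hϑ.2 (by linarith [hα.2]))

/-! ### Linearization error of the right-hand side -/

variable {m : ℕ} {T α : ℝ} {P : Set (Vec m)} {f : ℝ → Vec n → Vec m → Vec n}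

/-- Uniform smallness of the error of the linear approximation of the right-hand side. -/
theorem exists_rhs_error_le (hα : α ∈ Ioo (0 : ℝ) 1) (hP : IsCompact P) (hf1 : CondF1 T f P)
    (hf4 : CondF4 T f P) {η lam ε : ℝ} (hη : 0 < η) (R : ℝ) (hlam : 0 ≤ lam) (hε : 0 < ε) :
    ∃ δ₀ ∈ Ioc 0 (η / 2), ∀ t ∈ Icc 0 (T - η), ∀ δ ∈ Ioc 0 δ₀, ∀ ζ ∈ Ioc (0 : ℝ) 1,
      ∀ y y' : ℝ → Vec n, ‖y ζ‖ ≤ R → ‖y' ζ‖ ≤ R → ‖y' ζ - y ζ‖ ≤ lam * δ * ζ ^ (α - 1) →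
      ∀ μ : ProbabilityMeasure P,
      ‖(1 / δ) • (RStar T α f (t + δ) ζ (y' ζ) μ - RStar T α f t ζ (y ζ) μ) -
        AStar T α f t y ζ μ ((1 / δ) • (y' ζ - y ζ)) - bStar T α f t y ζ μ‖ ≤
        ε * ζ ^ (α / 2 - 1) := by
  obtain ⟨C, hC, hstar⟩ := exists_star_bounds (α := α) hP hf1 hf4 (half_pos hη) R
  -- One C bounds the increment of the right-hand side, the other its linear part; both multiply ‖y'
  -- - y‖ + δ ≤ δ(lam + 1)ζ^(α-1).
  set C' := 2 * C * (lam + 1)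
  have hC' : 0 ≤ C' := by positivity
  obtain ⟨ϑ₀, hϑ₀, hCϑ₀⟩ := exists_pos_mul_rpow_le (C := C') (half_pos hα.1) hε
  obtain ⟨ρ, hρ, hmod⟩ := exists_star_modulus (α := α) hP hf1 hf4 (half_pos hη) R
    (ε := ε / (lam + 1)) (by positivity)
  have hq : 0 ≤ lam * ϑ₀ ^ (α - 1) := by positivity
  -- The first bound keeps t + δ in [0, T - η/2], the second controls the time increment, and the
  -- third forces ‖y' - y‖ ≤ lam·δ·ϑ₀^(α-1) ≤ ρ for ζ ≥ ϑ₀.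
  refine ⟨min (η / 2) (min ρ (ρ / (lam * ϑ₀ ^ (α - 1) + 1))),
    ⟨lt_min (half_pos hη) (lt_min hρ (by positivity)), min_le_left _ _⟩,
    fun t ht δ hδ ζ hζ y y' hy hy' hyy μ => ?_⟩
  have hδ0 := hδ.1
  have hδη : δ ≤ η / 2 := hδ.2.trans (min_le_left _ _)
  have hδρ : δ ≤ ρ := hδ.2.trans ((min_le_right _ _).trans (min_le_left _ _))
  have hδρ' : δ * (lam * ϑ₀ ^ (α - 1) + 1) ≤ ρ :=
    (le_div_iff₀ (by positivity)).1 (hδ.2.trans ((min_le_right _ _).trans (min_le_right _ _)))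
  have ht1 : t ∈ Icc 0 (T - η / 2) := ⟨ht.1, by linarith [ht.2]⟩
  have ht2 : t + δ ∈ Icc t (T - η / 2) := ⟨by linarith, by linarith [ht.2]⟩
  have hζ' := Ioc_subset_Icc_self hζ
  have hp1 : 1 ≤ ζ ^ (α - 1) :=
    Real.one_le_rpow_of_pos_of_le_one_of_nonpos hζ.1 hζ.2 (by linarith [hα.2])
  have hsum : ‖y' ζ - y ζ‖ + δ ≤ δ * ((lam + 1) * ζ ^ (α - 1)) := by nlinarith
  have hδn : ‖1 / δ‖ = 1 / δ := Real.norm_of_nonneg (by positivity)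
  set D := RStar T α f (t + δ) ζ (y' ζ) μ - RStar T α f t ζ (y ζ) μ
  have e : (1 / δ) • D - AStar T α f t y ζ μ ((1 / δ) • (y' ζ - y ζ)) - bStar T α f t y ζ μ =
      (1 / δ) • (D - AStar T α f t y ζ μ (y' ζ - y ζ) - δ • bStar T α f t y ζ μ) := by
    rw [map_smul, one_div_smul_sub_smul hδ0.ne', smul_sub _ D]
  rw [e, norm_smul, hδn]
  refine le_mul_rpow_half hα.1 hζ hC' hCϑ₀ hε.le ?_ fun hge => ?_
  · obtain ⟨hb, hd⟩ := hstar t ht1 ζ hζ' μ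
    have h1 := hd (t + δ) ht2 _ _ hy hy'
    rw [add_sub_cancel_left] at h1
    have h2 := ContinuousLinearMap.le_of_opNorm_le _ (hb y hy).1 (y' ζ - y ζ)
    have h3 : ‖δ • bStar T α f t y ζ μ‖ ≤ δ * C := by
      rw [norm_smul, Real.norm_of_nonneg hδ0.le]
      exact mul_le_mul_of_nonneg_left (hb y hy).2 hδ0.le
    calc _ ≤ 1 / δ * (2 * C * (‖y' ζ - y ζ‖ + δ)) := by
          refine mul_le_mul_of_nonneg_left ?_ (by positivity)
          refine (norm_sub_le _ _).trans ((add_le_add ((norm_sub_le _ _).trans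
            (add_le_add h1 h2)) h3).trans_eq (by ring))
      _ ≤ 1 / δ * (2 * C * (δ * ((lam + 1) * ζ ^ (α - 1)))) := by gcongr
      _ = _ := by simp only [C']; field_simp
  · have h1 : ‖y' ζ - y ζ‖ ≤ ρ := by
      have h2 : ζ ^ (α - 1) ≤ ϑ₀ ^ (α - 1) :=
        Real.rpow_le_rpow_of_nonpos hϑ₀ hge (by linarith [hα.2])
      calc _ ≤ lam * δ * ϑ₀ ^ (α - 1) := hyy.trans (by gcongr)
        _ ≤ δ * (lam * ϑ₀ ^ (α - 1) + 1) := by linarith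
        _ ≤ ρ := hδρ'
    have h2 := hmod t ht1 (t + δ) ht2 (by linarith) ζ hζ' y (y' ζ) hy hy' h1 μ
    rw [add_sub_cancel_left] at h2
    calc _ ≤ 1 / δ * (ε / (lam + 1) * (δ * ((lam + 1) * ζ ^ (α - 1)))) :=
          mul_le_mul_of_nonneg_left (h2.trans (mul_le_mul_of_nonneg_left hsum (by positivity)))
            (by positivity)
      _ = _ := by field_simp

end FracControl

namespace FracControl

/-! ### Increments of solutions -/

variable {n m : ℕ} {T α : ℝ} {P : Set (Vec m)} {f : ℝ → Vec n → Vec m → Vec n}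

/-- Subtracting the two equations leaves a free term of size C₁δϑ^(α-1) and a right-hand side
Lipschitz in (x, t) on the common ball; the perturbed Gronwall inequality with β = α does the rest.
-/
theorem exists_isY_sub_bounds (hα : α ∈ Ioo (0 : ℝ) 1) (hT : 0 < T) (hP : IsCompact P)
    (hf1 : CondF1 T f P) {c : ℝ} (hc : 0 ≤ c) (hf3 : CondF3 T f P c) (hf4 : CondF4 T f P)
    {N L M η : ℝ} (hN : 0 ≤ N) (hL : 0 ≤ L) (hM : 0 ≤ M) (hη : 0 < η) :
    ∃ R lam, 0 ≤ R ∧ 0 ≤ lam ∧ ∀ (t : ℝ) (w g : ℝ → Vec n) (v : Vec n) (δ : ℝ)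
      (ν : ℝ → ProbabilityMeasure P) (y y' : ℝ → Vec n), t ∈ Icc 0 (T - η) →
      IsGenerator α t w g L → ‖w 0‖ ≤ N → ‖v‖ ≤ M → IsRelaxedControl ν → δ ∈ Ioc 0 (η / 2) →
      IsY T α f t w ν y → IsY T α f (t + δ) (xDir α t w v) ν y' →
      (∀ ϑ ∈ Icc (0 : ℝ) 1, ‖y ϑ‖ ≤ R ∧ ‖y' ϑ‖ ≤ R) ∧
      ∀ ϑ ∈ Ioc (0 : ℝ) 1, ‖y' ϑ - y ϑ‖ ≤ lam * δ * ϑ ^ (α - 1) := by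
  have hΓ := Real.Gamma_pos_of_pos hα.1
  -- The bound max(L, M) covers the generators of both positions, since the continued one takes the
  -- value `v`.
  obtain ⟨R, hR, hbound⟩ := exists_isY_bound (n := n) hα hT hc hN
    (le_max_of_le_left hL : (0 : ℝ) ≤ max L M)
  obtain ⟨C, hC, hstar⟩ := exists_star_bounds (α := α) hP hf1 hf4 (half_pos hη) R
  obtain ⟨C₁, hC₁, h₁⟩ := exists_norm_aExt_sub_le (n := n) (T := T) hα hη hL hM
  obtain ⟨A, hA, hgron⟩ := exists_gronwall_perturbed (n := n) (L := 1 / Real.Gamma α * C) hα hα.1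
    (by positivity)
  refine ⟨R, A * (C₁ + 1 / Real.Gamma α * C), hR.le, by positivity,
    fun t w g v δ ν y y' ht hg hw hv hν hδ hy hy' => ?_⟩
  rw [isY_iff] at hy hy'
  have hδ0 := hδ.1
  have ht1 : t ∈ Ico 0 T := ⟨ht.1, by linarith [ht.2]⟩
  have ht2 : t + δ ∈ Ico 0 T := ⟨by linarith [ht.1], by linarith [ht.2, hδ.2]⟩
  have hyR : ∀ ϑ ∈ Icc (0 : ℝ) 1, ‖y ϑ‖ ≤ R :=
    hbound y _ g w t ht1 (hg.mono (le_max_left _ _)) hw hy.1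
      (fun ζ hζ => norm_inv_Gamma_RStar_le hα hf3 ht1 hζ _ _) hy.2
  have hyR' : ∀ ϑ ∈ Icc (0 : ℝ) 1, ‖y' ϑ‖ ≤ R :=
    hbound y' _ _ _ (t + δ) ht2 ((hg.xDir hα ht.1 v).mono (max_le_max le_rfl hv))
      ((xDir_zero ht.1 w v).symm ▸ hw) hy'.1
      (fun ζ hζ => norm_inv_Gamma_RStar_le hα hf3 ht2 hζ _ _) hy'.2
  refine ⟨fun ϑ hϑ => ⟨hyR ϑ hϑ, hyR' ϑ hϑ⟩, fun ϑ hϑ => ?_⟩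
  have hpy : HasPowerBound 1 y := hasPowerBound_one_of_bound
    ((hy.1.mono Ioc_subset_Icc_self).aestronglyMeasurable measurableSet_Ioc)
    fun ζ hζ => hyR ζ (Ioc_subset_Icc_self hζ)
  have hpy' : HasPowerBound 1 y' := hasPowerBound_one_of_bound
    ((hy'.1.mono Ioc_subset_Icc_self).aestronglyMeasurable measurableSet_Ioc)
    fun ζ hζ => hyR' ζ (Ioc_subset_Icc_self hζ)
  have hr := IsY.hasPowerBound_RStar hf1 hα hc hf3 ht1 hν hy.1
  have hr' := IsY.hasPowerBound_RStar hf1 hα hc hf3 ht2 hν hy'.1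
  have key := hgron (fun ζ => y' ζ - y ζ)
    (fun ζ => (1 / Real.Gamma α) • RStar T α f (t + δ) ζ (y' ζ) (ν ζ) -
      (1 / Real.Gamma α) • RStar T α f t ζ (y ζ) (ν ζ))
    (C₁ * δ) (1 / Real.Gamma α * C * δ) (by positivity) (by positivity)
    ((hpy'.sub hpy).mono hα.2.le) (fun τ hτ => ?_) (fun ζ hζ => ?_) ϑ hϑ
  · exact key.trans_eq (by ring)
  · have hτ' := Ioc_subset_Icc_self hτ
    rw [hy'.2 τ hτ', hy.2 τ hτ', add_sub_add_comm]
    exact (norm_add_le _ _).trans (add_le_add (h₁ t w g v δ τ ht hg hv hδ hτ)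
      (hr'.norm_fracInt_sub_le hα.1 one_pos hr hτ'))
  · have hζ' := Ioc_subset_Icc_self hζ
    have h1 := (hstar t ⟨ht.1, by linarith [ht.2]⟩ ζ hζ' (ν ζ)).2 (t + δ)
      ⟨by linarith, by linarith [ht.2, hδ.2]⟩ _ _ (hyR ζ hζ') (hyR' ζ hζ')
    rw [add_sub_cancel_left] at h1
    have hp1 : 1 ≤ ζ ^ (α - 1) :=
      Real.one_le_rpow_of_pos_of_le_one_of_nonpos hζ.1 hζ.2 (by linarith [hα.2])
    rw [← smul_sub, norm_smul, Real.norm_of_nonneg (by positivity)]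
    calc _ ≤ 1 / Real.Gamma α * (C * (‖y' ζ - y ζ‖ + δ)) :=
          mul_le_mul_of_nonneg_left h1 (by positivity)
      _ = 1 / Real.Gamma α * C * ‖y' ζ - y ζ‖ + 1 / Real.Gamma α * C * δ * 1 := by ring
      _ ≤ _ := by gcongr

theorem HasPowerBound.fracInt_clm_apply {β τ : ℝ} {H : ℝ → Vec n →L[ℝ] Vec n} (hα : 0 < α)
    (hβ : 0 < β) (hH : HasPowerBound β H) (hτ : τ ∈ Icc (0 : ℝ) 1) (v : Vec n) :
    (fracInt α H τ) v = fracInt α (fun ζ => H ζ v) τ :=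
  ContinuousLinearMap.intervalIntegral_apply (hH.intervalIntegrable hα hβ hτ) v

theorem HasPowerBound.clm_apply {β : ℝ} {H : ℝ → Vec n →L[ℝ] Vec n} (hH : HasPowerBound β H)
    (v : Vec n) : HasPowerBound β (fun ζ => H ζ v) := by
  obtain ⟨hm, C, hC, hHC⟩ := hH
  refine HasPowerBound.of_bound (C := C * ‖v‖) (hm.apply_continuousLinearMap v) fun ζ hζ => ?_
  rw [mul_right_comm]
  exact ContinuousLinearMap.le_of_opNorm_le _ (hHC ζ hζ) v

/-- Uniform differentiability of `y(· | t, w, ν)` in the direction `(1, v)` with respect to the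
norm weighted by a power. -/
theorem exists_norm_quotient_sub_le (hα : α ∈ Ioo (0 : ℝ) 1) (hT : 0 < T) (hP : IsCompact P)
    (hf1 : CondF1 T f P) {c : ℝ} (hc : 0 ≤ c) (hf3 : CondF3 T f P c) (hf4 : CondF4 T f P)
    {N L M η ε : ℝ} (hN : 0 ≤ N) (hL : 0 ≤ L) (hM : 0 ≤ M) (hη : 0 < η) (hε : 0 < ε) :
    ∃ δ₀ ∈ Ioc 0 (η / 2), ∀ (t : ℝ) (w g : ℝ → Vec n) (v : Vec n) (δ : ℝ)
      (ν : ℝ → ProbabilityMeasure P) (y y' z : ℝ → Vec n) (Z : ℝ → Vec n →L[ℝ] Vec n),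
      t ∈ Icc 0 (T - η) → IsGenerator α t w g L → ‖w 0‖ ≤ N → ‖v‖ ≤ M → IsRelaxedControl ν →
      δ ∈ Ioc 0 δ₀ → IsY T α f t w ν y → IsY T α f (t + δ) (xDir α t w v) ν y' →
      IsZvec T α f t w ν y z → IsZmat T α f t ν y Z → ∀ ϑ ∈ Ioc (0 : ℝ) 1,
        ‖(1 / δ) • (y' ϑ - y ϑ) - z ϑ - Z ϑ v‖ ≤ ε * ϑ ^ (α / 2 - 1) := by
  have hΓ := Real.Gamma_pos_of_pos hα.1
  obtain ⟨R, lam, hR, hlam, hbounds⟩ := exists_isY_sub_bounds hα hT hP hf1 hc hf3 hf4 hN hL hM hη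
  obtain ⟨C, hC, hstar⟩ := exists_star_bounds (α := α) hP hf1 hf4 hη R
  obtain ⟨A, hA, hgron⟩ := exists_gronwall_perturbed (n := n) (β := α / 2)
    (L := 1 / Real.Gamma α * C) hα (half_pos hα.1) (by positivity)
  -- Free term and forcing each get ε/(2A), so that A(K + E) = ε. The factor Γ(α) in the second
  -- budget cancels the 1/Γ(α) before the integral.
  have hε1 : 0 < ε / (2 * A) := by positivity
  obtain ⟨δ₁, hδ₁, hfree⟩ := exists_freeTerm_error_le (n := n) (T := T) hα hη hL hM hε1
  obtain ⟨δ₂, hδ₂, hrhs⟩ := exists_rhs_error_le hα hP hf1 hf4 hη R hlam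
    (ε := Real.Gamma α * (ε / (2 * A))) (by positivity)
  refine ⟨min δ₁ δ₂, ⟨lt_min hδ₁.1 hδ₂.1, (min_le_left _ _).trans hδ₁.2⟩,
    fun t w g v δ ν y y' z Z ht hg hw hv hν hδ hy hy' hz hZ => ?_⟩
  have hδ0 := hδ.1
  have hδ1 : δ ∈ Ioc 0 δ₁ := ⟨hδ0, hδ.2.trans (min_le_left _ _)⟩
  have hδ2 : δ ∈ Ioc 0 δ₂ := ⟨hδ0, hδ.2.trans (min_le_right _ _)⟩
  have hδη : δ ∈ Ioc 0 (η / 2) := ⟨hδ0, hδ1.2.trans hδ₁.2⟩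
  have ht1 : t ∈ Ico 0 T := ⟨ht.1, by linarith [ht.2]⟩
  have ht2 : t + δ ∈ Ico 0 T := ⟨by linarith [ht.1], by linarith [ht.2, hδη.2]⟩
  obtain ⟨hyR, hyy⟩ := hbounds t w g v δ ν y y' ht hg hw hv hν hδη hy hy'
  rw [isY_iff] at hy hy'
  rw [isZvec_iff] at hz
  rw [isZmat_iff] at hZ
  set h : ℝ → Vec n := fun ζ => (1 / Real.Gamma α) • RStar T α f t ζ (y ζ) (ν ζ) with hh
  set h' : ℝ → Vec n := fun ζ => (1 / Real.Gamma α) • RStar T α f (t + δ) ζ (y' ζ) (ν ζ) with hh'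
  set k : ℝ → Vec n := fun ζ => (1 / Real.Gamma α) •
    (AStar T α f t y ζ (ν ζ) (z ζ) + bStar T α f t y ζ (ν ζ)) with hk
  set K : ℝ → Vec n →L[ℝ] Vec n := fun ζ => (1 / Real.Gamma α) •
    (AStar T α f t y ζ (ν ζ)).comp (Z ζ) with hK
  have hr : HasPowerBound 1 h := IsY.hasPowerBound_RStar hf1 hα hc hf3 ht1 hν hy.1
  have hr' : HasPowerBound 1 h' := IsY.hasPowerBound_RStar hf1 hα hc hf3 ht2 hν hy'.1
  have hkb : HasPowerBound α k :=
    ((hasPowerBound_AStar_apply hP hf1 hf4 ht1 hν hy.1 hz.1.hasPowerBound).add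
      ((hasPowerBound_bStar hP hf1 hf4 ht1 hν hy.1).mono hα.2.le)).const_smul _
  have hKb : HasPowerBound α K :=
    (hasPowerBound_AStar_comp hP hf1 hf4 ht1 hν hy.1 hZ.1.hasPowerBound).const_smul _
  have hd : HasPowerBound α (fun ζ => (1 / δ) • (h' ζ - h ζ)) :=
    ((hr'.sub hr).const_smul _).mono hα.2.le
  have hpy : HasPowerBound 1 y := hasPowerBound_one_of_bound
    ((hy.1.mono Ioc_subset_Icc_self).aestronglyMeasurable measurableSet_Ioc)
    fun ζ hζ => (hyR ζ (Ioc_subset_Icc_self hζ)).1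
  have hpy' : HasPowerBound 1 y' := hasPowerBound_one_of_bound
    ((hy'.1.mono Ioc_subset_Icc_self).aestronglyMeasurable measurableSet_Ioc)
    fun ζ hζ => (hyR ζ (Ioc_subset_Icc_self hζ)).2
  -- The remainder naturally lies in the class with exponent α; it is relaxed to α/2, the weight in
  -- which the errors are small.
  have hrb : HasPowerBound (α / 2) (fun ζ => (1 / δ) • (y' ζ - y ζ) - z ζ - Z ζ v) :=
    (((((hpy'.sub hpy).const_smul _).mono hα.2.le).sub hz.1.hasPowerBound).sub
      (hZ.1.hasPowerBound.clm_apply v)).mono (half_le_self hα.1.le)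
  have hint : ∀ τ ∈ Icc (0 : ℝ) 1,
      fracInt α (fun ζ => (1 / δ) • (h' ζ - h ζ) - k ζ - K ζ v) τ =
        (1 / δ) • (fracInt α h' τ - fracInt α h τ) - fracInt α k τ - fracInt α K τ v :=
    fun τ hτ => by
      rw [(hd.sub hkb).fracInt_sub hα.1 hα.1 (hKb.clm_apply v) hτ,
        hd.fracInt_sub hα.1 hα.1 hkb hτ, fracInt_const_smul,
        hr'.fracInt_sub hα.1 one_pos hr hτ, hKb.fracInt_clm_apply hα.1 hα.1 hτ]
  intro ϑ hϑ
  have key := hgron (fun ζ => (1 / δ) • (y' ζ - y ζ) - z ζ - Z ζ v)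
    (fun ζ => (1 / δ) • (h' ζ - h ζ) - k ζ - K ζ v)
    (ε / (2 * A)) (ε / (2 * A)) hε1.le hε1.le hrb (fun τ hτ => ?_) (fun ζ hζ => ?_) ϑ hϑ
  · refine key.trans_eq ?_
    field_simp
    ring
  · have hτ' := Ioc_subset_Icc_self hτ
    -- The remainder satisfies a Volterra relation whose free term is the linearization error of a +
    -- q + Qv type.
    have e : (1 / δ) • (y' τ - y τ) - z τ - Z τ v =
        ((1 / δ) • (aExt α (t + δ) (xDir α t w v) (t + δ + τ * (T - (t + δ))) -
          aExt α t w (t + τ * (T - t))) - qFun T α t w τ - QFun T α n t τ v) +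
        fracInt α (fun ζ => (1 / δ) • (h' ζ - h ζ) - k ζ - K ζ v) τ := by
      rw [hint τ hτ', hy'.2 τ hτ', hy.2 τ hτ', hz.2 τ hτ, hZ.2 τ hτ, add_sub_add_comm, smul_add]
      rw [add_apply]
      abel
    rw [e]
    exact (norm_add_le _ _).trans (add_le_add (hfree t w g v δ τ ht hg hv hδ1 hτ)
      (norm_fracInt_le_integral _ hτ.1.le))
  · have hζ' := Ioc_subset_Icc_self hζ
    obtain ⟨h1, h1'⟩ := hyR ζ hζ'
    have h2 := hrhs t ht δ hδ2 ζ hζ y y' h1 h1' (hyy ζ hζ) (ν ζ)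
    have h3 := ((hstar t ht ζ hζ' (ν ζ)).1 y h1).1
    set a := AStar T α f t y ζ (ν ζ)
    set r := (1 / δ) • (y' ζ - y ζ) - z ζ - Z ζ v with hrdef
    -- The integrand is A* applied to the remainder plus the linearization error of the right-hand
    -- side, which is the form required by the perturbed Gronwall inequality.
    have e : (1 / δ) • (h' ζ - h ζ) - k ζ - K ζ v = (1 / Real.Gamma α) • (a r +
        ((1 / δ) • (RStar T α f (t + δ) ζ (y' ζ) (ν ζ) - RStar T α f t ζ (y ζ) (ν ζ)) -
          a ((1 / δ) • (y' ζ - y ζ)) - bStar T α f t y ζ (ν ζ))) := by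
      have e1 : a r = a ((1 / δ) • (y' ζ - y ζ)) - a (z ζ) - a (Z ζ v) := by
        rw [hrdef, map_sub, map_sub]
      have e2 : K ζ v = (1 / Real.Gamma α) • a (Z ζ v) := rfl
      rw [e1, e2]
      simp only [hh, hh', hk]
      module
    rw [e, norm_smul, Real.norm_of_nonneg (by positivity)]
    calc _ ≤ 1 / Real.Gamma α * (C * ‖r‖ +
          Real.Gamma α * (ε / (2 * A)) * ζ ^ (α / 2 - 1)) :=
          mul_le_mul_of_nonneg_left ((norm_add_le _ _).trans
            (add_le_add (ContinuousLinearMap.le_of_opNorm_le _ h3 r) h2)) (by positivity)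
      _ = _ := by field_simp

end FracControl

end

/-! ### The main theorem -/

theorem mainTheorem6 {n m : ℕ} (α T : ℝ) (hα : α ∈ Set.Ioo (0 : ℝ) 1) (hT : 0 < T)
    (P : Set (Vec m)) (hP : IsCompact P) (f : ℝ → Vec n → Vec m → Vec n)
    (hf1 : CondF1 T f P) (c_f : ℝ) (hc_f : 0 ≤ c_f) (hf3 : CondF3 T f P c_f)
    (hf4 : CondF4 T f P)
    (N M η : ℝ) (hN : c_f ≤ N) (hM : 0 ≤ M) (hη : η ∈ Set.Ioo 0 T) :
    -- the solutions that the estimates speak about exist and are unique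
    (∀ t w, (t, w) ∈ positions n α T →
      ∀ ν : ℝ → ProbabilityMeasure P, IsRelaxedControl ν →
        (∃ y, IsY T α f t w ν y) ∧
        (∀ y y', IsY T α f t w ν y → IsY T α f t w ν y' → Set.EqOn y y' (Set.Icc 0 1)) ∧
        ∀ y, IsY T α f t w ν y →
          (∃ z, IsZvec T α f t w ν y z) ∧
          (∀ z z', IsZvec T α f t w ν y z → IsZvec T α f t w ν y z' →
            Set.EqOn z z' (Set.Ioc 0 1)) ∧
          (∃ Z, IsZmat T α f t ν y Z) ∧
          (∀ Z Z', IsZmat T α f t ν y Z → IsZmat T α f t ν y Z' →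
            Set.EqOn Z Z' (Set.Ioc 0 1))) ∧
    -- `(t + δ, x^(v)_{t + δ}(· | t, w))` is again a position
    (∀ t w, (t, w) ∈ GNη n α T N η → ∀ v : Vec n, ‖v‖ ≤ M → ∀ δ ∈ Set.Icc 0 (η / 2),
      (t + δ, xDir α t w v) ∈ positions n α T) ∧
    -- the difference quotients are bounded
    (∃ lam_y : ℝ, 0 ≤ lam_y ∧
      ∀ t w, (t, w) ∈ GNη n α T N η → ∀ v : Vec n, ‖v‖ ≤ M →
      ∀ ν : ℝ → ProbabilityMeasure P, IsRelaxedControl ν →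
      ∀ δ ∈ Set.Ioc 0 (η / 2), ∀ y yδ : ℝ → Vec n,
        IsY T α f t w ν y → IsY T α f (t + δ) (xDir α t w v) ν yδ →
        ∀ ϑ ∈ Set.Ioc (0 : ℝ) 1,
          ‖(1 / δ) • (yδ ϑ - y ϑ)‖ ≤ lam_y / ϑ ^ (1 - α)) ∧
    -- uniform convergence at `ϑ = 1`
    (∀ ε : ℝ, 0 < ε → ∃ δ₀ ∈ Set.Ioc 0 (η / 2),
      ∀ t w, (t, w) ∈ GNη n α T N η → ∀ v : Vec n, ‖v‖ ≤ M →
      ∀ ν : ℝ → ProbabilityMeasure P, IsRelaxedControl ν →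
      ∀ δ ∈ Set.Ioc 0 δ₀, ∀ y yδ z : ℝ → Vec n, ∀ Z : ℝ → Vec n →L[ℝ] Vec n,
        IsY T α f t w ν y → IsY T α f (t + δ) (xDir α t w v) ν yδ →
        IsZvec T α f t w ν y z → IsZmat T α f t ν y Z →
          ‖(1 / δ) • (yδ 1 - y 1) - z 1 - Z 1 v‖ ≤ ε) := by
  obtain ⟨L, hL, hgen⟩ := exists_generator_of_mem_GNη (n := n) hα hT (hc_f.trans hN) hη.1
  refine ⟨fun t w htw ν hν => ?_, fun t w htw v _ δ hδ => ?_, ?_, fun ε hε => ?_⟩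
  · obtain ⟨ht, hw⟩ : t ∈ Ico 0 T ∧ IsAC α t w := htw
    exact ⟨exists_isY hα hP hf1 hc_f hf3 hf4 ht hw hν,
      fun y y' hy hy' => hy.eqOn hα hP hf1 hc_f hf3 hf4 ht hν hy',
      fun y hy => ⟨exists_isZvec hα hP hf1 hf4 ht hw hν hy.1,
        fun z z' hz hz' => hz.eqOn hα hP hf1 hf4 ht hν hy.1 hz',
        exists_isZmat hα hP hf1 hf4 ht hν hy.1,
        fun Z Z' hZ hZ' => hZ.eqOn hα hP hf1 hf4 ht hν hy.1 hZ'⟩⟩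
  · obtain ⟨ht, -, g, hg⟩ := hgen t w htw
    exact ⟨⟨add_nonneg ht.1 hδ.1, by linarith [ht.2, hδ.2, hη.1]⟩, (hg.xDir hα ht.1 v).isAC⟩
  · obtain ⟨R, lam, -, hlam, h⟩ :=
      exists_isY_sub_bounds hα hT hP hf1 hc_f hf3 hf4 (hc_f.trans hN) hL hM hη.1
    refine ⟨lam, hlam, fun t w htw v hv ν hν δ hδ y yδ hy hyδ ϑ hϑ => ?_⟩
    obtain ⟨ht, hw, g, hg⟩ := hgen t w htw
    have hb := (h t w g v δ ν y yδ ht hg hw hv hν hδ hy hyδ).2 ϑ hϑ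
    have hδ0 := hδ.1
    rw [norm_smul, Real.norm_of_nonneg (by positivity), one_div, inv_mul_le_iff₀ hδ0,
      div_eq_mul_inv, ← Real.rpow_neg hϑ.1.le, neg_sub]
    exact hb.trans_eq (by ring)
  · obtain ⟨δ₀, hδ₀, h⟩ :=
      exists_norm_quotient_sub_le hα hT hP hf1 hc_f hf3 hf4 (hc_f.trans hN) hL hM hη.1 hε
    refine ⟨δ₀, hδ₀, fun t w htw v hv ν hν δ hδ y yδ z Z hy hyδ hz hZ => ?_⟩
    obtain ⟨ht, hw, g, hg⟩ := hgen t w htw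
    simpa using h t w g v δ ν y yδ z Z ht hg hw hv hν hδ hy hyδ hz hZ 1 ⟨zero_lt_one, le_rfl⟩
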